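/- Let $(M,\omega)$ be a closed (compact, without boundary), connected symplectic manifold with a smooth symplectic action of $SU(2)$, where $SU(2)$ is identified with the group of unit quaternions. Let $c_2(M)\in H^4(M)$ be the second Chern class of $TM$ with respect to an $\omega$-compatible almost complex structure, and assume that $c_2(M)$ is monotone, that is, it vanishes on the image of $\pi_4(M)\to H_4(M;\mathbb Q)$: $\int_{S^4}f^*c_2(M)=0$ for every smooth map $f:S^4\to M$. For a fixed point $x$ of the action, let $SU(2)$ act on $T_xM$ by the isotropy representation, make $T_xM$ a complex representation by means of an $SU(2)$-invariant $\omega_x$-compatible complex structure, and let $$E_x=S^7\times_{SU(2)}T_xM\longrightarrow S^4$$ be the complex vector bundle associated to the principal $SU(2)$-bundle $S^7=U(\mathbb H^2)\to S^4$ (quaternionic Hopf bundle); equivalently, $E_x$ is the bundle with clutching function $SU(2)=S^3\to GL(T_xM)$ given by the representation. Then for any two fixed points $x_1,x_2\in M$ of the action, $E_{x_1}$ and $E_{x_2}$ have the same second Chern class: $\int_{S^4}c_2(E_{x_1})=\int_{S^4}c_2(E_{x_2})$. Here $c_2$ of a complex vector bundle is represented by the closed form $\frac{1}{8\pi^2}\bigl(\operatorname{tr}(R\wedge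 R)-\operatorname{tr}R\wedge\operatorname{tr}R\bigr)$, where $R$ is the curvature of an arbitrary smooth complex-linear connection on the bundle, and $H^4(S^4;\mathbb Z)$ is identified with $\mathbb Z$ by evaluation on $[S^4]$. -/

import Mathlib

open scoped Manifold ContDiff Quaternion Topology
open Bundle FiberBundle

set_option linter.unusedSectionVars false

noncomputable section

namespace SU2Action

/-! ### Curvature of a connection and the second Chern form -/

section Curvature

variable {E : Type*} [NormedAddCommGroup E] [NormedSpace ℝ E] [FiniteDimensional ℝ E]
  {H : Type*} [TopologicalSpace H] {I : ModelWithCorners ℝ E H}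
  {M : Type*} [TopologicalSpace M] [ChartedSpace H M] [IsManifold I ∞ M] [T2Space M]
  {F : Type*} [NormedAddCommGroup F] [NormedSpace ℝ F]
  {V : M → Type*} [TopologicalSpace (TotalSpace F V)]
  [∀ x, AddCommGroup (V x)] [∀ x, Module ℝ (V x)] [∀ x, TopologicalSpace (V x)]
  [∀ x, IsTopologicalAddGroup (V x)] [∀ x, ContinuousSMul ℝ (V x)]
  [FiberBundle F V] [VectorBundle ℝ F V] [ContMDiffVectorBundle ∞ F V I]

theorem contMDiffOn_extend {x : M} (v : V x) :
    ContMDiffOn I (I.prod 𝓘(ℝ, F)) ∞ (fun y ↦ TotalSpace.mk' F y (extend F v y))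
      (trivializationAt F V x).baseSet := by
  intro y hy
  set t := trivializationAt F V x
  refine ContMDiffAt.contMDiffWithinAt ?_
  rw [t.contMDiffAt_section_iff hy]
  refine (contMDiffAt_const (c := (t ⟨x, v⟩).2)).congr_of_eventuallyEq ?_
  filter_upwards [t.open_baseSet.mem_nhds hy] with z hz
  simp [extend, t, hz]

theorem exists_smooth_section (x : M) (v : V x) :
    ∃ σ : Π y, V y, ContMDiff I (I.prod 𝓘(ℝ, F)) ∞ (fun y ↦ TotalSpace.mk' F y (σ y)) ∧
      ∀ᶠ y in 𝓝 x, σ y = extend F v y := by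
  set t := trivializationAt F V x
  obtain ⟨ψ, -, hψ⟩ := (SmoothBumpFunction.nhds_basis_tsupport (I := I) x).mem_iff.1
    (t.open_baseSet.mem_nhds (mem_baseSet_trivializationAt F V x))
  refine ⟨fun y ↦ ψ y • extend F v y, fun y ↦ ?_, ?_⟩
  · by_cases hy : y ∈ tsupport ψ
    · exact ψ.contMDiff.contMDiffAt.smul_section
        ((contMDiffOn_extend v).contMDiffAt (t.open_baseSet.mem_nhds (hψ hy)))
    · have h0 : ContMDiff I (I.prod 𝓘(ℝ, F)) ∞ (fun y ↦ TotalSpace.mk' F y (0 : V y)) :=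
        contMDiff_zeroSection ℝ V
      refine (h0 y).congr_of_eventuallyEq ?_
      filter_upwards [(isClosed_tsupport ψ).isOpen_compl.mem_nhds hy] with z hz
      simp [image_eq_zero_of_notMem_tsupport hz]
  · filter_upwards [ψ.eventuallyEq_one] with y hy
    simp [hy]

theorem mdifferentiableAt_cov_extend (cov : CovariantDerivative I F V)
    (hcov : cov.ContMDiffCovariantDerivative ∞) {x : M} (u : TangentSpace I x) (v : V x) :
    MDifferentiableAt I (I.prod 𝓘(ℝ, F))
      (fun y ↦ TotalSpace.mk' F y (cov (extend F v) y (extend E u y))) x := by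
  obtain ⟨σ, hσ, hσv⟩ := exists_smooth_section (I := I) (F := F) x v
  have h1 := (hcov.contMDiff.contMDiff (σ := σ) (hσ.contMDiffOn)) x trivial
  have h2 := (h1.contMDiffAt Filter.univ_mem).mdifferentiableAt (by simp)
  have h3 := MDifferentiableAt.clm_bundle_apply (F₁ := E) (F₂ := F) (b := id)
    (ϕ := fun y ↦ cov σ y) (v := fun y ↦ extend E u y) h2 (mdifferentiableAt_extend ..)
  refine h3.congr_of_eventuallyEq ?_
  have hb := (trivializationAt F V x).open_baseSet.mem_nhds (mem_baseSet_trivializationAt F V x)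
  filter_upwards [eventually_eventually_nhds.2 hσv, hb] with y hy hyb
  have := cov.isCovariantDerivativeOnUniv.congr_of_eventuallyEq (σ := extend F v) (σ' := σ)
    (((contMDiffOn_extend v).contMDiffAt
      ((trivializationAt F V x).open_baseSet.mem_nhds hyb)).mdifferentiableAt (by simp))
    ((hσ y).mdifferentiableAt (by simp)) Filter.univ_mem (hy.mono fun z hz ↦ hz.symm)
  simp [this]

theorem mdifferentiableAt_extend_of_mem {x y : M} (v : V x)
    (hy : y ∈ (trivializationAt F V x).baseSet) :
    MDifferentiableAt I (I.prod 𝓘(ℝ, F)) (fun y ↦ TotalSpace.mk' F y (extend F v y)) y :=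
  ((contMDiffOn_extend v).contMDiffAt
    ((trivializationAt F V x).open_baseSet.mem_nhds hy)).mdifferentiableAt (by simp)

theorem cov_extend_add (cov : CovariantDerivative I F V) {x y : M} (v w : V x)
    (hy : y ∈ (trivializationAt F V x).baseSet) :
    cov (extend F (v + w)) y = cov (extend F v) y + cov (extend F w) y := by
  have hv := mdifferentiableAt_extend_of_mem (I := I) (F := F) v hy
  have hw := mdifferentiableAt_extend_of_mem (I := I) (F := F) w hy
  rw [← cov.isCovariantDerivativeOnUniv.add hv hw]
  refine cov.isCovariantDerivativeOnUniv.congr_of_eventuallyEq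
    (mdifferentiableAt_extend_of_mem (v + w) hy) (mdifferentiableAt_add_section hv hw)
    Filter.univ_mem ?_
  filter_upwards [(trivializationAt F V x).open_baseSet.mem_nhds hy] with z hz
  have h := (trivializationAt F V x).linear ℝ (mem_baseSet_trivializationAt F V x)
  simp only [extend, Pi.add_apply]
  rw [h.map_add, ← Trivialization.coe_symmₗ (R := ℝ) _ hz, map_add]

theorem cov_extend_smul (cov : CovariantDerivative I F V) {x y : M} (c : ℝ) (v : V x)
    (hy : y ∈ (trivializationAt F V x).baseSet) :
    cov (extend F (c • v)) y = c • cov (extend F v) y := by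
  have hv := mdifferentiableAt_extend_of_mem (I := I) (F := F) v hy
  rw [← cov.isCovariantDerivativeOnUniv.smul_const c hv]
  refine cov.isCovariantDerivativeOnUniv.congr_of_eventuallyEq
    (mdifferentiableAt_extend_of_mem (c • v) hy) (mdifferentiableAt_const.smul_section hv)
    Filter.univ_mem ?_
  filter_upwards [(trivializationAt F V x).open_baseSet.mem_nhds hy] with z hz
  have h := (trivializationAt F V x).linear ℝ (mem_baseSet_trivializationAt F V x)
  simp only [extend, Pi.smul_apply]
  rw [h.map_smul, ← Trivialization.coe_symmₗ (R := ℝ) _ hz, map_smul]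

/-- The second covariant derivative expression `∇_X ∇_Y σ - ∇_Y ∇_X σ - ∇_{[X, Y]} σ`. -/
def curvatureAux (cov : CovariantDerivative I F V) (X Y : Π y : M, TangentSpace I y)
    (σ : Π y : M, V y) (x : M) : V x :=
  cov (fun y ↦ cov σ y (Y y)) x (X x) - cov (fun y ↦ cov σ y (X y)) x (Y x)
    - cov σ x (VectorField.mlieBracket I X Y x)

/-- The curvature endomorphism `R(u, v)` of the fibre `V x`: the value at `x` of
`∇_X ∇_Y σ - ∇_Y ∇_X σ - ∇_{[X, Y]} σ`, where `X`, `Y`, `σ` extend `u`, `v` and the argument. -/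
def curvature (cov : CovariantDerivative I F V) (hcov : cov.ContMDiffCovariantDerivative ∞)
    (x : M) (u v : TangentSpace I x) : V x →ₗ[ℝ] V x where
  toFun w := curvatureAux cov (extend E u) (extend E v) (extend F w) x
  map_add' w w' := by
    have hb := (trivializationAt F V x).open_baseSet.mem_nhds
      (mem_baseSet_trivializationAt F V x)
    have key : ∀ a b : TangentSpace I x,
        cov (fun y ↦ cov (extend F (w + w')) y (extend E a y)) x b =
          cov (fun y ↦ cov (extend F w) y (extend E a y)) x b +
          cov (fun y ↦ cov (extend F w') y (extend E a y)) x b := by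
      intro a b
      have h1 := mdifferentiableAt_cov_extend cov hcov a w
      have h2 := mdifferentiableAt_cov_extend cov hcov a w'
      rw [← add_apply, ← cov.isCovariantDerivativeOnUniv.add h1 h2]
      congr 1
      refine cov.isCovariantDerivativeOnUniv.congr_of_eventuallyEq
        (mdifferentiableAt_cov_extend cov hcov a (w + w')) (mdifferentiableAt_add_section h1 h2)
        Filter.univ_mem ?_
      filter_upwards [hb] with y hy
      rw [cov_extend_add cov w w' hy]
      simp
    simp only [curvatureAux, key,
      cov_extend_add cov w w' (mem_baseSet_trivializationAt F V x), add_apply]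
    abel
  map_smul' c w := by
    have hb := (trivializationAt F V x).open_baseSet.mem_nhds
      (mem_baseSet_trivializationAt F V x)
    have key : ∀ a b : TangentSpace I x,
        cov (fun y ↦ cov (extend F (c • w)) y (extend E a y)) x b =
          c • cov (fun y ↦ cov (extend F w) y (extend E a y)) x b := by
      intro a b
      have h1 := mdifferentiableAt_cov_extend cov hcov a w
      rw [← smul_apply, ← cov.isCovariantDerivativeOnUniv.smul_const c h1]
      congr 1
      refine cov.isCovariantDerivativeOnUniv.congr_of_eventuallyEq
        (mdifferentiableAt_cov_extend cov hcov a (c • w)) (mdifferentiableAt_const.smul_section h1)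
        Filter.univ_mem ?_
      filter_upwards [hb] with y hy
      rw [cov_extend_smul cov c w hy]
      simp
    simp only [curvatureAux, key,
      cov_extend_smul cov c w (mem_baseSet_trivializationAt F V x), smul_apply,
      RingHom.id_apply, smul_sub]

/-- The complex trace of a `J`-linear endomorphism `A` of a real vector space `W` with complex
structure `J`, `J ^ 2 = -1`: its real part is half the real trace of `A`, its imaginary part is
minus half the real trace of `J A`. -/
def complexTrace {W : Type*} [AddCommGroup W] [Module ℝ W] (J A : W →ₗ[ℝ] W) : ℂ :=
  ⟨LinearMap.trace ℝ W A / 2, -(LinearMap.trace ℝ W (J ∘ₗ A) / 2)⟩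

variable (I F) in
/-- A smooth connection on the real vector bundle `V` with fibrewise complex structure `J`, for
which `J` is parallel, that is, a smooth connection on the complex vector bundle `(V, J)`. -/
structure ComplexConnection (J : Π x : M, V x →L[ℝ] V x) where
  cov : CovariantDerivative I F V
  smooth : cov.ContMDiffCovariantDerivative ∞
  complexLinear : ∀ σ : Π x : M, V x,
    ContMDiff I (I.prod 𝓘(ℝ, F)) ∞ (fun x ↦ TotalSpace.mk' F x (σ x)) →
    ∀ x, cov (fun y ↦ J y (σ y)) x = (J x).comp (cov σ x)

/-- The second Chern form `(tr (R ∧ R) - tr R ∧ tr R) / (8 π ^ 2)` of a connection with curvature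
`R` on the complex vector bundle `(V, J)`. The wedge product of two 2-forms is
`(α ∧ β) (v₀, v₁, v₂, v₃) = 1/4 ∑ sign s • α (v_{s 0}, v_{s 1}) β (v_{s 2}, v_{s 3})`. -/
def ComplexConnection.secondChernForm {J : Π x : M, V x →L[ℝ] V x}
    (D : ComplexConnection I F J) (x : M) (v : Fin 4 → TangentSpace I x) : ℂ :=
  let R := fun i j ↦ curvature D.cov D.smooth x (v i) (v j)
  let tr := complexTrace (J x : V x →ₗ[ℝ] V x)
  (1 / (8 * (Real.pi : ℂ) ^ 2)) * ((1 / 4) * ∑ s : Equiv.Perm (Fin 4), ((s.sign : ℤ) : ℂ) *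
    (tr (R (s 0) (s 1) ∘ₗ R (s 2) (s 3)) - tr (R (s 0) (s 1)) * tr (R (s 2) (s 3))))

end Curvature

/-! ### The spheres `S³ = SU(2)` and `S⁴` -/

/-- `SU(2)`, identified with the group of unit quaternions, whose underlying manifold is the
unit sphere in `ℍ = ℝ⁴`. -/
abbrev SU2 : Type := Metric.sphere (0 : ℍ[ℝ]) 1

instance : Group SU2 := inferInstance

instance : Monoid SU2 := inferInstance

instance finrankQuaternionFact : Fact (Module.finrank ℝ ℍ[ℝ] = 3 + 1) :=
  ⟨Quaternion.finrank_eq_four⟩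

/-- The unit sphere in `ℝ⁵`. -/
abbrev S4 : Type := Metric.sphere (0 : EuclideanSpace ℝ (Fin 5)) 1

theorem inverseStereographic_mem (y : EuclideanSpace ℝ (Fin 4)) :
    (!₂[2 * y 0 / (1 + ‖y‖ ^ 2), 2 * y 1 / (1 + ‖y‖ ^ 2), 2 * y 2 / (1 + ‖y‖ ^ 2),
      2 * y 3 / (1 + ‖y‖ ^ 2), (1 - ‖y‖ ^ 2) / (1 + ‖y‖ ^ 2)] : EuclideanSpace ℝ (Fin 5)) ∈
      Metric.sphere (0 : EuclideanSpace ℝ (Fin 5)) 1 := by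
  have h0 : (1 + ‖y‖ ^ 2 : ℝ) ≠ 0 := by positivity
  have hy : ‖y‖ ^ 2 = y 0 ^ 2 + y 1 ^ 2 + y 2 ^ 2 + y 3 ^ 2 := by
    simp [EuclideanSpace.norm_sq_eq, Fin.sum_univ_four]
  rw [mem_sphere_zero_iff_norm, ← sq_eq_sq₀ (norm_nonneg _) zero_le_one,
    EuclideanSpace.norm_sq_eq]
  simp only [Fin.sum_univ_five, Real.norm_eq_abs, sq_abs]
  simp
  field_simp
  rw [hy]
  ring

/-- The inverse of stereographic projection from the pole `(0, 0, 0, 0, -1)`, a diffeomorphism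
from `ℝ⁴` onto the complement of that pole, compatible with the standard orientations. -/
def inverseStereographic (y : EuclideanSpace ℝ (Fin 4)) : S4 :=
  ⟨_, inverseStereographic_mem y⟩

/-- The integral over `S⁴` of a (smooth) differential 4-form: the integral over `ℝ⁴` of its
pull-back by inverse stereographic projection. -/
def integralS4 (η : Π b : S4, (Fin 4 → TangentSpace (𝓡 4) b) → ℂ) : ℂ :=
  ∫ y : EuclideanSpace ℝ (Fin 4), η (inverseStereographic y) fun i ↦
    mfderiv (𝓡 4) (𝓡 4) inverseStereographic y
      (EuclideanSpace.single i (1 : ℝ) : EuclideanSpace ℝ (Fin 4))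

/-- The quaternion formed by the first four coordinates of a point of `S⁴`. -/
def quaternionPart (b : S4) : ℍ[ℝ] :=
  ⟨b.1 0, b.1 1, b.1 2, b.1 3⟩

open Classical in
/-- The projection `q / |q|` of a point `b = (q, t)` of `S⁴ ⊆ ℍ × ℝ` with `q ≠ 0` (that is, `b` is
not a pole) to the equator `S³ = SU(2)`; the value at the poles is not used. -/
def toEquator (b : S4) : SU2 :=
  if h : quaternionPart b = 0 then 1
  else ⟨‖quaternionPart b‖⁻¹ • quaternionPart b, by
    rw [mem_sphere_zero_iff_norm, norm_smul, norm_inv, norm_norm,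
      inv_mul_cancel₀ (norm_ne_zero_iff.2 h)]⟩

/-! ### Vector bundles over `S⁴` associated to representations of `SU(2)` -/

/-- A smooth representation of `SU(2)` on the real vector space `W`. -/
structure SmoothRep (W : Type*) [NormedAddCommGroup W] [NormedSpace ℝ W] where
  toHom : SU2 →* (W →L[ℝ] W)
  smooth : ContMDiff (𝓡 3) 𝓘(ℝ, W →L[ℝ] W) ∞ toHom

theorem contMDiff_inv_SU2 : ContMDiff (𝓡 3) (𝓡 3) ∞ (fun g : SU2 ↦ g⁻¹) := by
  let L : ℍ[ℝ] →ₗ[ℝ] ℍ[ℝ] :=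
    { toFun := star
      map_add' := star_add
      map_smul' := fun c q ↦ Quaternion.star_smul c q }
  have h : ContMDiff (𝓡 3) 𝓘(ℝ, ℍ[ℝ]) ∞ (fun g : SU2 ↦ star (g : ℍ[ℝ])) :=
    (LinearMap.toContinuousLinearMap L).contDiff.contMDiff.comp contMDiff_coe_sphere
  have h' := h.codRestrict_sphere (n := 3) (fun g ↦ by simp)
  refine h'.congr fun g ↦ ?_
  ext1
  have hg : Quaternion.normSq (g : ℍ[ℝ]) = 1 := by
    rw [Quaternion.normSq_eq_norm_mul_self]; simp
  simp [Quaternion.inv_def, hg]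

theorem contMDiff_quaternionPart : ContMDiff (𝓡 4) 𝓘(ℝ, ℍ[ℝ]) ∞ quaternionPart := by
  let L : EuclideanSpace ℝ (Fin 5) →ₗ[ℝ] ℍ[ℝ] :=
    { toFun := fun b ↦ ⟨b 0, b 1, b 2, b 3⟩
      map_add' := fun a b ↦ rfl
      map_smul' := fun c b ↦ by ext <;> rfl }
  have : Fact (Module.finrank ℝ (EuclideanSpace ℝ (Fin 5)) = 4 + 1) := ⟨by simp⟩
  exact (LinearMap.toContinuousLinearMap L).contDiff.contMDiff.comp contMDiff_coe_sphere

theorem contMDiffOn_toEquator :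
    ContMDiffOn (𝓡 4) (𝓡 3) ∞ toEquator {b | quaternionPart b ≠ 0} := by
  let U : TopologicalSpace.Opens S4 :=
    ⟨{b | quaternionPart b ≠ 0}, isOpen_ne_fun contMDiff_quaternionPart.continuous continuous_const⟩
  have h1 : ContMDiff (𝓡 4) 𝓘(ℝ, ℍ[ℝ]) ∞
      (fun b : U ↦ ‖quaternionPart b‖⁻¹ • quaternionPart b) := by
    intro b
    have h2 : ContDiffAt ℝ ∞ (fun q : ℍ[ℝ] ↦ ‖q‖⁻¹ • q) (quaternionPart b) :=
      ((contDiffAt_norm ℝ b.2).inv (norm_ne_zero_iff.2 b.2)).smul contDiffAt_id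
    exact (contMDiffAt_subtype_iff (f := fun b : S4 ↦ ‖quaternionPart b‖⁻¹ • quaternionPart b)).2
      (h2.contMDiffAt.comp b.1 (contMDiff_quaternionPart b.1))
  have h3 := h1.codRestrict_sphere (n := 3) (fun b ↦ by
    rw [mem_sphere_zero_iff_norm, norm_smul, norm_inv, norm_norm,
      inv_mul_cancel₀ (norm_ne_zero_iff.2 b.2)])
  intro b hb
  refine ContMDiffAt.contMDiffWithinAt ?_
  refine (contMDiffAt_subtype_iff (U := U) (f := toEquator) (x := ⟨b, hb⟩)).1 ?_
  refine (h3.congr fun c ↦ ?_) ⟨b, hb⟩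
  have hc : quaternionPart c.1 ≠ 0 := c.2
  ext1
  simp [toEquator, hc]

/-- The complement of the pole `(0, 0, 0, 0, -1)` for `true` and of the pole `(0, 0, 0, 0, 1)` for
`false`. -/
def poleComplement : Bool → Set S4
  | true => {b | b.1 4 ≠ -1}
  | false => {b | b.1 4 ≠ 1}

theorem isOpen_poleComplement (i : Bool) : IsOpen (poleComplement i) := by
  have hc : Continuous fun b : S4 ↦ b.1 4 :=
    (PiLp.continuous_apply 2 _ 4).comp continuous_subtype_val
  cases i
  · exact isOpen_ne_fun hc continuous_const
  · exact isOpen_ne_fun hc continuous_const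

theorem quaternionPart_ne_zero {b : S4} (h1 : b.1 4 ≠ 1) (h2 : b.1 4 ≠ -1) :
    quaternionPart b ≠ 0 := by
  intro h
  have hb : ‖b.1‖ ^ 2 = 1 := by simp
  have h0 : b.1 0 = 0 := congrArg (fun q : ℍ[ℝ] ↦ q.re) h
  have h1' : b.1 1 = 0 := congrArg (fun q : ℍ[ℝ] ↦ q.imI) h
  have h2' : b.1 2 = 0 := congrArg (fun q : ℍ[ℝ] ↦ q.imJ) h
  have h3 : b.1 3 = 0 := congrArg (fun q : ℍ[ℝ] ↦ q.imK) h
  rw [EuclideanSpace.norm_sq_eq] at hb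
  simp [Fin.sum_univ_five, h0, h1', h2', h3] at hb
  exact hb.elim h1 h2

/-- The transition functions of the Hopf bundle `S⁷ → S⁴`,
`(v₁, v₂) ↦ (2 v₁ (star v₂), |v₁|² - |v₂|²)`, with `SU(2)` acting by `(v₁, v₂) ↦ (v₁ g, v₂ g)`:
over the points with `v₁ ≠ 0` (`true`) and with `v₂ ≠ 0` (`false`) it has the sections with
`v₁ > 0` and with `v₂ > 0`, respectively, and at `b = (q, t)` the second one is the first one
multiplied by `q / |q|`. -/
def hopfTransition : Bool → Bool → S4 → SU2
  | true, true, _ => 1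
  | false, false, _ => 1
  | false, true, b => toEquator b
  | true, false, b => (toEquator b)⁻¹

theorem contMDiffOn_hopfTransition (i j : Bool) :
    ContMDiffOn (𝓡 4) (𝓡 3) ∞ (hopfTransition i j) (poleComplement i ∩ poleComplement j) := by
  have h : ∀ k : Bool, ContMDiffOn (𝓡 4) (𝓡 3) ∞ toEquator
      (poleComplement k ∩ poleComplement !k) := by
    intro k
    refine contMDiffOn_toEquator.mono fun b hb ↦ ?_
    cases k
    · exact quaternionPart_ne_zero hb.1 hb.2
    · exact quaternionPart_ne_zero hb.2 hb.1
  cases i <;> cases j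
  · exact contMDiffOn_const
  · exact h false
  · exact contMDiff_inv_SU2.comp_contMDiffOn (h true)
  · exact contMDiffOn_const

namespace SmoothRep

variable {W : Type*} [NormedAddCommGroup W] [NormedSpace ℝ W]

theorem contMDiffOn_transition (ρ : SmoothRep W) (i j : Bool) :
    ContMDiffOn (𝓡 4) 𝓘(ℝ, W →L[ℝ] W) ∞ (fun b ↦ ρ.toHom (hopfTransition i j b))
      (poleComplement i ∩ poleComplement j) :=
  ρ.smooth.comp_contMDiffOn (contMDiffOn_hopfTransition i j)

/-- The vector bundle over `S⁴` associated to the Hopf bundle `S⁷ → S⁴` and a representation of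
`SU(2)`, described by its transition functions. Equivalently, it is obtained from
`D⁴ × W ⊔ D⁴ × W` by glueing `(g, w)` and `(g, ρ(g) w)` for `g` in `∂D⁴ = SU(2)`. -/
def bundleCore (ρ : SmoothRep W) : VectorBundleCore ℝ S4 W Bool where
  baseSet := poleComplement
  isOpen_baseSet := isOpen_poleComplement
  indexAt b := by
    classical exact decide (b.1 4 ≠ -1)
  mem_baseSet_at b := by
    by_cases h : b.1 4 = -1
    · simp only [h, ne_eq, not_true_eq_false, decide_false]
      change b.1 4 ≠ 1
      rw [h]; norm_num
    · simpa [h] using (show b ∈ poleComplement true from h)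
  coordChange i j b := ρ.toHom (hopfTransition i j b)
  coordChange_self i b _ w := by
    cases i <;> simp [hopfTransition]
  continuousOn_coordChange i j := (ρ.contMDiffOn_transition i j).continuousOn
  coordChange_comp i j k b _ w := by
    rw [← mul_apply_eq_comp, ← map_mul]
    cases i <;> cases j <;> cases k <;> simp [hopfTransition]

instance (ρ : SmoothRep W) : ρ.bundleCore.IsContMDiff (𝓡 4) ∞ where
  contMDiffOn_coordChange := ρ.contMDiffOn_transition

/-- The fibres of the vector bundle over `S⁴` associated to a representation of `SU(2)`. -/
abbrev AssociatedBundle (ρ : SmoothRep W) : S4 → Type _ := ρ.bundleCore.Fiber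

instance (ρ : SmoothRep W) (b : S4) : IsTopologicalAddGroup (ρ.AssociatedBundle b) :=
  inferInstanceAs (IsTopologicalAddGroup W)

instance (ρ : SmoothRep W) (b : S4) : ContinuousSMul ℝ (ρ.AssociatedBundle b) :=
  inferInstanceAs (ContinuousSMul ℝ W)

/-- The endomorphism of the associated bundle induced by an endomorphism `J` of `W`
(for `J` commuting with the representation). -/
def inducedEndomorphism (ρ : SmoothRep W) (J : W →L[ℝ] W) (b : S4) :
    ρ.AssociatedBundle b →L[ℝ] ρ.AssociatedBundle b := J

end SmoothRep

/-! ### Symplectic manifolds and symplectic actions -/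

section Symplectic

variable {E : Type*} [NormedAddCommGroup E] [NormedSpace ℝ E]
  {M : Type*} [TopologicalSpace M] [ChartedSpace E M] [IsManifold 𝓘(ℝ, E) ∞ M]

variable (E M) in
/-- A symplectic form on `M`: a smooth, closed, nondegenerate differential 2-form. Closedness is
the vanishing of the exterior derivative, evaluated on smooth vector fields. -/
structure SymplecticForm where
  form : Π x : M, TangentSpace 𝓘(ℝ, E) x →L[ℝ] TangentSpace 𝓘(ℝ, E) x →L[ℝ] ℝ
  alternating : ∀ x v, form x v v = 0
  nondegenerate : ∀ x v, (∀ w, form x v w = 0) → v = 0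
  smooth : ContMDiff 𝓘(ℝ, E) (𝓘(ℝ, E).prod 𝓘(ℝ, E →L[ℝ] E →L[ℝ] ℝ)) ∞
    (fun x ↦ TotalSpace.mk' (E →L[ℝ] E →L[ℝ] ℝ)
      (E := fun x : M ↦ TangentSpace 𝓘(ℝ, E) x →L[ℝ] TangentSpace 𝓘(ℝ, E) x →L[ℝ] ℝ) x (form x))
  closed : ∀ X Y Z : Π x : M, TangentSpace 𝓘(ℝ, E) x,
    ContMDiff 𝓘(ℝ, E) 𝓘(ℝ, E).tangent ∞ (fun x ↦ (⟨x, X x⟩ : TangentBundle 𝓘(ℝ, E) M)) →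
    ContMDiff 𝓘(ℝ, E) 𝓘(ℝ, E).tangent ∞ (fun x ↦ (⟨x, Y x⟩ : TangentBundle 𝓘(ℝ, E) M)) →
    ContMDiff 𝓘(ℝ, E) 𝓘(ℝ, E).tangent ∞ (fun x ↦ (⟨x, Z x⟩ : TangentBundle 𝓘(ℝ, E) M)) →
    ∀ x : M,
      mvfderiv 𝓘(ℝ, E) (fun y ↦ form y (Y y) (Z y)) x (X x)
      - mvfderiv 𝓘(ℝ, E) (fun y ↦ form y (X y) (Z y)) x (Y x)
      + mvfderiv 𝓘(ℝ, E) (fun y ↦ form y (X y) (Y y)) x (Z x)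
      - form x (VectorField.mlieBracket 𝓘(ℝ, E) X Y x) (Z x)
      + form x (VectorField.mlieBracket 𝓘(ℝ, E) X Z x) (Y x)
      - form x (VectorField.mlieBracket 𝓘(ℝ, E) Y Z x) (X x) = 0

/-- A linear complex structure on `T_x M` is compatible with the symplectic form. -/
structure SymplecticForm.IsCompatibleAt (Ω : SymplecticForm E M) (x : M)
    (J : TangentSpace 𝓘(ℝ, E) x →L[ℝ] TangentSpace 𝓘(ℝ, E) x) : Prop where
  sq : ∀ v, J (J v) = -v
  invariant : ∀ v w, Ω.form x (J v) (J w) = Ω.form x v w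
  pos : ∀ v, v ≠ 0 → 0 < Ω.form x v (J v)

/-- A smooth almost complex structure on `M`, compatible with the symplectic form. -/
structure SymplecticForm.CompatibleAlmostComplexStructure (Ω : SymplecticForm E M) where
  J : Π x : M, TangentSpace 𝓘(ℝ, E) x →L[ℝ] TangentSpace 𝓘(ℝ, E) x
  compatible : ∀ x, Ω.IsCompatibleAt x (J x)
  smooth : ContMDiff 𝓘(ℝ, E) (𝓘(ℝ, E).prod 𝓘(ℝ, E →L[ℝ] E)) ∞
    (fun x ↦ TotalSpace.mk' (E →L[ℝ] E)
      (E := fun x : M ↦ TangentSpace 𝓘(ℝ, E) x →L[ℝ] TangentSpace 𝓘(ℝ, E) x) x (J x))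

/-- A differential 4-form on `M` is monotone if the corresponding class vanishes on the image of
`π₄(M) → H₄(M)`: its integral over every (smooth) map `S⁴ → M` is zero. -/
def IsMonotone (η : Π x : M, (Fin 4 → TangentSpace 𝓘(ℝ, E) x) → ℂ) : Prop :=
  ∀ f : S4 → M, ContMDiff (𝓡 4) 𝓘(ℝ, E) ∞ f →
    integralS4 (fun b v ↦ η (f b) fun i ↦ mfderiv (𝓡 4) 𝓘(ℝ, E) f b (v i)) = 0

variable [MulAction SU2 M] [ContMDiffSMul (𝓡 3) 𝓘(ℝ, E) ∞ SU2 M]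

/-- Every element of `SU(2)` acts by a symplectomorphism. -/
def SymplecticForm.IsInvariant (Ω : SymplecticForm E M) : Prop :=
  ∀ (g : SU2) (x : M) (v w : TangentSpace 𝓘(ℝ, E) x),
    Ω.form (g • x) (mfderiv 𝓘(ℝ, E) 𝓘(ℝ, E) (fun y : M ↦ g • y) x v)
      (mfderiv 𝓘(ℝ, E) 𝓘(ℝ, E) (fun y : M ↦ g • y) x w) = Ω.form x v w

theorem contMDiff_smul_const (g : SU2) :
    ContMDiff 𝓘(ℝ, E) 𝓘(ℝ, E) ∞ (fun y : M ↦ g • y) :=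
  (contMDiff_smul (I := 𝓡 3) (I' := 𝓘(ℝ, E)) (n := ∞) (G := SU2) (M := M)).comp
    (contMDiff_const.prodMk contMDiff_id)

/-- The differential at `x` of the action of `g`, as an endomorphism of the model space `E`, with
which every tangent space of `M` is identified. It is an endomorphism of `T_x M` if `x` is fixed. -/
def differentialAt (x : M) (g : SU2) : E →L[ℝ] E :=
  mfderiv 𝓘(ℝ, E) 𝓘(ℝ, E) (fun y : M ↦ g • y) x

theorem differentialAt_mul (x : M) (hx : ∀ g : SU2, g • x = x) (g h : SU2) :
    differentialAt (E := E) x (g * h) = differentialAt (E := E) x g * differentialAt x h := by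
  have hg : ∀ k : SU2, MDifferentiable 𝓘(ℝ, E) 𝓘(ℝ, E) (fun y : M ↦ k • y) := fun k ↦
    (contMDiff_smul_const k).mdifferentiable (by simp)
  have h1 : (fun y : M ↦ (g * h) • y) = (fun y : M ↦ g • y) ∘ (fun y : M ↦ h • y) := by
    funext y; exact mul_smul g h y
  have h2 : differentialAt (E := E) x (g * h)
      = differentialAt (E := E) (h • x) g * differentialAt x h := by
    unfold differentialAt
    rw [h1]
    exact mfderiv_comp x (hg g (h • x)) (hg h x)
  rw [h2, hx h]

theorem contMDiff_differentialAt (x : M) (hx : ∀ g : SU2, g • x = x) :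
    ContMDiff (𝓡 3) 𝓘(ℝ, E →L[ℝ] E) ∞ (differentialAt (E := E) x) := by
  intro g₀
  have h := ContMDiffAt.mfderiv (I := 𝓘(ℝ, E)) (I' := 𝓘(ℝ, E)) (J := 𝓡 3) (x₀ := g₀) (n := ∞)
    (m := ∞) (fun (g : SU2) (y : M) ↦ g • y) (fun _ ↦ x)
    ((contMDiff_smul (I := 𝓡 3) (I' := 𝓘(ℝ, E)) (n := ∞) (G := SU2) (M := M)) (g₀, x))
    contMDiffAt_const le_rfl
  refine h.congr_of_eventuallyEq (Filter.Eventually.of_forall fun g ↦ ?_)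
  have h1 : ∀ k : SU2, k • x ∈ (chartAt E (g₀ • x)).source := fun k ↦ by
    rw [hx k, hx g₀]; exact mem_chart_source E x
  refine Eq.trans ?_ (inTangentCoordinates_eq (I := 𝓘(ℝ, E)) (I' := 𝓘(ℝ, E)) (fun _ : SU2 ↦ x)
    (fun k ↦ k • x) (fun k ↦ differentialAt x k) (x₀ := g₀) (x := g)
    (mem_chart_source E x) (h1 g)).symm
  have h2 : ∀ w : E, (tangentBundleCore 𝓘(ℝ, E) M).coordChange (achart E (g • x))
      (achart E (g₀ • x)) (g • x) w = w := by
    rw [hx g, hx g₀]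
    exact (tangentBundleCore 𝓘(ℝ, E) M).coordChange_self _ _ (mem_chart_source E x)
  ext v
  simp only [ContinuousLinearMap.comp_apply]
  rw [h2, (tangentBundleCore 𝓘(ℝ, E) M).coordChange_self _ _ (mem_chart_source E x)]

/-- The isotropy representation of `SU(2)` on the tangent space at a fixed point. -/
def isotropyRep (x : M) (hx : ∀ g : SU2, g • x = x) : SmoothRep E where
  toHom :=
    { toFun := differentialAt x
      map_one' := by
        have : (fun y : M ↦ (1 : SU2) • y) = id := by funext y; exact one_smul SU2 y
        unfold differentialAt
        rw [this]
        exact mfderiv_id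
      map_mul' := differentialAt_mul x hx }
  smooth := contMDiff_differentialAt x hx

/-- A complex structure on the tangent space at a fixed point which is compatible with the
symplectic form and commutes with the isotropy representation. -/
structure SymplecticForm.IsInvariantCompatibleAt (Ω : SymplecticForm E M) (x : M)
    (J : TangentSpace 𝓘(ℝ, E) x →L[ℝ] TangentSpace 𝓘(ℝ, E) x) : Prop where
  compatible : Ω.IsCompatibleAt x J
  commutes : ∀ (g : SU2) (v : TangentSpace 𝓘(ℝ, E) x),
    J (differentialAt (E := E) x g v) = differentialAt (E := E) x g (J v)

/-- The complex structure on the associated bundle over `S⁴` of the isotropy representation at a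
fixed point `x` that is induced by an invariant complex structure on `T_x M`. -/
def isotropyComplexStructure (x : M) (hx : ∀ g : SU2, g • x = x)
    (J : TangentSpace 𝓘(ℝ, E) x →L[ℝ] TangentSpace 𝓘(ℝ, E) x) (b : S4) :
    (isotropyRep (E := E) x hx).AssociatedBundle b →L[ℝ]
      (isotropyRep (E := E) x hx).AssociatedBundle b :=
  (isotropyRep (E := E) x hx).inducedEndomorphism J b

end Symplectic

end SU2Action

end

noncomputable section

namespace SU2Action

/-! Both Chern numbers are computed as residues of a Chern–Simons form, and both turn out to be the
same universal multiple of a number read off from the real isotropy representation: `tripleTrace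
halfTrace`, essentially ½ tr(dρ(i)[dρ(j), dρ(k)]). Monotonicity, tested on one sphere, forces this
number to agree at the two fixed points.

For the associated bundle of a representation ρ, the frame over the complement of one pole gives a
smooth connection form A on ℝ⁴. At infinity it is compared with the frame at the other pole: the two
differ by y ↦ ρ(y/‖y‖)⁻¹, so A is asymptotic to the logarithmic derivative of that map, the
`modelForm` of dρ. Stokes' theorem for the Chern–Simons form, with cutoffs at larger and larger
radii, leaves only the cubic term of the model (`integral_traceSq_of_asymptotic`). The term tr F ∧
tr F contributes nothing, because its algebra is commutative. Thus the number does not depend on the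
connection (`SmoothRep.integralS4_secondChernForm`). For a symplectic representation commuting with
J, taking adjoints shows that the triple trace is real (`tripleTrace_complexTraceCLM`), so the
number does not depend on the choice of J either.

In M, join the fixed points by a framed path γ that is constant near its ends and let f(q, t) =
(q/|q|)⁻¹ • γ(t). This map is smooth on S⁴ because its ends are fixed points. Moving the frame of γ
by the differentials of the action gives a frame of f^*TM away from the poles. Near the poles f is
constant and the frame is ρᵢ(y/‖y‖)⁻¹ times a constant, so there the pulled-back connection form is
flat and equals a conjugate of the model of the isotropy representation ρᵢ. The same residue
computation on ℝ⁴ ∖ 0 yields the difference of the two triple traces (`integral_traceSq_annulus`).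

The almost complex structure is not assumed invariant, so this frame is not complex linear and J is
a variable matrix K with dK = [K, A]. Only the real part of the Chern integral is therefore used. It
consists of ½ tr(F ∧ F) and of the squares of the real 2-forms tr F and tr(K F). These are closed by
the Bianchi identity and compactly supported after extension over the origin, and the square of such
a form integrates to zero (`integral_sq_closed`, `re_integral_chernIntegrand_annulus`). Monotonicity
makes the whole integral vanish, so the triple traces coincide (`re_tripleTrace_isotropyRep_eq`). -/

theorem contMDiffAt_clm_of_apply {E : Type*} [NormedAddCommGroup E] [NormedSpace ℝ E]
    {B : Type*} [TopologicalSpace B] [ChartedSpace E B] {E' G : Type*} [NormedAddCommGroup E']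
    [NormedSpace ℝ E'] [FiniteDimensional ℝ E'] [NormedAddCommGroup G] [NormedSpace ℝ G] {n : WithTop ℕ∞}
    {f : B → E' →L[ℝ] G} {x : B} (h : ∀ u, ContMDiffAt 𝓘(ℝ, E) 𝓘(ℝ, G) n (fun y ↦ f y u) x) :
    ContMDiffAt 𝓘(ℝ, E) 𝓘(ℝ, E' →L[ℝ] G) n f x := by
  let b := Module.finBasis ℝ E'
  have hf : f = fun y ↦ ∑ i, (LinearMap.toContinuousLinearMap (b.coord i)).smulRight (f y (b i)) := by
    ext y u
    have h := congrArg (f y) (b.sum_repr u)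
    rw [map_sum] at h
    simpa using h.symm
  rw [hf]
  refine ContMDiffAt.sum fun i _ ↦ ?_
  exact (ContinuousLinearMap.smulRightL ℝ E' G
    (LinearMap.toContinuousLinearMap (b.coord i))).contDiff.contMDiff.contMDiffAt.comp x (h (b i))

/-! ### Local connection forms and the structure equation. -/

section LocalForm

variable {E : Type*} [NormedAddCommGroup E] [NormedSpace ℝ E] [FiniteDimensional ℝ E]
  {B : Type*} [TopologicalSpace B] [ChartedSpace E B] [IsManifold 𝓘(ℝ, E) ∞ B] [T2Space B]
  {F : Type*} [NormedAddCommGroup F] [NormedSpace ℝ F] [FiniteDimensional ℝ F]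
  {V : B → Type*} [TopologicalSpace (TotalSpace F V)]
  [∀ x, AddCommGroup (V x)] [∀ x, Module ℝ (V x)] [∀ x, TopologicalSpace (V x)]
  [∀ x, IsTopologicalAddGroup (V x)] [∀ x, ContinuousSMul ℝ (V x)]
  [FiberBundle F V] [VectorBundle ℝ F V] [ContMDiffVectorBundle ∞ F V 𝓘(ℝ, E)]

variable (F) in
/-- The coordinates on the fibre over `x` in the trivialization at `x₀`. -/
abbrev toFib (x₀ x : B) : V x →L[ℝ] F := (trivializationAt F V x₀).continuousLinearMapAt ℝ x

variable (F V) in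
/-- The inverse of the coordinates on the fibre over `x` in the trivialization at `x₀`. -/
abbrev fromFib (x₀ x : B) : F →L[ℝ] V x := (trivializationAt F V x₀).symmL ℝ x

theorem toFib_fromFib {x₀ x : B} (hx : x ∈ (trivializationAt F V x₀).baseSet) (w : F) :
    toFib F x₀ x (fromFib F V x₀ x w) = w :=
  Trivialization.continuousLinearMapAt_symmL _ hx w

theorem fromFib_toFib {x₀ x : B} (hx : x ∈ (trivializationAt F V x₀).baseSet) (v : V x) :
    fromFib F V x₀ x (toFib F x₀ x v) = v :=
  Trivialization.symmL_continuousLinearMapAt _ hx v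

theorem toFib_eq {x₀ x : B} (hx : x ∈ (trivializationAt F V x₀).baseSet) (v : V x) :
    toFib F x₀ x v = (trivializationAt F V x₀ ⟨x, v⟩).2 := by
  rw [toFib, Trivialization.continuousLinearMapAt_apply, Trivialization.coe_linearMapAt_of_mem _ hx]

theorem contMDiffAt_section_iff_toFib {n : WithTop ℕ∞} (hn : n ≤ ∞) {x₀ x : B}
    (hx : x ∈ (trivializationAt F V x₀).baseSet) {σ : Π x : B, V x} :
    ContMDiffAt 𝓘(ℝ, E) (𝓘(ℝ, E).prod 𝓘(ℝ, F)) n (fun y ↦ TotalSpace.mk' F y (σ y)) x ↔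
    ContMDiffAt 𝓘(ℝ, E) 𝓘(ℝ, F) n (fun y ↦ toFib F x₀ y (σ y)) x := by
  have : ContMDiffVectorBundle n F V 𝓘(ℝ, E) := .of_le hn
  rw [(trivializationAt F V x₀).contMDiffAt_section_iff hx]
  refine Filter.EventuallyEq.contMDiffAt_iff ?_
  filter_upwards [(trivializationAt F V x₀).open_baseSet.mem_nhds hx] with y hy
  rw [toFib_eq hy]

theorem mdifferentiableAt_section_iff_toFib {x₀ x : B}
    (hx : x ∈ (trivializationAt F V x₀).baseSet) {σ : Π x : B, V x} :
    MDifferentiableAt 𝓘(ℝ, E) (𝓘(ℝ, E).prod 𝓘(ℝ, F)) (fun y ↦ TotalSpace.mk' F y (σ y)) x ↔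
    MDifferentiableAt 𝓘(ℝ, E) 𝓘(ℝ, F) (fun y ↦ toFib F x₀ y (σ y)) x := by
  have : ContMDiffVectorBundle 1 F V 𝓘(ℝ, E) := .of_le (n := ∞) (by simp)
  rw [(trivializationAt F V x₀).mdifferentiableAt_section_iff 𝓘(ℝ, E) σ hx]
  refine Filter.EventuallyEq.mdifferentiableAt_iff ?_
  filter_upwards [(trivializationAt F V x₀).open_baseSet.mem_nhds hx] with y hy
  rw [toFib_eq hy]

/-- The flat connection on the base set of the trivialization at `x₀`. -/
def flatCov (x₀ : B) (σ : Π x : B, V x) (x : B) : TangentSpace 𝓘(ℝ, E) x →L[ℝ] V x :=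
  (fromFib F V x₀ x).comp (mvfderiv 𝓘(ℝ, E) (fun y ↦ toFib F x₀ y (σ y)) x)

theorem isCovariantDerivativeOn_flatCov (x₀ : B) :
    IsCovariantDerivativeOn F (flatCov (E := E) (F := F) (V := V) x₀)
      (trivializationAt F V x₀).baseSet where
  add {σ σ' x} hσ hσ' hx := by
    have h1 := (mdifferentiableAt_section_iff_toFib hx).1 hσ
    have h2 := (mdifferentiableAt_section_iff_toFib hx).1 hσ'
    unfold flatCov
    rw [← ContinuousLinearMap.comp_add, ← mvfderiv_add h1 h2]
    congr 2
    ext y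
    simp
  leibniz {σ g x} hσ hg hx := by
    have h1 := (mdifferentiableAt_section_iff_toFib hx).1 hσ
    have h2 : (fun y ↦ toFib F x₀ y ((g • σ) y)) = g • (fun y ↦ toFib F x₀ y (σ y)) := by
      ext y
      simp
    ext u
    unfold flatCov
    rw [h2, mvfderiv_smul hg h1]
    simp [fromFib_toFib hx, -Trivialization.continuousLinearMapAt_apply]

/-- The endomorphism-valued 1-form by which a connection differs from the flat connection of the
trivialization at `x₀`. -/
def christoffel (cov : CovariantDerivative 𝓘(ℝ, E) F V) (x₀ x : B) :
    V x →L[ℝ] TangentSpace 𝓘(ℝ, E) x →L[ℝ] V x :=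
  cov.isCovariantDerivativeOn.difference (isCovariantDerivativeOn_flatCov (E := E) x₀)
    (s := (trivializationAt F V x₀).baseSet) x

variable (cov : CovariantDerivative 𝓘(ℝ, E) F V)

/-- The local connection form in the trivializations at `x₀`. -/
def locForm (x₀ x : B) : E →L[ℝ] F →L[ℝ] F :=
  LinearMap.toContinuousLinearMap
    ((LinearMap.toContinuousLinearMap : (F →ₗ[ℝ] F) ≃ₗ[ℝ] (F →L[ℝ] F)).toLinearMap ∘ₗ
      LinearMap.mk₂ ℝ (fun (u : E) (w : F) ↦
        toFib F x₀ x (christoffel cov x₀ x (fromFib F V x₀ x w)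
          (fromFib E (TangentSpace 𝓘(ℝ, E)) x₀ x u)))
        (by simp) (by simp) (by simp) (by simp))

theorem locForm_apply (x₀ x : B) (u : E) (w : F) :
    locForm cov x₀ x u w = toFib F x₀ x (christoffel cov x₀ x (fromFib F V x₀ x w)
          (fromFib E (TangentSpace 𝓘(ℝ, E)) x₀ x u)) := rfl

theorem mem_baseSet_tangent {x₀ x : B} :
    x ∈ (trivializationAt E (TangentSpace 𝓘(ℝ, E)) x₀).baseSet ↔ x ∈ (chartAt E x₀).source := by
  rw [TangentBundle.trivializationAt_baseSet]

theorem toFib_cov {x₀ x : B} (hx : x ∈ (trivializationAt F V x₀).baseSet)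
    (hx' : x ∈ (chartAt E x₀).source) {σ : Π x : B, V x}
    (hσ : MDifferentiableAt 𝓘(ℝ, E) (𝓘(ℝ, E).prod 𝓘(ℝ, F)) (fun y ↦ TotalSpace.mk' F y (σ y)) x)
    (u : TangentSpace 𝓘(ℝ, E) x) :
    toFib F x₀ x (cov σ x u) = mvfderiv 𝓘(ℝ, E) (fun y ↦ toFib F x₀ y (σ y)) x u +
      locForm cov x₀ x (toFib E x₀ x u) (toFib F x₀ x (σ x)) := by
  have h1 := cov.isCovariantDerivativeOn.difference_apply
    (isCovariantDerivativeOn_flatCov (E := E) x₀) hx hσ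
  rw [locForm_apply, fromFib_toFib hx, fromFib_toFib (mem_baseSet_tangent.2 hx'), christoffel, h1]
  simp [flatCov, toFib_fromFib hx, -Trivialization.continuousLinearMapAt_apply]

theorem contMDiffAt_fromFib {n : WithTop ℕ∞} (hn : n ≤ ∞) {x₀ x : B}
    (hx : x ∈ (trivializationAt F V x₀).baseSet) (w : F) :
    ContMDiffAt 𝓘(ℝ, E) (𝓘(ℝ, E).prod 𝓘(ℝ, F)) n
      (fun y ↦ TotalSpace.mk' F y (fromFib F V x₀ y w)) x := by
  rw [contMDiffAt_section_iff_toFib hn hx]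
  refine (contMDiffAt_const (c := w)).congr_of_eventuallyEq ?_
  filter_upwards [(trivializationAt F V x₀).open_baseSet.mem_nhds hx] with y hy
  rw [toFib_fromFib hy]

theorem extend_eq_fromFib {x₀ x : B} (hx : x ∈ (trivializationAt F V x₀).baseSet) (v : V x₀) :
    extend F v x = fromFib F V x₀ x (toFib F x₀ x₀ v) := by
  rw [toFib_eq (mem_baseSet_trivializationAt F V x₀)]
  exact (Trivialization.symmL_apply _ hx _).symm

theorem extend_eventuallyEq_fromFib {x₀ x : B} (hx : x ∈ (trivializationAt F V x₀).baseSet)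
    (v : V x₀) : ∀ᶠ y in 𝓝 x, extend F v y = fromFib F V x₀ y (toFib F x₀ x₀ v) := by
  filter_upwards [(trivializationAt F V x₀).open_baseSet.mem_nhds hx] with y hy
  exact extend_eq_fromFib hy v

theorem cov_extend_eq {x₀ x : B} (hx : x ∈ (trivializationAt F V x₀).baseSet) (v : V x₀) :
    cov (extend F v) x = cov (fun y ↦ fromFib F V x₀ y (toFib F x₀ x₀ v)) x :=
  cov.isCovariantDerivativeOnUniv.congr_of_eventuallyEq (mdifferentiableAt_extend_of_mem v hx)
    ((contMDiffAt_fromFib (n := ∞) le_rfl hx _).mdifferentiableAt (by simp)) Filter.univ_mem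
    (extend_eventuallyEq_fromFib hx v)

theorem toFib_cov_fromFib {x₀ x : B} (hx : x ∈ (trivializationAt F V x₀).baseSet)
    (hx' : x ∈ (chartAt E x₀).source) (u : TangentSpace 𝓘(ℝ, E) x) (w : F) :
    toFib F x₀ x (cov (fun y ↦ fromFib F V x₀ y w) x u) =
      locForm cov x₀ x (toFib E x₀ x u) w := by
  rw [toFib_cov cov hx hx' ((contMDiffAt_fromFib (n := ∞) le_rfl hx w).mdifferentiableAt (by simp)),
    toFib_fromFib hx]
  have : mvfderiv 𝓘(ℝ, E) (fun y ↦ toFib F x₀ y (fromFib F V x₀ y w)) x = 0 := by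
    rw [← mvfderiv_const (I := 𝓘(ℝ, E)) w (x := x)]
    have h : (fun y ↦ toFib F x₀ y (fromFib F V x₀ y w)) =ᶠ[𝓝 x] fun _ ↦ w := by
      filter_upwards [(trivializationAt F V x₀).open_baseSet.mem_nhds hx] with y hy
      rw [toFib_fromFib hy]
    unfold mvfderiv
    rw [h.mfderiv_eq, h.self_of_nhds]
  simp [this, -Trivialization.continuousLinearMapAt_apply]

/-- Smoothness of a connection is a statement about global sections, whereas a section with constant
coordinates is only local; it is replaced by a global smooth section with the same germ at x₀. -/
theorem contMDiffAt_cov_fromFib (hcov : cov.ContMDiffCovariantDerivative ∞) (x₀ : B)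
    (u : E) (w : F) :
    ContMDiffAt 𝓘(ℝ, E) (𝓘(ℝ, E).prod 𝓘(ℝ, F)) ∞ (fun y ↦ TotalSpace.mk' F y
      (cov (fun y ↦ fromFib F V x₀ y w) y (fromFib E (TangentSpace 𝓘(ℝ, E)) x₀ y u))) x₀ := by
  have hb := mem_baseSet_trivializationAt F V x₀
  obtain ⟨σ, hσ, hσv⟩ := exists_smooth_section (I := 𝓘(ℝ, E)) (F := F) x₀ (fromFib F V x₀ x₀ w)
  have hσ' : ∀ᶠ y in 𝓝 x₀, σ y = fromFib F V x₀ y w := by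
    filter_upwards [hσv.and ((trivializationAt F V x₀).open_baseSet.mem_nhds hb)] with y hy
    rw [hy.1, extend_eq_fromFib hy.2, toFib_fromFib hb]
  have h1 := (hcov.contMDiff.contMDiff (σ := σ) (hσ.contMDiffOn)) x₀ trivial
  have h2 := h1.contMDiffAt Filter.univ_mem
  have h3 := ContMDiffAt.clm_bundle_apply (F₁ := E) (F₂ := F) (b := id)
    (ϕ := fun y ↦ cov σ y) (v := fun y ↦ fromFib E (TangentSpace 𝓘(ℝ, E)) x₀ y u) h2
    (contMDiffAt_fromFib (n := ∞) le_rfl (mem_baseSet_trivializationAt _ _ _) u)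
  refine h3.congr_of_eventuallyEq ?_
  filter_upwards [eventually_eventually_nhds.2 hσ',
    (trivializationAt F V x₀).open_baseSet.mem_nhds hb] with y hy hyb
  have := cov.isCovariantDerivativeOnUniv.congr_of_eventuallyEq
    (σ := fun y ↦ fromFib F V x₀ y w) (σ' := σ)
    ((contMDiffAt_fromFib (n := ∞) le_rfl hyb w).mdifferentiableAt (by simp))
    ((hσ y).mdifferentiableAt (by simp)) Filter.univ_mem (hy.mono fun z hz ↦ hz.symm)
  simp [this]

theorem contMDiffAt_locForm (hcov : cov.ContMDiffCovariantDerivative ∞) (x₀ : B) :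
    ContMDiffAt 𝓘(ℝ, E) 𝓘(ℝ, E →L[ℝ] F →L[ℝ] F) ∞ (locForm cov x₀) x₀ := by
  have hb := mem_baseSet_trivializationAt F V x₀
  refine contMDiffAt_clm_of_apply fun u ↦ contMDiffAt_clm_of_apply fun w ↦ ?_
  have h := (contMDiffAt_section_iff_toFib le_rfl hb).1 (contMDiffAt_cov_fromFib cov hcov x₀ u w)
  refine h.congr_of_eventuallyEq ?_
  filter_upwards [(trivializationAt F V x₀).open_baseSet.mem_nhds hb,
    (chartAt E x₀).open_source.mem_nhds (mem_chart_source E x₀)] with y hy hy'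
  rw [toFib_cov_fromFib cov hy hy', toFib_fromFib (mem_baseSet_tangent.2 hy')]

theorem lieBracketWithin_const {X Y : E → E} {s : Set E} {x u v : E} (hs : s = Set.univ)
    (hX : X =ᶠ[𝓝 x] fun _ ↦ u) (hY : Y =ᶠ[𝓝 x] fun _ ↦ v) :
    VectorField.lieBracketWithin ℝ X Y s x = 0 := by
  rw [hs, VectorField.lieBracketWithin_univ, hX.lieBracket_vectorField_eq hY]
  simp [VectorField.lieBracket]

/-- These are coordinate fields: pulled back to the chart at x₀ they become constant. -/
theorem mlieBracket_fromFib (x₀ : B) (u v : E) :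
    VectorField.mlieBracket 𝓘(ℝ, E) (fun y ↦ fromFib E (TangentSpace 𝓘(ℝ, E)) x₀ y u)
      (fun y ↦ fromFib E (TangentSpace 𝓘(ℝ, E)) x₀ y v) x₀ = 0 := by
  have key : ∀ w : E, (VectorField.mpullbackWithin 𝓘(ℝ, E) 𝓘(ℝ, E) (extChartAt 𝓘(ℝ, E) x₀).symm
      (fun y ↦ fromFib E (TangentSpace 𝓘(ℝ, E)) x₀ y w) (Set.range 𝓘(ℝ, E)))
      =ᶠ[𝓝 (extChartAt 𝓘(ℝ, E) x₀ x₀)] fun _ ↦ w := by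
    intro w
    filter_upwards [(isOpen_extChartAt_target x₀).mem_nhds (mem_extChartAt_target x₀)] with y hy
    have hy' : (extChartAt 𝓘(ℝ, E) x₀).symm y ∈ (chartAt E x₀).source := by
      have := (extChartAt 𝓘(ℝ, E) x₀).map_target hy
      rwa [extChartAt_source] at this
    rw [VectorField.mpullbackWithin_apply, fromFib, TangentBundle.symmL_trivializationAt hy',
      (extChartAt 𝓘(ℝ, E) x₀).right_inv hy]
    exact ((isInvertible_mfderivWithin_extChartAt_symm hy).inverse_apply_eq).2 rfl
  have h : VectorField.lieBracketWithin ℝ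
      (VectorField.mpullbackWithin 𝓘(ℝ, E) 𝓘(ℝ, E) (extChartAt 𝓘(ℝ, E) x₀).symm
        (fun y ↦ fromFib E (TangentSpace 𝓘(ℝ, E)) x₀ y u) (Set.range 𝓘(ℝ, E)))
      (VectorField.mpullbackWithin 𝓘(ℝ, E) 𝓘(ℝ, E) (extChartAt 𝓘(ℝ, E) x₀).symm
        (fun y ↦ fromFib E (TangentSpace 𝓘(ℝ, E)) x₀ y v) (Set.range 𝓘(ℝ, E)))
      ((extChartAt 𝓘(ℝ, E) x₀).symm ⁻¹' Set.univ ∩ Set.range 𝓘(ℝ, E))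
      (extChartAt 𝓘(ℝ, E) x₀ x₀) = 0 := by
    exact lieBracketWithin_const (by simp) (key u) (key v)
  rw [← VectorField.mlieBracketWithin_univ, VectorField.mlieBracketWithin_apply]
  exact (congrArg _ h).trans (map_zero _)

-- The structure equation R = dΓ + Γ ∧ Γ at the centre of a trivialization. The extensions in the
-- definition of `curvature` have constant coordinates there, so the bracket term vanishes and each
-- iterated derivative is one derivative of Γ plus one product.
set_option synthInstance.maxHeartbeats 200000 in
theorem curvature_fromFib (hcov : cov.ContMDiffCovariantDerivative ∞) (x₀ : B)
    (u v : TangentSpace 𝓘(ℝ, E) x₀) (w : V x₀) :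
    toFib F x₀ x₀ (curvature cov hcov x₀ u v w) =
      mvfderiv 𝓘(ℝ, E) (locForm cov x₀) x₀ u (toFib E x₀ x₀ v) (toFib F x₀ x₀ w)
      - mvfderiv 𝓘(ℝ, E) (locForm cov x₀) x₀ v (toFib E x₀ x₀ u) (toFib F x₀ x₀ w)
      + locForm cov x₀ x₀ (toFib E x₀ x₀ u)
          (locForm cov x₀ x₀ (toFib E x₀ x₀ v) (toFib F x₀ x₀ w))
      - locForm cov x₀ x₀ (toFib E x₀ x₀ v)
          (locForm cov x₀ x₀ (toFib E x₀ x₀ u) (toFib F x₀ x₀ w)) := by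
  have hb := mem_baseSet_trivializationAt F V x₀
  have hbT := mem_baseSet_trivializationAt E (TangentSpace 𝓘(ℝ, E)) x₀
  have key : ∀ a b : TangentSpace 𝓘(ℝ, E) x₀,
      toFib F x₀ x₀ (cov (fun y ↦ cov (extend F w) y (extend E b y)) x₀ a) =
        mvfderiv 𝓘(ℝ, E) (locForm cov x₀) x₀ a (toFib E x₀ x₀ b) (toFib F x₀ x₀ w)
        + locForm cov x₀ x₀ (toFib E x₀ x₀ a)
          (locForm cov x₀ x₀ (toFib E x₀ x₀ b) (toFib F x₀ x₀ w)) := by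
    intro a b
    -- Near x₀ the inner covariant derivative is Γ evaluated at fixed vectors, so differentiating it
    -- amounts to differentiating Γ alone.
    have e1 : ∀ᶠ y in 𝓝 x₀, toFib F x₀ y (cov (extend F w) y (extend E b y)) =
        locForm cov x₀ y (toFib E x₀ x₀ b) (toFib F x₀ x₀ w) := by
      filter_upwards [(trivializationAt F V x₀).open_baseSet.mem_nhds hb,
        (chartAt E x₀).open_source.mem_nhds (mem_chart_source E x₀)] with y hy hy'
      rw [cov_extend_eq cov hy, toFib_cov_fromFib cov hy hy',
        extend_eq_fromFib (mem_baseSet_tangent.2 hy'), toFib_fromFib (mem_baseSet_tangent.2 hy')]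
    rw [toFib_cov cov hb (mem_chart_source E x₀) (mdifferentiableAt_cov_extend cov hcov b w),
      e1.self_of_nhds]
    congr 1
    have h1 : MDifferentiableAt 𝓘(ℝ, E) 𝓘(ℝ, E →L[ℝ] F →L[ℝ] F) (locForm cov x₀) x₀ :=
      (contMDiffAt_locForm cov hcov x₀).mdifferentiableAt (by simp)
    let L : (E →L[ℝ] F →L[ℝ] F) →L[ℝ] F :=
      (ContinuousLinearMap.apply ℝ F (toFib F x₀ x₀ w)).comp
        (ContinuousLinearMap.apply ℝ (F →L[ℝ] F) (toFib E x₀ x₀ b))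
    have h2 : mvfderiv 𝓘(ℝ, E) (L ∘ locForm cov x₀) x₀ =
        L.comp (mvfderiv 𝓘(ℝ, E) (locForm cov x₀) x₀) := by
      have := mfderiv_comp x₀ (I'' := 𝓘(ℝ, F)) L.mdifferentiableAt h1
      unfold mvfderiv
      rw [this, ContinuousLinearMap.mfderiv_eq]
      rfl
    have h3 : mvfderiv 𝓘(ℝ, E) (fun y ↦ toFib F x₀ y (cov (extend F w) y (extend E b y))) x₀ =
        mvfderiv 𝓘(ℝ, E) (L ∘ locForm cov x₀) x₀ := by
      have h : (fun y ↦ toFib F x₀ y (cov (extend F w) y (extend E b y))) =ᶠ[𝓝 x₀]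
        (L ∘ locForm cov x₀) := e1
      unfold mvfderiv
      rw [h.mfderiv_eq, h.self_of_nhds]
    rw [h3, h2]
    rfl
  have hbr : VectorField.mlieBracket 𝓘(ℝ, E) (extend E u) (extend E v) x₀ = 0 := by
    rw [Filter.EventuallyEq.mlieBracket_vectorField_eq (extend_eventuallyEq_fromFib hbT u)
      (extend_eventuallyEq_fromFib hbT v)]
    exact mlieBracket_fromFib x₀ _ _
  change toFib F x₀ x₀ (curvatureAux cov (extend E u) (extend E v) (extend F w) x₀) = _
  rw [curvatureAux, hbr, extend_apply_self, extend_apply_self, map_zero, sub_zero, map_sub, key,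
    key]
  abel

end LocalForm

/-! ### Gauge transformations of algebra-valued connection forms. -/

section Gauge

variable {Y : Type*} [NormedAddCommGroup Y] [NormedSpace ℝ Y]
  {𝒜 : Type*} [NormedRing 𝒜] [NormedAlgebra ℝ 𝒜]

/-- The curvature `dA + A ∧ A` of an algebra-valued 1-form `A`. -/
def curv (A : Y → Y →L[ℝ] 𝒜) (y u v : Y) : 𝒜 :=
  fderiv ℝ A y u v - fderiv ℝ A y v u + (A y u * A y v - A y v * A y u)

theorem curv_congr {A A' : Y → Y →L[ℝ] 𝒜} {y : Y} (h : A =ᶠ[𝓝 y] A') :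
    curv A y = curv A' y := by
  funext u v
  rw [curv, curv, h.fderiv_eq, h.self_of_nhds]

/-- The gauge transform `ψ⁻¹ dψ + ψ⁻¹ A ψ` of an algebra-valued 1-form `A`. -/
def gaugeTransform (ψ : Y → 𝒜) (A : Y → Y →L[ℝ] 𝒜) (y : Y) : Y →L[ℝ] 𝒜 :=
  (ContinuousLinearMap.mul ℝ 𝒜 (Ring.inverse (ψ y))).comp
    (fderiv ℝ ψ y + ((ContinuousLinearMap.mul ℝ 𝒜).flip (ψ y)).comp (A y))

theorem gaugeTransform_apply (ψ : Y → 𝒜) (A : Y → Y →L[ℝ] 𝒜) (y u : Y) :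
    gaugeTransform ψ A y u = Ring.inverse (ψ y) * (fderiv ℝ ψ y u + A y u * ψ y) := rfl

/-- The form without inverses; identities below are obtained from it, so that `Ring.inverse` need
not be differentiated. -/
theorem mul_gaugeTransform {ψ : Y → 𝒜} {A : Y → Y →L[ℝ] 𝒜} {y : Y} (hψ : IsUnit (ψ y)) (u : Y) :
    ψ y * gaugeTransform ψ A y u = fderiv ℝ ψ y u + A y u * ψ y := by
  rw [gaugeTransform_apply, ← mul_assoc, Ring.mul_inverse_cancel _ hψ, one_mul]

theorem gaugeTransform_eq_iff {ψ : Y → 𝒜} {A : Y → Y →L[ℝ] 𝒜} {y : Y} (hψ : IsUnit (ψ y))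
    {L : Y →L[ℝ] 𝒜} :
    L = gaugeTransform ψ A y ↔ ∀ u, ψ y * L u = fderiv ℝ ψ y u + A y u * ψ y := by
  constructor
  · rintro rfl u
    exact mul_gaugeTransform hψ u
  · intro h
    ext u
    rw [gaugeTransform_apply, ← h, ← mul_assoc, Ring.inverse_mul_cancel _ hψ, one_mul]

theorem gaugeTransform_congr {ψ ψ' : Y → 𝒜} {A A' : Y → Y →L[ℝ] 𝒜} {y : Y}
    (h : ψ =ᶠ[𝓝 y] ψ') (hA : A y = A' y) : gaugeTransform ψ A y = gaugeTransform ψ' A' y := by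
  unfold gaugeTransform
  rw [h.fderiv_eq, h.self_of_nhds, hA]

theorem gaugeTransform_mul {ψ h : Y → 𝒜} {A : Y → Y →L[ℝ] 𝒜} {y : Y}
    (hψ : IsUnit (ψ y)) (hh : IsUnit (h y)) (dψ : DifferentiableAt ℝ ψ y)
    (dh : DifferentiableAt ℝ h y) :
    gaugeTransform (fun z ↦ ψ z * h z) A y = gaugeTransform h (gaugeTransform ψ A) y := by
  symm
  refine (gaugeTransform_eq_iff (ψ := fun z ↦ ψ z * h z) (hψ.mul hh)).2 fun u ↦ ?_
  rw [mul_assoc, mul_gaugeTransform hh, fderiv_fun_mul' dψ dh]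
  simp only [add_apply, smul_apply, smul_eq_mul, MulOpposite.smul_eq_mul_unop,
    MulOpposite.unop_op]
  rw [mul_add, ← mul_assoc, mul_gaugeTransform hψ]
  noncomm_ring

theorem gaugeTransform_comp {Z : Type*} [NormedAddCommGroup Z] [NormedSpace ℝ Z]
    {ψ : Y → 𝒜} {A : Y → Y →L[ℝ] 𝒜} {z : Z → Y} {x : Z}
    (dψ : DifferentiableAt ℝ ψ (z x)) (dz : DifferentiableAt ℝ z x) :
    gaugeTransform (ψ ∘ z) (fun x ↦ (A (z x)).comp (fderiv ℝ z x)) x =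
      (gaugeTransform ψ A (z x)).comp (fderiv ℝ z x) := by
  ext u
  simp [gaugeTransform_apply, fderiv_comp x dψ dz]

variable [CompleteSpace 𝒜]

theorem contDiffAt_inverse {n : WithTop ℕ∞} {ψ : Y → 𝒜} {y : Y} (hψ : IsUnit (ψ y))
    (dψ : ContDiffAt ℝ n ψ y) : ContDiffAt ℝ n (fun z ↦ Ring.inverse (ψ z)) y := by
  obtain ⟨a, ha⟩ := hψ
  exact ContDiffAt.comp y (g := Ring.inverse) (ha ▸ contDiffAt_ringInverse ℝ a) dψ

theorem contDiffAt_gaugeTransform {ψ : Y → 𝒜} {A : Y → Y →L[ℝ] 𝒜} {y : Y} (hψ : IsUnit (ψ y))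
    (dψ : ContDiffAt ℝ ∞ ψ y) (dA : ContDiffAt ℝ ∞ A y) :
    ContDiffAt ℝ ∞ (gaugeTransform ψ A) y := by
  unfold gaugeTransform
  refine ContDiffAt.clm_comp ?_ ((dψ.fderiv_right (by simp)).add (ContDiffAt.clm_comp ?_ dA))
  · exact (ContinuousLinearMap.mul ℝ 𝒜).contDiff.contDiffAt.comp y (contDiffAt_inverse hψ dψ)
  · exact (ContinuousLinearMap.mul ℝ 𝒜).flip.contDiff.contDiffAt.comp y dψ

theorem isUnit_eventually {ψ : Y → 𝒜} {y : Y} (hψ : IsUnit (ψ y)) (dψ : ContinuousAt ψ y) :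
    ∀ᶠ z in 𝓝 y, IsUnit (ψ z) :=
  dψ.eventually (Units.isOpen.mem_nhds hψ)

theorem fderiv_clm_apply_const {G G' : Type*} [NormedAddCommGroup G] [NormedSpace ℝ G]
    [NormedAddCommGroup G'] [NormedSpace ℝ G'] {A : Y → G →L[ℝ] G'} {y : Y}
    (dA : DifferentiableAt ℝ A y) (v : Y) (u : G) :
    fderiv ℝ (fun z ↦ A z u) y v = fderiv ℝ A y v u := by
  rw [fderiv_clm_apply dA (differentiableAt_const u)]
  simp

theorem two_le_infty : minSmoothness ℝ 2 ≤ (∞ : WithTop ℕ∞) := by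
  rw [minSmoothness_of_isRCLikeNormedField]
  exact WithTop.coe_le_coe.2 (le_top : (2 : ℕ∞) ≤ ⊤)

/-- Differentiate ψ G = dψ + A ψ and antisymmetrize: the second derivatives of ψ cancel by symmetry,
and the remaining first-order terms assemble into the curvature. -/
theorem mul_curv_gaugeTransform {ψ : Y → 𝒜} {A : Y → Y →L[ℝ] 𝒜} {y : Y} (hψ : IsUnit (ψ y))
    (dψ : ContDiffAt ℝ ∞ ψ y) (dA : ContDiffAt ℝ ∞ A y) (u v : Y) :
    ψ y * curv (gaugeTransform ψ A) y u v = curv A y u v * ψ y := by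
  have hψ1 : DifferentiableAt ℝ ψ y := dψ.differentiableAt (by simp)
  have hψ2 : DifferentiableAt ℝ (fderiv ℝ ψ) y :=
    (dψ.fderiv_right (m := ∞) (by simp)).differentiableAt (by simp)
  have hA : DifferentiableAt ℝ A y := dA.differentiableAt (by simp)
  have hG : DifferentiableAt ℝ (gaugeTransform ψ A) y :=
    (contDiffAt_gaugeTransform hψ dψ dA).differentiableAt (by simp)
  have key : ∀ a b : Y, fderiv ℝ ψ y a * gaugeTransform ψ A y b
      + ψ y * fderiv ℝ (gaugeTransform ψ A) y a b =
      fderiv ℝ (fderiv ℝ ψ) y a b + (fderiv ℝ A y a b * ψ y + A y b * fderiv ℝ ψ y a) := by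
    intro a b
    have e : (fun z ↦ ψ z * gaugeTransform ψ A z b) =ᶠ[𝓝 y]
        fun z ↦ fderiv ℝ ψ z b + A z b * ψ z := by
      filter_upwards [isUnit_eventually hψ hψ1.continuousAt] with z hz
      exact mul_gaugeTransform hz b
    have h := congrArg (fun L ↦ L a) (e.fderiv_eq (𝕜 := ℝ))
    rw [fderiv_fun_mul' hψ1 (hG.clm_apply (differentiableAt_const b)),
      fderiv_fun_add (hψ2.clm_apply (differentiableAt_const b))
        ((hA.clm_apply (differentiableAt_const b)).fun_mul hψ1),
      fderiv_fun_mul' (hA.clm_apply (differentiableAt_const b)) hψ1] at h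
    simp only [add_apply, smul_apply, smul_eq_mul, MulOpposite.smul_eq_mul_unop,
      MulOpposite.unop_op, fderiv_clm_apply_const hG, fderiv_clm_apply_const hψ2,
      fderiv_clm_apply_const hA] at h
    rw [add_comm, h]
    abel
  have hs : fderiv ℝ (fderiv ℝ ψ) y u v = fderiv ℝ (fderiv ℝ ψ) y v u :=
    (dψ.isSymmSndFDerivAt two_le_infty).eq u v
  have k1 := key u v
  have k2 := key v u
  have m1 := mul_gaugeTransform (A := A) hψ u
  have m2 := mul_gaugeTransform (A := A) hψ v
  set G := gaugeTransform ψ A y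
  rw [hs] at k1
  unfold curv
  have e1 : ψ y * fderiv ℝ (gaugeTransform ψ A) y u v = fderiv ℝ (fderiv ℝ ψ) y v u +
      (fderiv ℝ A y u v * ψ y + A y v * fderiv ℝ ψ y u) - fderiv ℝ ψ y u * G v := by
    rw [← k1]; abel
  have e2 : ψ y * fderiv ℝ (gaugeTransform ψ A) y v u = fderiv ℝ (fderiv ℝ ψ) y v u +
      (fderiv ℝ A y v u * ψ y + A y u * fderiv ℝ ψ y v) - fderiv ℝ ψ y v * G u := by
    rw [← k2]; abel
  have e3 : fderiv ℝ ψ y u = ψ y * G u - A y u * ψ y := by rw [m1]; abel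
  have e4 : fderiv ℝ ψ y v = ψ y * G v - A y v * ψ y := by rw [m2]; abel
  rw [mul_add, mul_sub, e1, e2, e3, e4]
  noncomm_ring

/-- The equation dJ = [J, A] of a parallel endomorphism is independent of the frame; this follows by
differentiating ψ K = J ψ. -/
theorem fderiv_parallel {ψ J K : Y → 𝒜} {A : Y → Y →L[ℝ] 𝒜} {y u : Y} (hψ : IsUnit (ψ y))
    (dψ : DifferentiableAt ℝ ψ y) (dJ : DifferentiableAt ℝ J y) (dK : DifferentiableAt ℝ K y)
    (hJ : fderiv ℝ J y u = J y * A y u - A y u * J y)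
    (hK : ∀ᶠ z in 𝓝 y, ψ z * K z = J z * ψ z) :
    fderiv ℝ K y u = K y * gaugeTransform ψ A y u - gaugeTransform ψ A y u * K y := by
  have h := congrArg (fun L ↦ L u) (Filter.EventuallyEq.fderiv_eq (𝕜 := ℝ) hK)
  simp only [fderiv_fun_mul' dψ dK, fderiv_fun_mul' dJ dψ] at h
  simp only [add_apply, smul_apply, smul_eq_mul, MulOpposite.smul_eq_mul_unop,
    MulOpposite.unop_op] at h
  have m1 := mul_gaugeTransform (A := A) hψ u
  have hK0 := hK.self_of_nhds
  set G := gaugeTransform ψ A y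
  have e3 : fderiv ℝ ψ y u = ψ y * G u - A y u * ψ y := by rw [m1]; abel
  rw [hJ, e3] at h
  refine hψ.mul_left_cancel ?_
  have h' : ψ y * fderiv ℝ K y u = J y * (ψ y * G u - A y u * ψ y) +
    (J y * A y u - A y u * J y) * ψ y - (ψ y * G u - A y u * ψ y) * K y := by rw [← h]; abel
  rw [h']
  have c1 : A y u * J y * ψ y = A y u * ψ y * K y := by rw [mul_assoc, ← hK0, mul_assoc]
  have c2 : J y * (ψ y * G u) = ψ y * K y * G u := by rw [← mul_assoc, hK0]
  calc _ = J y * (ψ y * G u) - A y u * J y * ψ y - ψ y * G u * K y + A y u * ψ y * K y := by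
        noncomm_ring
    _ = _ := by rw [c1, c2]; noncomm_ring

end Gauge

/-! ### Pulled-back connections in frames along a map. -/

section Pullback

variable {E : Type*} [NormedAddCommGroup E] [NormedSpace ℝ E] [FiniteDimensional ℝ E]
  {B : Type*} [TopologicalSpace B] [ChartedSpace E B] [IsManifold 𝓘(ℝ, E) ∞ B] [T2Space B]
  {F : Type*} [NormedAddCommGroup F] [NormedSpace ℝ F] [FiniteDimensional ℝ F]
  {V : B → Type*} [TopologicalSpace (TotalSpace F V)]
  [∀ x, AddCommGroup (V x)] [∀ x, Module ℝ (V x)] [∀ x, TopologicalSpace (V x)]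
  [∀ x, IsTopologicalAddGroup (V x)] [∀ x, ContinuousSMul ℝ (V x)]
  [FiberBundle F V] [VectorBundle ℝ F V] [ContMDiffVectorBundle ∞ F V 𝓘(ℝ, E)]
  {Y : Type*} [NormedAddCommGroup Y] [NormedSpace ℝ Y]
  (cov : CovariantDerivative 𝓘(ℝ, E) F V)

/-- The domain of the chart and of the trivialization at `x₀`. -/
def chartDomain (F : Type*) [NormedAddCommGroup F] [NormedSpace ℝ F]
    (V : B → Type*) [TopologicalSpace (TotalSpace F V)] [∀ x, TopologicalSpace (V x)]
    [FiberBundle F V] (x₀ : B) : Set B :=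
  (trivializationAt F V x₀).baseSet ∩ (chartAt E x₀).source

theorem mem_chartDomain (x₀ : B) : x₀ ∈ chartDomain (E := E) F V x₀ :=
  ⟨mem_baseSet_trivializationAt F V x₀, mem_chart_source E x₀⟩

theorem isOpen_chartDomain (x₀ : B) : IsOpen (chartDomain (E := E) F V x₀) :=
  (trivializationAt F V x₀).open_baseSet.inter (chartAt E x₀).open_source

/-- A smooth map `f` and a smooth isomorphism `φ` of the trivial bundle with `f^* V` near `y`. -/
structure IsGaugeAt (f : Y → B) (φ : Π y, F →L[ℝ] V (f y)) (y : Y) : Prop where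
  contMDiffAt : ContMDiffAt 𝓘(ℝ, Y) 𝓘(ℝ, E) ∞ f y
  contMDiffAt_frame : ∀ w, ContMDiffAt 𝓘(ℝ, Y) (𝓘(ℝ, E).prod 𝓘(ℝ, F)) ∞
    (fun z ↦ TotalSpace.mk' F (f z) (φ z w)) y
  bijective : Function.Bijective (φ y)

/-- The gauge `φ` in the trivialization at `x₀`. -/
def gaugeCoord (x₀ : B) (f : Y → B) (φ : Π y, F →L[ℝ] V (f y)) (y : Y) : F →L[ℝ] F :=
  (toFib F x₀ (f y)).comp (φ y)

/-- The pull-back by `f` of the connection form in the trivialization at `x₀`. -/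
def pullbackForm (x₀ : B) (f : Y → B) (y : Y) : Y →L[ℝ] F →L[ℝ] F :=
  (locForm cov x₀ (f y)).comp (fderiv ℝ (extChartAt 𝓘(ℝ, E) x₀ ∘ f) y)

/-- The connection form of the pull-back of a connection by `f` in the gauge `φ`. -/
def connAlong (f : Y → B) (φ : Π y, F →L[ℝ] V (f y)) (y : Y) : Y →L[ℝ] F →L[ℝ] F :=
  gaugeTransform (gaugeCoord (f y) f φ) (pullbackForm cov (f y) f) y

theorem toFib_bijective {x₀ x : B} (hx : x ∈ (trivializationAt F V x₀).baseSet) :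
    Function.Bijective (toFib F x₀ x : V x → F) :=
  Function.bijective_iff_has_inverse.2 ⟨fromFib F V x₀ x, fromFib_toFib hx, toFib_fromFib hx⟩

variable {f : Y → B} {φ : Π y, F →L[ℝ] V (f y)} {y : Y}

theorem isUnit_gaugeCoord {x₀ : B} (hx : f y ∈ (trivializationAt F V x₀).baseSet)
    (h : Function.Bijective (φ y)) : IsUnit (gaugeCoord x₀ f φ y) := by
  have : CompleteSpace F := FiniteDimensional.complete ℝ F
  exact ContinuousLinearMap.isUnit_iff_bijective.2 ((toFib_bijective hx).comp h)

theorem contDiffAt_gaugeCoord (h : IsGaugeAt (E := E) f φ y) {x₀ : B}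
    (hx : f y ∈ (trivializationAt F V x₀).baseSet) :
    ContDiffAt ℝ ∞ (gaugeCoord x₀ f φ) y := by
  rw [← contMDiffAt_iff_contDiffAt]
  refine contMDiffAt_clm_of_apply fun w ↦ ?_
  have h1 := ((trivializationAt F V x₀).contMDiffAt_iff (IB := 𝓘(ℝ, E))
    ((trivializationAt F V x₀).mem_source.2 hx)).1 (h.contMDiffAt_frame w)
  refine h1.2.congr_of_eventuallyEq ?_
  filter_upwards [h.contMDiffAt.continuousAt.preimage_mem_nhds
    ((trivializationAt F V x₀).open_baseSet.mem_nhds hx)] with z hz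
  exact toFib_eq hz _

theorem contDiffAt_chart_comp (hf : ContMDiffAt 𝓘(ℝ, Y) 𝓘(ℝ, E) ∞ f y) {x₀ : B}
    (hx : f y ∈ (chartAt E x₀).source) :
    ContDiffAt ℝ ∞ (extChartAt 𝓘(ℝ, E) x₀ ∘ f) y := by
  rw [← contMDiffAt_iff_contDiffAt]
  exact (contMDiffAt_extChartAt' hx).comp y hf

theorem toFib_mfderiv (hf : ContMDiffAt 𝓘(ℝ, Y) 𝓘(ℝ, E) ∞ f y) {x₀ : B}
    (hx : f y ∈ (chartAt E x₀).source) (u : Y) :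
    toFib E x₀ (f y) (mfderiv 𝓘(ℝ, Y) 𝓘(ℝ, E) f y u) =
      fderiv ℝ (extChartAt 𝓘(ℝ, E) x₀ ∘ f) y u := by
  rw [toFib, TangentBundle.continuousLinearMapAt_trivializationAt hx, ← mfderiv_eq_fderiv,
    mfderiv_comp y ((contMDiffAt_extChartAt' (n := ∞) hx).mdifferentiableAt (by simp))
      (hf.mdifferentiableAt (by simp))]
  rfl

theorem pullbackForm_apply (hf : ContMDiffAt 𝓘(ℝ, Y) 𝓘(ℝ, E) ∞ f y) {x₀ : B}
    (hx : f y ∈ (chartAt E x₀).source) (u : Y) :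
    pullbackForm cov x₀ f y u =
      locForm cov x₀ (f y) (toFib E x₀ (f y) (mfderiv 𝓘(ℝ, Y) 𝓘(ℝ, E) f y u)) := by
  rw [toFib_mfderiv hf hx]
  rfl

theorem mvfderiv_comp_apply {G : Type*} [NormedAddCommGroup G] [NormedSpace ℝ G] {g : B → G}
    (hf : ContMDiffAt 𝓘(ℝ, Y) 𝓘(ℝ, E) ∞ f y) (hg : MDifferentiableAt 𝓘(ℝ, E) 𝓘(ℝ, G) g (f y))
    (u : Y) :
    fderiv ℝ (g ∘ f) y u = mvfderiv 𝓘(ℝ, E) g (f y) (mfderiv 𝓘(ℝ, Y) 𝓘(ℝ, E) f y u) := by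
  rw [← mfderiv_eq_fderiv, mfderiv_comp y hg (hf.mdifferentiableAt (by simp))]
  rfl

variable (F V) in
/-- The transition function from the trivialization at `x₀` to the trivialization at `x₁`. -/
def transition (x₀ x₁ x : B) : F →L[ℝ] F := (toFib F x₁ x).comp (fromFib F V x₀ x)

theorem contMDiffAt_transition {x₀ x₁ x : B} (h₀ : x ∈ (trivializationAt F V x₀).baseSet)
    (h₁ : x ∈ (trivializationAt F V x₁).baseSet) :
    ContMDiffAt 𝓘(ℝ, E) 𝓘(ℝ, F →L[ℝ] F) ∞
      (transition F V x₀ x₁) x :=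
  contMDiffAt_clm_of_apply fun w ↦
    (contMDiffAt_section_iff_toFib le_rfl h₁).1 (contMDiffAt_fromFib le_rfl h₀ w)

/-- Differentiate a section with constant coordinates at x₀, once in each trivialization: at x₁ its
coordinates are the transition function, which produces the term dψ. -/
theorem pullbackForm_change (hf : ContMDiffAt 𝓘(ℝ, Y) 𝓘(ℝ, E) ∞ f y) {x₀ x₁ : B}
    (h₀ : f y ∈ chartDomain (E := E) F V x₀) (h₁ : f y ∈ chartDomain (E := E) F V x₁) :
    pullbackForm cov x₀ f y = gaugeTransform
      ((transition F V x₀ x₁) ∘ f) (pullbackForm cov x₁ f) y := by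
  have : CompleteSpace F := FiniteDimensional.complete ℝ F
  have hu : IsUnit (transition F V x₀ x₁ (f y)) := by
    refine ContinuousLinearMap.isUnit_iff_bijective.2 ((toFib_bijective h₁.1).comp ?_)
    exact Function.bijective_iff_has_inverse.2
      ⟨toFib F x₀ (f y), toFib_fromFib h₀.1, fromFib_toFib h₀.1⟩
  refine (gaugeTransform_eq_iff (ψ := transition F V x₀ x₁ ∘ f) hu).2 fun u ↦ ?_
  have hκ := contMDiffAt_transition (E := E) h₀.1 h₁.1
  have hκ' := (hκ.comp y hf).contDiffAt.differentiableAt (by simp)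
  ext w
  have hs : MDifferentiableAt 𝓘(ℝ, E) (𝓘(ℝ, E).prod 𝓘(ℝ, F))
      (fun y ↦ TotalSpace.mk' F y (fromFib F V x₀ y w)) (f y) :=
    (contMDiffAt_fromFib (n := ∞) le_rfl h₀.1 w).mdifferentiableAt (by simp)
  have e0 := toFib_cov_fromFib cov h₀.1 h₀.2 (mfderiv 𝓘(ℝ, Y) 𝓘(ℝ, E) f y u) w
  have e1 := toFib_cov cov h₁.1 h₁.2 hs (mfderiv 𝓘(ℝ, Y) 𝓘(ℝ, E) f y u)
  rw [← pullbackForm_apply cov hf h₀.2] at e0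
  rw [← pullbackForm_apply cov hf h₁.2, ← mvfderiv_comp_apply hf
    ((mdifferentiableAt_section_iff_toFib h₁.1).1 hs)] at e1
  have e2 : fderiv ℝ ((fun x ↦ toFib F x₁ x (fromFib F V x₀ x w)) ∘ f) y u =
      fderiv ℝ ((transition F V x₀ x₁) ∘ f) y u w := by
    rw [← fderiv_clm_apply_const hκ']
    rfl
  rw [e2] at e1
  change toFib F x₁ (f y) (fromFib F V x₀ (f y) (pullbackForm cov x₀ f y u w)) = _
  rw [← e0, fromFib_toFib h₀.1, e1]
  rfl

/-- `connAlong` uses at each point the trivialization centred at the image of that point. Here the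
centre is held fixed on a neighbourhood, without which the form could not be differentiated. -/
theorem connAlong_eq (h : IsGaugeAt (E := E) f φ y) {x₀ : B}
    (hx : f y ∈ chartDomain (E := E) F V x₀) :
    connAlong cov f φ y = gaugeTransform (gaugeCoord x₀ f φ) (pullbackForm cov x₀ f) y := by
  have : CompleteSpace F := FiniteDimensional.complete ℝ F
  have hy := mem_chartDomain (E := E) (F := F) (V := V) (f y)
  have hf := h.contMDiffAt
  have hκ := ((contMDiffAt_transition (E := E) hy.1 hx.1).comp y hf).contDiffAt
  have hu : IsUnit (transition F V (f y) x₀ (f y)) := by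
    refine ContinuousLinearMap.isUnit_iff_bijective.2 ((toFib_bijective hx.1).comp ?_)
    exact Function.bijective_iff_has_inverse.2
      ⟨toFib F (f y) (f y), toFib_fromFib hy.1, fromFib_toFib hy.1⟩
  have e : gaugeCoord x₀ f φ =ᶠ[𝓝 y] fun z ↦
      (transition F V (f y) x₀ ∘ f) z * gaugeCoord (f y) f φ z := by
    filter_upwards [hf.continuousAt.preimage_mem_nhds ((isOpen_chartDomain (E := E) (f y)).mem_nhds
      hy)] with z hz
    ext w
    change _ = toFib F x₀ (f z) (fromFib F V (f y) (f z) (toFib F (f y) (f z) (φ z w)))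
    rw [fromFib_toFib hz.1]
    rfl
  rw [gaugeTransform_congr (A' := pullbackForm cov x₀ f) e rfl,
    gaugeTransform_mul (ψ := transition F V (f y) x₀ ∘ f) hu (isUnit_gaugeCoord hy.1 h.bijective) (hκ.differentiableAt (by simp))
    ((contDiffAt_gaugeCoord h hy.1).differentiableAt (by simp))]
  exact gaugeTransform_congr Filter.EventuallyEq.rfl
    (pullbackForm_change cov hf hy hx)

theorem eventually_mem_chartDomain (hf : ContMDiffAt 𝓘(ℝ, Y) 𝓘(ℝ, E) ∞ f y) {x₀ : B}
    (hx : f y ∈ chartDomain (E := E) F V x₀) :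
    ∀ᶠ z in 𝓝 y, f z ∈ chartDomain (E := E) F V x₀ :=
  hf.continuousAt.preimage_mem_nhds ((isOpen_chartDomain (E := E) x₀).mem_nhds hx)

theorem connAlong_eventuallyEq (h : ∀ᶠ z in 𝓝 y, IsGaugeAt (E := E) f φ z) {x₀ : B}
    (hx : f y ∈ chartDomain (E := E) F V x₀) :
    connAlong cov f φ =ᶠ[𝓝 y] gaugeTransform (gaugeCoord x₀ f φ) (pullbackForm cov x₀ f) := by
  filter_upwards [h, eventually_mem_chartDomain h.self_of_nhds.contMDiffAt hx] with z hz hz'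
  exact connAlong_eq cov hz hz'

theorem contDiffAt_pullbackForm (hcov : cov.ContMDiffCovariantDerivative ∞)
    (hf : ContMDiffAt 𝓘(ℝ, Y) 𝓘(ℝ, E) ∞ f y) :
    ContDiffAt ℝ ∞ (pullbackForm cov (f y) f) y := by
  refine ContDiffAt.clm_comp ?_ ?_
  · exact ((contMDiffAt_locForm cov hcov (f y)).comp y hf).contDiffAt
  · exact (contDiffAt_chart_comp hf (mem_chart_source E (f y))).fderiv_right (by simp)

theorem contDiffAt_connAlong (hcov : cov.ContMDiffCovariantDerivative ∞)
    (h : ∀ᶠ z in 𝓝 y, IsGaugeAt (E := E) f φ z) : ContDiffAt ℝ ∞ (connAlong cov f φ) y := by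
  have : CompleteSpace F := FiniteDimensional.complete ℝ F
  have hy := mem_chartDomain (E := E) (F := F) (V := V) (f y)
  have h0 := h.self_of_nhds
  exact (contDiffAt_gaugeTransform (isUnit_gaugeCoord hy.1 h0.bijective)
    (contDiffAt_gaugeCoord h0 hy.1)
    (contDiffAt_pullbackForm cov hcov h0.contMDiffAt)).congr_of_eventuallyEq
      (connAlong_eventuallyEq cov h hy)

/-- The second derivative of f in the chart is symmetric and drops out of dA; what remains is the
structure equation at f y. -/
theorem curv_pullbackForm (hcov : cov.ContMDiffCovariantDerivative ∞)
    (hf : ContMDiffAt 𝓘(ℝ, Y) 𝓘(ℝ, E) ∞ f y) (u v : Y) (w : V (f y)) :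
    curv (pullbackForm cov (f y) f) y u v (toFib F (f y) (f y) w) =
      toFib F (f y) (f y) (curvature cov hcov (f y) (mfderiv 𝓘(ℝ, Y) 𝓘(ℝ, E) f y u)
        (mfderiv 𝓘(ℝ, Y) 𝓘(ℝ, E) f y v) w) := by
  have hc := mem_chart_source E (f y)
  have hΓ := contMDiffAt_locForm cov hcov (f y)
  have hΓf := ((hΓ.comp y hf).contDiffAt).differentiableAt (by simp)
  have hg := contDiffAt_chart_comp hf hc
  have hg' : DifferentiableAt ℝ (fderiv ℝ (extChartAt 𝓘(ℝ, E) (f y) ∘ f)) y :=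
    (hg.fderiv_right (m := ∞) (by simp)).differentiableAt (by simp)
  have hs := (hg.isSymmSndFDerivAt two_le_infty).eq u v
  have key : ∀ a b : Y, fderiv ℝ (pullbackForm cov (f y) f) y a b =
      mvfderiv 𝓘(ℝ, E) (locForm cov (f y)) (f y) (mfderiv 𝓘(ℝ, Y) 𝓘(ℝ, E) f y a)
        (toFib E (f y) (f y) (mfderiv 𝓘(ℝ, Y) 𝓘(ℝ, E) f y b)) +
      locForm cov (f y) (f y) (fderiv ℝ (fderiv ℝ (extChartAt 𝓘(ℝ, E) (f y) ∘ f)) y a b) := by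
    intro a b
    rw [toFib_mfderiv hf hc, ← mvfderiv_comp_apply hf (hΓ.mdifferentiableAt (by simp))]
    have := fderiv_clm_comp hΓf hg'
    change fderiv ℝ (fun z ↦ ((locForm cov (f y) ∘ f) z).comp
      (fderiv ℝ (extChartAt 𝓘(ℝ, E) (f y) ∘ f) z)) y a b = _
    rw [this, add_apply, add_apply, add_comm]
    rfl
  rw [curvature_fromFib, curv, key, key, hs, pullbackForm_apply cov hf hc,
    pullbackForm_apply cov hf hc]
  simp only [add_apply, sub_apply, mul_apply_eq_comp]
  abel

/-- The bridge between the invariant `curvature` on the bundle and the computable `curv` on a vector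
space. -/
theorem curv_connAlong (hcov : cov.ContMDiffCovariantDerivative ∞)
    (h : ∀ᶠ z in 𝓝 y, IsGaugeAt (E := E) f φ z) (u v : Y) (w : F) :
    φ y (curv (connAlong cov f φ) y u v w) =
      curvature cov hcov (f y) (mfderiv 𝓘(ℝ, Y) 𝓘(ℝ, E) f y u)
        (mfderiv 𝓘(ℝ, Y) 𝓘(ℝ, E) f y v) (φ y w) := by
  have : CompleteSpace F := FiniteDimensional.complete ℝ F
  have hy := mem_chartDomain (E := E) (F := F) (V := V) (f y)
  have h0 := h.self_of_nhds
  apply (toFib_bijective (F := F) hy.1).1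
  rw [← curv_pullbackForm cov hcov h0.contMDiffAt, curv_congr (connAlong_eventuallyEq cov h hy)]
  exact congrArg (fun L ↦ L w) (mul_curv_gaugeTransform (isUnit_gaugeCoord hy.1 h0.bijective)
    (contDiffAt_gaugeCoord h0 hy.1) (contDiffAt_pullbackForm cov hcov h0.contMDiffAt) u v)

theorem connAlong_mul (h : IsGaugeAt (E := E) f φ y) {k : Y → F →L[ℝ] F} (hk : IsUnit (k y))
    (dk : DifferentiableAt ℝ k y) :
    connAlong cov f (fun z ↦ (φ z).comp (k z)) y =
      gaugeTransform k (connAlong cov f φ) y := by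
  have hy := mem_chartDomain (E := E) (F := F) (V := V) (f y)
  have e : gaugeCoord (f y) f (fun z ↦ (φ z).comp (k z)) = fun z ↦ gaugeCoord (f y) f φ z * k z :=
    rfl
  rw [connAlong, e, gaugeTransform_mul (A := pullbackForm cov (f y) f)
    (isUnit_gaugeCoord hy.1 h.bijective) hk
    ((contDiffAt_gaugeCoord h hy.1).differentiableAt (by simp)) dk]
  exact gaugeTransform_congr Filter.EventuallyEq.rfl rfl

theorem connAlong_comp {Z : Type*} [NormedAddCommGroup Z] [NormedSpace ℝ Z] {z : Z → Y} {x : Z}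
    (h : IsGaugeAt (E := E) f φ (z x)) (dz : DifferentiableAt ℝ z x) :
    connAlong cov (f ∘ z) (fun x ↦ φ (z x)) x =
      (connAlong cov f φ (z x)).comp (fderiv ℝ z x) := by
  have hy := mem_chartDomain (E := E) (F := F) (V := V) (f (z x))
  refine Eq.trans ?_ (gaugeTransform_comp
    ((contDiffAt_gaugeCoord h hy.1).differentiableAt (by simp)) dz)
  refine gaugeTransform_congr (Filter.EventuallyEq.rfl) ?_
  ext1 u
  have h1 := (contDiffAt_chart_comp h.contMDiffAt hy.2).differentiableAt (by simp)
  change locForm cov _ _ (fderiv ℝ ((extChartAt 𝓘(ℝ, E) (f (z x)) ∘ f) ∘ z) x u) = _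
  rw [fderiv_comp x h1 dz]
  rfl

/-- Parallelism of J is assumed for global smooth sections; a global section with the germ of a
constant-coordinate one turns it into dJ = [J, Γ] at the centre of the trivialization. -/
theorem toFib_parallel {J : Π x : B, V x →L[ℝ] V x} (D : ComplexConnection 𝓘(ℝ, E) F J) {x : B}
    (hJ : MDifferentiableAt 𝓘(ℝ, E) 𝓘(ℝ, F →L[ℝ] F)
      (fun z ↦ (toFib F x z).comp ((J z).comp (fromFib F V x z))) x)
    (u : TangentSpace 𝓘(ℝ, E) x) (w : F) :
    mvfderiv 𝓘(ℝ, E) (fun z ↦ toFib F x z (J z (fromFib F V x z w))) x u +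
      locForm D.cov x x (toFib E x x u) (toFib F x x (J x (fromFib F V x x w))) =
      toFib F x x (J x (fromFib F V x x (locForm D.cov x x (toFib E x x u) w))) := by
  have hx := mem_chartDomain (E := E) (F := F) (V := V) x
  have hJw : MDifferentiableAt 𝓘(ℝ, E) (𝓘(ℝ, E).prod 𝓘(ℝ, F))
      (fun z ↦ TotalSpace.mk' F z (J z (fromFib F V x z w))) x := by
    rw [mdifferentiableAt_section_iff_toFib hx.1]
    exact (ContinuousLinearMap.apply ℝ F w).mdifferentiableAt.comp x hJ
  rw [← toFib_cov D.cov hx.1 hx.2 hJw, ← toFib_cov_fromFib D.cov hx.1 hx.2,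
    fromFib_toFib hx.1]
  obtain ⟨σ, hσ, hσv⟩ := exists_smooth_section (I := 𝓘(ℝ, E)) (F := F) x (fromFib F V x x w)
  have hσ' : ∀ᶠ y in 𝓝 x, fromFib F V x y w = σ y := by
    filter_upwards [hσv, extend_eventuallyEq_fromFib hx.1 (fromFib F V x x w)] with y h1 h2
    rw [h1, h2, toFib_fromFib hx.1]
  have hw : MDifferentiableAt 𝓘(ℝ, E) (𝓘(ℝ, E).prod 𝓘(ℝ, F))
      (fun z ↦ TotalSpace.mk' F z (fromFib F V x z w)) x :=
    (contMDiffAt_fromFib (n := ∞) le_rfl hx.1 w).mdifferentiableAt (by simp)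
  have hJσ : (fun z ↦ TotalSpace.mk' F z (J z (fromFib F V x z w))) =ᶠ[𝓝 x]
      (fun z ↦ TotalSpace.mk' F z (J z (σ z))) := by
    filter_upwards [hσ'] with z hz
    rw [hz]
  have e1 := D.cov.isCovariantDerivativeOnUniv.congr_of_eventuallyEq
    (σ := fun z ↦ J z (fromFib F V x z w)) (σ' := fun z ↦ J z (σ z)) hJw
    (hJw.congr_of_eventuallyEq hJσ.symm) Filter.univ_mem
    (hσ'.mono fun z hz ↦ by simp only [hz])
  have e2 := D.cov.isCovariantDerivativeOnUniv.congr_of_eventuallyEq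
    (σ := fun z ↦ fromFib F V x z w) (σ' := σ) hw
    ((hσ x).mdifferentiableAt (by simp)) Filter.univ_mem hσ'
  rw [e1, e2, D.complexLinear σ hσ x]
  rfl

/-- K is the matrix of the complex structure in the frame φ. When K is constant, this says that the
connection form commutes with it. -/
theorem fderiv_complexStructure {J : Π x : B, V x →L[ℝ] V x}
    (D : ComplexConnection 𝓘(ℝ, E) F J)
    (hJ : MDifferentiableAt 𝓘(ℝ, E) 𝓘(ℝ, F →L[ℝ] F)
      (fun z ↦ (toFib F (f y) z).comp ((J z).comp (fromFib F V (f y) z))) (f y))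
    (h : IsGaugeAt (E := E) f φ y)
    {K : Y → F →L[ℝ] F} (hK : ∀ᶠ z in 𝓝 y, ∀ w, φ z (K z w) = J (f z) (φ z w)) (u : Y) :
    DifferentiableAt ℝ K y ∧ fderiv ℝ K y u =
      K y * connAlong D.cov f φ y u - connAlong D.cov f φ y u * K y := by
  have : CompleteSpace F := FiniteDimensional.complete ℝ F
  have hy := mem_chartDomain (E := E) (F := F) (V := V) (f y)
  have hψ := isUnit_gaugeCoord hy.1 h.bijective
  have dψ := contDiffAt_gaugeCoord h hy.1
  let JE : B → F →L[ℝ] F := fun z ↦ (toFib F (f y) z).comp ((J z).comp (fromFib F V (f y) z))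
  have dJ : DifferentiableAt ℝ (JE ∘ f) y := by
    rw [← mdifferentiableAt_iff_differentiableAt]
    exact MDifferentiableAt.comp y hJ (h.contMDiffAt.mdifferentiableAt (by simp))
  have hKψ : ∀ᶠ z in 𝓝 y, gaugeCoord (f y) f φ z * K z = (JE ∘ f) z * gaugeCoord (f y) f φ z := by
    filter_upwards [hK, eventually_mem_chartDomain h.contMDiffAt hy] with z h1 h2
    ext w
    change toFib F (f y) (f z) (φ z (K z w)) = toFib F (f y) (f z) (J (f z)
      (fromFib F V (f y) (f z) (toFib F (f y) (f z) (φ z w))))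
    rw [fromFib_toFib h2.1, h1]
  have dK : DifferentiableAt ℝ K y := by
    have e : K =ᶠ[𝓝 y] fun z ↦ Ring.inverse (gaugeCoord (f y) f φ z) *
        ((JE ∘ f) z * gaugeCoord (f y) f φ z) := by
      filter_upwards [hKψ, isUnit_eventually hψ dψ.continuousAt] with z h1 h2
      rw [← h1, ← mul_assoc, Ring.inverse_mul_cancel _ h2, one_mul]
    exact (((contDiffAt_inverse hψ dψ).differentiableAt (by simp)).fun_mul
      (dJ.fun_mul (dψ.differentiableAt (by simp)))).congr_of_eventuallyEq e
  refine ⟨dK, fderiv_parallel hψ (dψ.differentiableAt (by simp)) dJ dK ?_ hKψ⟩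
  ext w
  have h1 := toFib_parallel D hJ (mfderiv 𝓘(ℝ, Y) 𝓘(ℝ, E) f y u) w
  rw [← pullbackForm_apply D.cov h.contMDiffAt hy.2] at h1
  have h2 : fderiv ℝ (JE ∘ f) y u w = mvfderiv 𝓘(ℝ, E)
      (fun z ↦ toFib F (f y) z (J z (fromFib F V (f y) z w))) (f y)
      (mfderiv 𝓘(ℝ, Y) 𝓘(ℝ, E) f y u) := by
    rw [← fderiv_clm_apply_const dJ]
    exact mvfderiv_comp_apply h.contMDiffAt
      ((ContinuousLinearMap.apply ℝ F w).mdifferentiableAt.comp (f y) hJ) u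
  rw [h2]
  exact eq_sub_of_add_eq h1

end Pullback

/-! ### Permutation sums and trace identities. -/

theorem sum_perm_fin_four {G : Type*} [AddCommGroup G] (f : Fin 4 → Fin 4 → Fin 4 → Fin 4 → G) :
    ∑ s : Equiv.Perm (Fin 4), ((s.sign : ℤ)) • f (s 0) (s 1) (s 2) (s 3) =
      f 0 1 2 3 - f 0 1 3 2 - f 0 2 1 3 + f 0 2 3 1 + f 0 3 1 2 - f 0 3 2 1
      - f 1 0 2 3 + f 1 0 3 2 + f 1 2 0 3 - f 1 2 3 0 - f 1 3 0 2 + f 1 3 2 0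
      + f 2 0 1 3 - f 2 0 3 1 - f 2 1 0 3 + f 2 1 3 0 + f 2 3 0 1 - f 2 3 1 0
      - f 3 0 1 2 + f 3 0 2 1 + f 3 1 0 2 - f 3 1 2 0 - f 3 2 0 1 + f 3 2 1 0 := by
  -- A permutation of four letters is the image of 0 together with a permutation of three letters,
  -- which makes the enumeration 4 × 6.
  rw [← Equiv.Perm.decomposeFin.symm.sum_comp, Fintype.sum_prod_type]
  have h : ∀ p : Fin 4, ∀ e : Equiv.Perm (Fin 3), (Equiv.Perm.decomposeFin.symm (p, e)) 0 = p ∧ 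
    (Equiv.Perm.decomposeFin.symm (p, e)) 1 = Equiv.swap 0 p (e 0).succ ∧ 
    (Equiv.Perm.decomposeFin.symm (p, e)) 2 = Equiv.swap 0 p (e 1).succ ∧ 
    (Equiv.Perm.decomposeFin.symm (p, e)) 3 = Equiv.swap 0 p (e 2).succ := by decide
  simp only [fun p e ↦ (h p e).1, fun p e ↦ (h p e).2.1, fun p e ↦ (h p e).2.2.1, fun p e ↦ (h p e).2.2.2, Equiv.Perm.decomposeFin.symm_sign]
  have u : (Finset.univ : Finset (Equiv.Perm (Fin 3))) = {1, Equiv.swap 0 1, Equiv.swap 0 2, Equiv.swap 1 2, Equiv.swap 0 1 * Equiv.swap 1 2, Equiv.swap 1 2 * Equiv.swap 0 1} := by decide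
  simp only [u, Fin.sum_univ_four]
  repeat rw [Finset.sum_insert (by decide)]
  simp only [Finset.sum_singleton]
  have p0 : (1 : Equiv.Perm (Fin 3)) 0 = 0 ∧ (1 : Equiv.Perm (Fin 3)) 1 = 1 ∧ (1 : Equiv.Perm (Fin 3)) 2 = 2 ∧ Equiv.Perm.sign (1 : Equiv.Perm (Fin 3)) = 1 := by decide
  have p1 : (Equiv.swap 0 1 : Equiv.Perm (Fin 3)) 0 = 1 ∧ (Equiv.swap 0 1 : Equiv.Perm (Fin 3)) 1 = 0 ∧ (Equiv.swap 0 1 : Equiv.Perm (Fin 3)) 2 = 2 ∧ Equiv.Perm.sign (Equiv.swap 0 1 : Equiv.Perm (Fin 3)) = -1 := by decide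
  have p2 : (Equiv.swap 0 2 : Equiv.Perm (Fin 3)) 0 = 2 ∧ (Equiv.swap 0 2 : Equiv.Perm (Fin 3)) 1 = 1 ∧ (Equiv.swap 0 2 : Equiv.Perm (Fin 3)) 2 = 0 ∧ Equiv.Perm.sign (Equiv.swap 0 2 : Equiv.Perm (Fin 3)) = -1 := by decide
  have p3 : (Equiv.swap 1 2 : Equiv.Perm (Fin 3)) 0 = 0 ∧ (Equiv.swap 1 2 : Equiv.Perm (Fin 3)) 1 = 2 ∧ (Equiv.swap 1 2 : Equiv.Perm (Fin 3)) 2 = 1 ∧ Equiv.Perm.sign (Equiv.swap 1 2 : Equiv.Perm (Fin 3)) = -1 := by decide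
  have p4 : (Equiv.swap 0 1 * Equiv.swap 1 2 : Equiv.Perm (Fin 3)) 0 = 1 ∧ (Equiv.swap 0 1 * Equiv.swap 1 2 : Equiv.Perm (Fin 3)) 1 = 2 ∧ (Equiv.swap 0 1 * Equiv.swap 1 2 : Equiv.Perm (Fin 3)) 2 = 0 ∧ Equiv.Perm.sign (Equiv.swap 0 1 * Equiv.swap 1 2 : Equiv.Perm (Fin 3)) = 1 := by decide
  have p5 : (Equiv.swap 1 2 * Equiv.swap 0 1 : Equiv.Perm (Fin 3)) 0 = 2 ∧ (Equiv.swap 1 2 * Equiv.swap 0 1 : Equiv.Perm (Fin 3)) 1 = 0 ∧ (Equiv.swap 1 2 * Equiv.swap 0 1 : Equiv.Perm (Fin 3)) 2 = 1 ∧ Equiv.Perm.sign (Equiv.swap 1 2 * Equiv.swap 0 1 : Equiv.Perm (Fin 3)) = 1 := by decide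
  have q0 : Equiv.swap (0 : Fin 4) 0 0 = 0 ∧ Equiv.swap (0 : Fin 4) 0 1 = 1 ∧ Equiv.swap (0 : Fin 4) 0 2 = 2 ∧ Equiv.swap (0 : Fin 4) 0 3 = 3 := by decide
  have q1 : Equiv.swap (0 : Fin 4) 1 0 = 1 ∧ Equiv.swap (0 : Fin 4) 1 1 = 0 ∧ Equiv.swap (0 : Fin 4) 1 2 = 2 ∧ Equiv.swap (0 : Fin 4) 1 3 = 3 := by decide
  have q2 : Equiv.swap (0 : Fin 4) 2 0 = 2 ∧ Equiv.swap (0 : Fin 4) 2 1 = 1 ∧ Equiv.swap (0 : Fin 4) 2 2 = 0 ∧ Equiv.swap (0 : Fin 4) 2 3 = 3 := by decide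
  have q3 : Equiv.swap (0 : Fin 4) 3 0 = 3 ∧ Equiv.swap (0 : Fin 4) 3 1 = 1 ∧ Equiv.swap (0 : Fin 4) 3 2 = 2 ∧ Equiv.swap (0 : Fin 4) 3 3 = 0 := by decide
  have r : (0 : Fin 3).succ = 1 ∧ (1 : Fin 3).succ = 2 ∧ (2 : Fin 3).succ = 3 := by decide
  simp only [p0.1, p0.2.1, p0.2.2.1, p0.2.2.2, p1.1, p1.2.1, p1.2.2.1, p1.2.2.2, p2.1, p2.2.1, p2.2.2.1, p2.2.2.2, p3.1, p3.2.1, p3.2.2.1, p3.2.2.2, p4.1, p4.2.1, p4.2.2.1, p4.2.2.2, p5.1, p5.2.1, p5.2.2.1, p5.2.2.2, q0.2.1, q0.2.2.1, q0.2.2.2, q1.2.1, q1.2.2.1, q1.2.2.2, q2.2.1, q2.2.2.1, q2.2.2.2, q3.2.1, q3.2.2.1, q3.2.2.2, r.1, r.2.1, r.2.2]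
  simp
  abel

section Algebra
variable {R : Type*} [Ring R]

/-- The coefficient identity behind d CS = 4 tr(F ∧ F), with `a i` for Aᵢ, `d i j` for ∂ᵢAⱼ and `dd`
for second derivatives. The second derivatives cancel by symmetry, and the words of length four in
the `a i` cancel after cyclic rotation. -/
theorem trace_chernSimons (τ : R →+ ℂ) (hτ : ∀ x y, τ (x * y) = τ (y * x))
    (a : Fin 4 → R) (d : Fin 4 → Fin 4 → R) (dd : Fin 4 → Fin 4 → Fin 4 → R)
    (hdd : ∀ i j k, dd i j k = dd j i k)
    (F : Fin 4 → Fin 4 → R) (hF : ∀ i j, F i j = d i j - d j i + (a i * a j - a j * a i))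
    (dF : Fin 4 → Fin 4 → Fin 4 → R) (hdF : ∀ k i j, dF k i j = dd k i j - dd k j i +
      ((d k i * a j + a i * d k j) - (d k j * a i + a j * d k i)))
    (c : Fin 4 → Fin 4 → Fin 4 → Fin 4 → ℂ)
    (hc : ∀ k i j l, c k i j l = 4 * (τ (d k i * F j l) + τ (a i * dF k j l)
        - (τ (d k j * F i l) + τ (a j * dF k i l)) + (τ (d k l * F i j) + τ (a l * dF k i j)))
      - 4 * (τ (d k i * (a j * a l)) + τ (a i * (d k j * a l)) + τ (a i * (a j * d k l))
        - (τ (d k i * (a l * a j)) + τ (a i * (d k l * a j)) + τ (a i * (a l * d k j))))) :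
    c 0 1 2 3 - c 1 0 2 3 + c 2 0 1 3 - c 3 0 1 2 =
      8 * (τ (F 0 1 * F 2 3) - τ (F 0 2 * F 1 3) + τ (F 0 3 * F 1 2)) := by
  have r1 : ∀ i j k l, τ (a i * (d j k * a l)) = τ (d j k * (a l * a i)) := fun i j k l ↦ by
    rw [hτ, mul_assoc]
  have r2 : ∀ i j k l, τ (a i * (a j * d k l)) = τ (d k l * (a i * a j)) := fun i j k l ↦ by
    rw [← mul_assoc, hτ]
  have r3 : ∀ i j k l, τ (d i j * d k l) = τ (d k l * d i j) := fun i j k l ↦ hτ _ _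
  have r6 : ∀ i j k, τ (a i * (a 0 * (a j * a k))) = τ (a 0 * (a j * (a k * a i))) :=
    fun i j k ↦ by rw [hτ]; simp only [mul_assoc]
  simp only [hc, hF, hdF, mul_add, add_mul, mul_sub, sub_mul, map_add, map_sub, mul_assoc, r1, r2,
    r6, hdd 1 0, hdd 2 0, hdd 3 0, hdd 2 1, hdd 3 1, hdd 3 2]
  simp only [r3 2 3 0 1, r3 2 3 1 0, r3 3 2 0 1, r3 3 2 1 0, r3 1 3 0 2, r3 1 3 2 0, r3 3 1 0 2,
    r3 3 1 2 0, r3 1 2 0 3, r3 1 2 3 0, r3 2 1 0 3, r3 2 1 3 0]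
  ring

/-- By cyclicity τ(U[V, W]) is an alternating trilinear form, so on the span of three elements it is
a determinant times one number. -/
theorem trace_alternating (τ : R →+ ℂ) (hτ : ∀ x y, τ (x * y) = τ (y * x)) [Module ℝ R]
    [IsScalarTower ℝ R R] [SMulCommClass ℝ R R]
    (hs : ∀ (r : ℝ) x, τ (r • x) = r * τ x) (l₁ l₂ l₃ : R) (u v w : Fin 3 → ℝ)
    (U V W : R) (hU : U = u 0 • l₁ + u 1 • l₂ + u 2 • l₃)
    (hV : V = v 0 • l₁ + v 1 • l₂ + v 2 • l₃)
    (hW : W = w 0 • l₁ + w 1 • l₂ + w 2 • l₃) :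
    τ (U * (V * W)) - τ (U * (W * V)) =
      (u 0 * (v 1 * w 2 - v 2 * w 1) - u 1 * (v 0 * w 2 - v 2 * w 0) +
        u 2 * (v 0 * w 1 - v 1 * w 0) : ℝ) * (τ (l₁ * (l₂ * l₃)) - τ (l₁ * (l₃ * l₂))) := by
  have cyc : ∀ x y z, τ (x * (y * z)) = τ (y * (z * x)) := fun x y z ↦ by rw [hτ, mul_assoc]
  subst hU hV hW
  simp only [mul_add, add_mul, map_add, smul_mul_assoc, mul_smul_comm, hs]
  have h (x y : R) : τ (x * (y * x)) = τ (x * (x * y)) := (cyc _ _ _).trans (cyc _ _ _)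
  have h' (x y : R) : τ (x * (y * y)) = τ (y * (y * x)) := cyc _ _ _
  rw [h l₁ l₂, h l₁ l₃, h l₂ l₁, h l₂ l₃, h l₃ l₁, h l₃ l₂, h' l₁ l₂, h' l₁ l₃, h' l₂ l₁, h' l₂ l₃,
    h' l₃ l₁, h' l₃ l₂, cyc l₂ l₃ l₁, cyc l₃ l₁ l₂, cyc l₃ l₂ l₁, cyc l₂ l₁ l₃]
  push_cast
  ring

end Algebra
end SU2Action

open MeasureTheory

namespace SU2Action

/-- Four-dimensional Euclidean space. -/
abbrev R4 : Type := EuclideanSpace ℝ (Fin 4)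

/-- The standard basis of `ℝ⁴`. -/
abbrev stdVec (i : Fin 4) : R4 := EuclideanSpace.single i 1

/-! ### The Chern–Simons form and Stokes' theorem with a cutoff. -/

section ChernSimons

variable {𝒜 : Type*} [NormedRing 𝒜] [NormedAlgebra ℝ 𝒜]

/-- The values on the standard basis of the 4-form `4 τ (F ∧ F)`, where `F` is the curvature of
`A`. -/
def traceSq (τ : 𝒜 →L[ℝ] ℂ) (A : R4 → R4 →L[ℝ] 𝒜) (y : R4) : ℂ :=
  ∑ s : Equiv.Perm (Fin 4), (s.sign : ℤ) •
    τ (curv A y (stdVec (s 0)) (stdVec (s 1)) * curv A y (stdVec (s 2)) (stdVec (s 3)))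

theorem curv_swap (A : R4 → R4 →L[ℝ] 𝒜) (y u v : R4) : curv A y v u = - curv A y u v := by
  unfold curv
  abel

/-- There are three ways to split four indices into two pairs, and each of them accounts for eight
equal terms. -/
theorem sum_perm_alternating {B : R4 → R4 → 𝒜} (hB : ∀ u v, B v u = - B u v)
    (β : 𝒜 →+ 𝒜 →+ ℂ) (hβ : ∀ x y, β x y = β y x) :
    ∑ s : Equiv.Perm (Fin 4), (s.sign : ℤ) •
      β (B (stdVec (s 0)) (stdVec (s 1))) (B (stdVec (s 2)) (stdVec (s 3))) =
    8 * (β (B (stdVec 0) (stdVec 1)) (B (stdVec 2) (stdVec 3)) -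
      β (B (stdVec 0) (stdVec 2)) (B (stdVec 1) (stdVec 3)) +
      β (B (stdVec 0) (stdVec 3)) (B (stdVec 1) (stdVec 2))) := by
  rw [sum_perm_fin_four (fun a b c d ↦
    β (B (stdVec a) (stdVec b)) (B (stdVec c) (stdVec d)))]
  rw [hB (stdVec 0) (stdVec 1), hB (stdVec 0) (stdVec 2), hB (stdVec 0) (stdVec 3),
    hB (stdVec 1) (stdVec 2), hB (stdVec 1) (stdVec 3), hB (stdVec 2) (stdVec 3)]
  simp only [map_neg, AddMonoidHom.neg_apply]
  rw [hβ (B (stdVec 2) (stdVec 3)), hβ (B (stdVec 1) (stdVec 3)), hβ (B (stdVec 1) (stdVec 2))]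
  ring

theorem traceSq_eq (τ : 𝒜 →L[ℝ] ℂ) (hτ : ∀ x y, τ (x * y) = τ (y * x))
    (A : R4 → R4 →L[ℝ] 𝒜) (y : R4) :
    traceSq τ A y = 8 * (τ (curv A y (stdVec 0) (stdVec 1) * curv A y (stdVec 2) (stdVec 3)) -
      τ (curv A y (stdVec 0) (stdVec 2) * curv A y (stdVec 1) (stdVec 3)) +
      τ (curv A y (stdVec 0) (stdVec 3) * curv A y (stdVec 1) (stdVec 2))) :=
  sum_perm_alternating (curv_swap A y)
    ((AddMonoidHom.mul (R := 𝒜)).compr₂ (τ : 𝒜 →+ ℂ)) hτ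

/-- The Chern–Simons 3-form, a primitive of `4 τ (F ∧ F)`. -/
def chernSimons (τ : 𝒜 →L[ℝ] ℂ) (A : R4 → R4 →L[ℝ] 𝒜) (u v w y : R4) : ℂ :=
  4 * (τ (A y u * curv A y v w) - τ (A y v * curv A y u w) + τ (A y w * curv A y u v)) -
    4 * (τ (A y u * (A y v * A y w)) - τ (A y u * (A y w * A y v)))

/-- The values on the standard basis of the exterior product of the differential of `χ` with the
Chern–Simons form. -/
def wedgeChernSimons (τ : 𝒜 →L[ℝ] ℂ) (χ : R4 → ℝ) (A : R4 → R4 →L[ℝ] 𝒜) (y : R4) : ℂ :=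
  fderiv ℝ χ y (stdVec 0) • chernSimons τ A (stdVec 1) (stdVec 2) (stdVec 3) y -
  fderiv ℝ χ y (stdVec 1) • chernSimons τ A (stdVec 0) (stdVec 2) (stdVec 3) y +
  fderiv ℝ χ y (stdVec 2) • chernSimons τ A (stdVec 0) (stdVec 1) (stdVec 3) y -
  fderiv ℝ χ y (stdVec 3) • chernSimons τ A (stdVec 0) (stdVec 1) (stdVec 2) y

theorem contDiffAt_curv {A : R4 → R4 →L[ℝ] 𝒜} {y : R4} (dA : ContDiffAt ℝ ∞ A y) (u v : R4) :
    ContDiffAt ℝ ∞ (fun z ↦ curv A z u v) y := by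
  have h (u v : R4) : ContDiffAt ℝ ∞ (fun z ↦ fderiv ℝ A z u v) y :=
    ((dA.fderiv_right (m := ∞) (by simp)).clm_apply contDiffAt_const).clm_apply contDiffAt_const
  have h' (u : R4) : ContDiffAt ℝ ∞ (fun z ↦ A z u) y := dA.clm_apply contDiffAt_const
  exact ((h u v).sub (h v u)).add (((h' u).mul (h' v)).sub ((h' v).mul (h' u)))

theorem fderiv_mul_apply {f g : R4 → 𝒜} {y : R4} (hf : DifferentiableAt ℝ f y)
    (hg : DifferentiableAt ℝ g y) (k : R4) :
    fderiv ℝ (fun z ↦ f z * g z) y k = fderiv ℝ f y k * g y + f y * fderiv ℝ g y k := by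
  rw [fderiv_fun_mul' hf hg]
  simp [add_comm]

theorem fderiv_curv {A : R4 → R4 →L[ℝ] 𝒜} {y : R4} (dA : ContDiffAt ℝ ∞ A y) (k u v : R4) :
    fderiv ℝ (fun z ↦ curv A z u v) y k =
      fderiv ℝ (fderiv ℝ A) y k u v - fderiv ℝ (fderiv ℝ A) y k v u +
      ((fderiv ℝ A y k u * A y v + A y u * fderiv ℝ A y k v) -
        (fderiv ℝ A y k v * A y u + A y v * fderiv ℝ A y k u)) := by
  have h1 : DifferentiableAt ℝ A y := dA.differentiableAt (by simp)
  have h2 : DifferentiableAt ℝ (fderiv ℝ A) y :=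
    (dA.fderiv_right (m := ∞) (by simp)).differentiableAt (by simp)
  have h3 (u : R4) : DifferentiableAt ℝ (fun z ↦ A z u) y := h1.clm_apply (by fun_prop)
  have h4 (u : R4) : DifferentiableAt ℝ (fun z ↦ fderiv ℝ A z u) y := h2.clm_apply (by fun_prop)
  have h5 (u v : R4) : DifferentiableAt ℝ (fun z ↦ fderiv ℝ A z u v) y :=
    (h4 u).clm_apply (by fun_prop)
  unfold curv
  rw [fderiv_fun_add ((h5 u v).fun_sub (h5 v u))
      (((h3 u).fun_mul (h3 v)).fun_sub ((h3 v).fun_mul (h3 u))),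
    fderiv_fun_sub (h5 u v) (h5 v u), fderiv_fun_sub ((h3 u).fun_mul (h3 v)) ((h3 v).fun_mul (h3 u))]
  simp only [add_apply, sub_apply, fderiv_mul_apply (h3 u) (h3 v), fderiv_mul_apply (h3 v) (h3 u),
    fderiv_clm_apply_const h1, fderiv_clm_apply_const (h4 u), fderiv_clm_apply_const (h4 v),
    fderiv_clm_apply_const h2]

theorem contDiffAt_chernSimons (τ : 𝒜 →L[ℝ] ℂ) {A : R4 → R4 →L[ℝ] 𝒜} {y : R4}
    (dA : ContDiffAt ℝ ∞ A y) (u v w : R4) :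
    ContDiffAt ℝ ∞ (chernSimons τ A u v w) y := by
  have h (u : R4) : ContDiffAt ℝ ∞ (fun z ↦ A z u) y := dA.clm_apply contDiffAt_const
  have t {f : R4 → 𝒜} (hf : ContDiffAt ℝ ∞ f y) : ContDiffAt ℝ ∞ (fun z ↦ τ (f z)) y :=
    τ.contDiff.contDiffAt.comp y hf
  have c := contDiffAt_curv dA
  exact (contDiffAt_const.mul (((t ((h u).mul (c v w))).sub (t ((h v).mul (c u w)))).add
    (t ((h w).mul (c u v))))).sub (contDiffAt_const.mul
      ((t ((h u).mul ((h v).mul (h w)))).sub (t ((h u).mul ((h w).mul (h v))))))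

theorem fderiv_chernSimons (τ : 𝒜 →L[ℝ] ℂ) {A : R4 → R4 →L[ℝ] 𝒜} {y : R4}
    (dA : ContDiffAt ℝ ∞ A y) (k u v w : R4) :
    fderiv ℝ (chernSimons τ A u v w) y k =
      4 * (τ (fderiv ℝ A y k u * curv A y v w) + τ (A y u * fderiv ℝ (fun z ↦ curv A z v w) y k)
        - (τ (fderiv ℝ A y k v * curv A y u w) + τ (A y v * fderiv ℝ (fun z ↦ curv A z u w) y k))
        + (τ (fderiv ℝ A y k w * curv A y u v) + τ (A y w * fderiv ℝ (fun z ↦ curv A z u v) y k)))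
      - 4 * (τ (fderiv ℝ A y k u * (A y v * A y w)) + τ (A y u * (fderiv ℝ A y k v * A y w))
          + τ (A y u * (A y v * fderiv ℝ A y k w))
        - (τ (fderiv ℝ A y k u * (A y w * A y v)) + τ (A y u * (fderiv ℝ A y k w * A y v))
          + τ (A y u * (A y w * fderiv ℝ A y k v)))) := by
  have h1 : DifferentiableAt ℝ A y := dA.differentiableAt (by simp)
  have h (u : R4) : DifferentiableAt ℝ (fun z ↦ A z u) y := h1.clm_apply (by fun_prop)
  have c (u v : R4) : DifferentiableAt ℝ (fun z ↦ curv A z u v) y :=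
    (contDiffAt_curv dA u v).differentiableAt (by simp)
  have t {f : R4 → 𝒜} (hf : DifferentiableAt ℝ f y) :
      DifferentiableAt ℝ (fun z ↦ τ (f z)) y ∧
        fderiv ℝ (fun z ↦ τ (f z)) y k = τ (fderiv ℝ f y k) := by
    have := (τ.hasFDerivAt.comp y hf.hasFDerivAt)
    exact ⟨this.differentiableAt, by rw [HasFDerivAt.fderiv (f := fun z ↦ τ (f z)) this]; rfl⟩
  have m (u v w : R4) := (h u).fun_mul (c v w)
  have n (u v w : R4) := (h u).fun_mul ((h v).fun_mul (h w))
  have e : chernSimons τ A u v w = fun y ↦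
    4 * (τ (A y u * curv A y v w) - τ (A y v * curv A y u w) + τ (A y w * curv A y u v)) -
    4 * (τ (A y u * (A y v * A y w)) - τ (A y u * (A y w * A y v))) := rfl
  have a1 := (t (m u v w)).1.fun_sub (t (m v u w)).1
  have a2 := a1.fun_add (t (m w u v)).1
  have a3 := (t (n u v w)).1.fun_sub (t (n u w v)).1
  rw [e, fderiv_fun_sub (a2.const_mul _) (a3.const_mul _), fderiv_const_mul a2,
    fderiv_const_mul a3, fderiv_fun_add a1 (t (m w u v)).1,
    fderiv_fun_sub (t (m u v w)).1 (t (m v u w)).1, fderiv_fun_sub (t (n u v w)).1 (t (n u w v)).1]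
  simp only [add_apply, sub_apply, smul_apply, smul_eq_mul, (t (m _ _ _)).2, (t (n _ _ _)).2,
    fderiv_mul_apply (h _) (c _ _), fderiv_mul_apply (h _) ((h _).fun_mul (h _)),
    fderiv_mul_apply (h _) (h _), map_add, mul_add, fderiv_clm_apply_const h1]
  ring

theorem sum_fderiv_chernSimons (τ : 𝒜 →L[ℝ] ℂ) (hτ : ∀ x y, τ (x * y) = τ (y * x))
    {A : R4 → R4 →L[ℝ] 𝒜} {y : R4} (dA : ContDiffAt ℝ ∞ A y) :
    fderiv ℝ (chernSimons τ A (stdVec 1) (stdVec 2) (stdVec 3)) y (stdVec 0) -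
      fderiv ℝ (chernSimons τ A (stdVec 0) (stdVec 2) (stdVec 3)) y (stdVec 1) +
      fderiv ℝ (chernSimons τ A (stdVec 0) (stdVec 1) (stdVec 3)) y (stdVec 2) -
      fderiv ℝ (chernSimons τ A (stdVec 0) (stdVec 1) (stdVec 2)) y (stdVec 3) =
      traceSq τ A y := by
  rw [traceSq_eq τ hτ]
  have hs : ∀ u v, fderiv ℝ (fderiv ℝ A) y u v = fderiv ℝ (fderiv ℝ A) y v u := fun u v ↦
    (dA.isSymmSndFDerivAt two_le_infty).eq u v
  refine trace_chernSimons (τ : 𝒜 →+ ℂ) hτ (fun i ↦ A y (stdVec i))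
    (fun i j ↦ fderiv ℝ A y (stdVec i) (stdVec j))
    (fun k i j ↦ fderiv ℝ (fderiv ℝ A) y (stdVec k) (stdVec i) (stdVec j))
    (fun i j k ↦ by rw [hs])
    (fun i j ↦ curv A y (stdVec i) (stdVec j)) (fun i j ↦ rfl)
    (fun k i j ↦ fderiv ℝ (fun z ↦ curv A z (stdVec i) (stdVec j)) y (stdVec k))
    (fun k i j ↦ fderiv_curv dA _ _ _)
    (fun k i j l ↦ fderiv ℝ (chernSimons τ A (stdVec i) (stdVec j) (stdVec l)) y (stdVec k))
    (fun k i j l ↦ fderiv_chernSimons τ dA _ _ _ _)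

/-- Outside the support of χ the product vanishes locally, so g may behave arbitrarily there. -/
theorem integrable_smul_of_tsupport {χ : R4 → ℝ} (hχ : Continuous χ) (hc : HasCompactSupport χ)
    {S : Set R4} (hS : tsupport χ ⊆ S) {g : R4 → ℂ} (hg : ∀ y ∈ S, ContinuousAt g y) :
    Integrable (fun y ↦ χ y • g y) := by
  refine Continuous.integrable_of_hasCompactSupport ?_ (hc.smul_right (f' := g))
  refine continuous_iff_continuousAt.2 fun y ↦ ?_
  by_cases hy : y ∈ tsupport χ
  · exact hχ.continuousAt.smul (hg y (hS hy))
  · refine (continuousAt_const (y := (0 : ℂ))).congr ?_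
    filter_upwards [(isClosed_tsupport χ).isOpen_compl.mem_nhds hy] with z hz
    simp [image_eq_zero_of_notMem_tsupport hz]

theorem tsupport_fderiv_apply_subset (χ : R4 → ℝ) (u : R4) :
    tsupport (fun y ↦ fderiv ℝ χ y u) ⊆ tsupport χ := by
  refine closure_minimal (fun y hy ↦ ?_) (isClosed_tsupport χ)
  by_contra h
  refine hy ?_
  have : χ =ᶠ[𝓝 y] fun _ ↦ 0 := by
    filter_upwards [(isClosed_tsupport χ).isOpen_compl.mem_nhds h] with z hz
    exact image_eq_zero_of_notMem_tsupport hz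
  simp [this.fderiv_eq]

/-- Integration by parts without boundary terms. Smoothness of g is asked only on the support of χ,
so that forms singular at the origin are allowed. -/
theorem integral_smul_fderiv {χ : R4 → ℝ} (hχ : ContDiff ℝ ∞ χ) (hc : HasCompactSupport χ)
    {g : R4 → ℂ} (hg : ∀ y ∈ tsupport χ, ContDiffAt ℝ ∞ g y) (u : R4) :
    Integrable (fun y ↦ fderiv ℝ χ y u • g y) ∧ Integrable (fun y ↦ χ y • fderiv ℝ g y u) ∧
    ∫ y, χ y • fderiv ℝ g y u = - ∫ y, fderiv ℝ χ y u • g y := by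
  have h1 : Integrable (fun y ↦ fderiv ℝ χ y u • g y) :=
    integrable_smul_of_tsupport ((hχ.continuous_fderiv (by simp)).clm_apply continuous_const)
      (hc.fderiv_apply ℝ u) (tsupport_fderiv_apply_subset χ u) fun y hy ↦ (hg y hy).continuousAt
  have h2 : Integrable (fun y ↦ χ y • fderiv ℝ g y u) :=
    integrable_smul_of_tsupport hχ.continuous hc subset_rfl fun y hy ↦
      (((hg y hy).fderiv_right (m := ∞) (by simp)).clm_apply contDiffAt_const).continuousAt
  refine ⟨h1, h2, integral_smul_fderiv_eq_neg_fderiv_smul_of_integrable h1 h2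
    (integrable_smul_of_tsupport hχ.continuous hc subset_rfl fun y hy ↦ (hg y hy).continuousAt)
    (fun y _ ↦ hχ.contDiffAt.differentiableAt (by simp))
    (fun y hy ↦ (hg y hy).differentiableAt (by simp))⟩

theorem integral_sub_add_sub {f g h k : R4 → ℂ} (hf : Integrable f) (hg : Integrable g)
    (hh : Integrable h) (hk : Integrable k) :
    ∫ y, (f y - g y + h y - k y) = (∫ y, f y) - (∫ y, g y) + (∫ y, h y) - ∫ y, k y := by
  have h1 := integral_sub' hf hg
  have h2 := integral_add' (hf.sub hg) hh
  have h3 := integral_sub' ((hf.sub hg).add hh) hk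
  rw [h2, h1] at h3
  exact h3

/-- Stokes' theorem for the Chern–Simons form multiplied by a cutoff function. -/
theorem integral_smul_traceSq (τ : 𝒜 →L[ℝ] ℂ) (hτ : ∀ x y, τ (x * y) = τ (y * x))
    {A : R4 → R4 →L[ℝ] 𝒜} {χ : R4 → ℝ} (hχ : ContDiff ℝ ∞ χ) (hc : HasCompactSupport χ)
    (hA : ∀ y ∈ tsupport χ, ContDiffAt ℝ ∞ A y) :
    ∫ y, χ y • traceSq τ A y = - ∫ y, wedgeChernSimons τ χ A y := by
  have h (u v w k : R4) := integral_smul_fderiv hχ hc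
    (fun y hy ↦ contDiffAt_chernSimons τ (hA y hy) u v w) k
  have e : ∀ y, χ y • traceSq τ A y =
      χ y • fderiv ℝ (chernSimons τ A (stdVec 1) (stdVec 2) (stdVec 3)) y (stdVec 0) -
      χ y • fderiv ℝ (chernSimons τ A (stdVec 0) (stdVec 2) (stdVec 3)) y (stdVec 1) +
      χ y • fderiv ℝ (chernSimons τ A (stdVec 0) (stdVec 1) (stdVec 3)) y (stdVec 2) -
      χ y • fderiv ℝ (chernSimons τ A (stdVec 0) (stdVec 1) (stdVec 2)) y (stdVec 3) := fun y ↦ by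
    by_cases hy : y ∈ tsupport χ
    · rw [← sum_fderiv_chernSimons τ hτ (hA y hy)]
      simp only [smul_add, smul_sub]
    · simp [image_eq_zero_of_notMem_tsupport hy]
  have i0 := h (stdVec 1) (stdVec 2) (stdVec 3) (stdVec 0)
  have i1 := h (stdVec 0) (stdVec 2) (stdVec 3) (stdVec 1)
  have i2 := h (stdVec 0) (stdVec 1) (stdVec 3) (stdVec 2)
  have i3 := h (stdVec 0) (stdVec 1) (stdVec 2) (stdVec 3)
  simp_rw [e, wedgeChernSimons]
  rw [integral_sub_add_sub i0.2.1 i1.2.1 i2.2.1 i3.2.1,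
    integral_sub_add_sub i0.1 i1.1 i2.1 i3.1, i0.2.2, i1.2.2, i2.2.2, i3.2.2]
  ring

end ChernSimons

theorem norm_sq_R4 (y : R4) : ‖y‖ ^ 2 = y 0 ^ 2 + y 1 ^ 2 + y 2 ^ 2 + y 3 ^ 2 := by
  simp [EuclideanSpace.norm_sq_eq, Fin.sum_univ_four]

/-- The isometry of `ℝ⁴` with the quaternions. -/
def toQuat : R4 ≃ₗᵢ[ℝ] ℍ[ℝ] := Quaternion.linearIsometryEquivTuple.symm

theorem toQuat_apply (y : R4) : toQuat y = ⟨y 0, y 1, y 2, y 3⟩ := rfl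

/-- Conjugation of quaternions as a continuous linear map. -/
def starQuat : ℍ[ℝ] →L[ℝ] ℍ[ℝ] :=
  LinearMap.toContinuousLinearMap
    { toFun := star
      map_add' := star_add
      map_smul' := fun c q ↦ Quaternion.star_smul c q }

/-- The quaternion units. -/
abbrev quatI : ℍ[ℝ] := ⟨0, 1, 0, 0⟩
/-- The quaternion units. -/
abbrev quatJ : ℍ[ℝ] := ⟨0, 0, 1, 0⟩
/-- The quaternion units. -/
abbrev quatK : ℍ[ℝ] := ⟨0, 0, 0, 1⟩

/-! ### A radial cutoff function and its constant. -/

section Cutoff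

/-- A smooth cutoff function on `ℝ⁴`. -/
def cutoff (y : R4) : ℝ := Real.smoothTransition (2 - ‖y‖ ^ 2)

theorem contDiff_cutoff : ContDiff ℝ ∞ cutoff :=
  Real.smoothTransition.contDiff.comp (contDiff_const.sub (contDiff_norm_sq ℝ))

theorem cutoff_eq_one {y : R4} (hy : ‖y‖ ≤ 1) : cutoff y = 1 :=
  Real.smoothTransition.one_of_one_le (by nlinarith [norm_nonneg y])

theorem cutoff_eq_zero {y : R4} (hy : 2 ≤ ‖y‖) : cutoff y = 0 :=
  Real.smoothTransition.zero_of_nonpos (by nlinarith [norm_nonneg y])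

theorem hasCompactSupport_cutoff : HasCompactSupport cutoff :=
  HasCompactSupport.intro (isCompact_closedBall (0 : R4) 2) fun y hy ↦
    cutoff_eq_zero (by simpa using (not_le.1 (mt mem_closedBall_zero_iff.2 hy)).le)

theorem norm_cutoff_le (y : R4) : ‖cutoff y‖ ≤ 1 := by
  rw [cutoff, Real.norm_eq_abs, abs_of_nonneg (Real.smoothTransition.nonneg _)]
  exact Real.smoothTransition.le_one _

theorem fderiv_cutoff_eq_zero {y : R4} (hy : ‖y‖ < 1) : fderiv ℝ cutoff y = 0 := by
  have : cutoff =ᶠ[𝓝 y] fun _ ↦ 1 := by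
    filter_upwards [(isOpen_lt continuous_norm continuous_const).mem_nhds hy] with z hz
    exact cutoff_eq_one (le_of_lt hz)
  rw [this.fderiv_eq]
  exact fderiv_const_apply 1

theorem fderiv_cutoff_apply_self (y : R4) :
    fderiv ℝ cutoff y y = -(2 * ‖y‖ ^ 2 * deriv Real.smoothTransition (2 - ‖y‖ ^ 2)) := by
  have h1 : HasFDerivAt (fun y : R4 ↦ 2 - ‖y‖ ^ 2) (-(2 • innerSL ℝ y)) y :=
    (hasStrictFDerivAt_norm_sq y).hasFDerivAt.const_sub 2
  have h2 := ((Real.smoothTransition.contDiff (n := ⊤)).differentiable (by simp)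
    (2 - ‖y‖ ^ 2)).hasDerivAt.comp_hasFDerivAt y h1
  have h3 : fderiv ℝ cutoff y = _ := h2.fderiv
  rw [h3]
  simp
  ring

theorem fderiv_cutoff_apply_self_nonpos (y : R4) : fderiv ℝ cutoff y y ≤ 0 := by
  rw [fderiv_cutoff_apply_self, neg_nonpos]
  have := Real.smoothTransition.monotone.deriv_nonneg (x := 2 - ‖y‖ ^ 2)
  positivity

/-- The transition climbs from 0 to 1 on the unit interval, so its derivative equals 1 at some c;
the points with ‖y‖² = 2 - c then serve. -/
theorem exists_fderiv_cutoff_ne_zero : ∃ y : R4, y ≠ 0 ∧ fderiv ℝ cutoff y y ≠ 0 := by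
  obtain ⟨c, hc, h⟩ := exists_deriv_eq_slope Real.smoothTransition (zero_lt_one)
    Real.smoothTransition.continuous.continuousOn
    ((Real.smoothTransition.contDiff (n := ⊤)).differentiable (by simp)).differentiableOn
  rw [Real.smoothTransition.one, Real.smoothTransition.zero] at h
  have h2 : ‖Real.sqrt (2 - c) • stdVec 0‖ ^ 2 = 2 - c := by
    rw [norm_smul, mul_pow, Real.norm_eq_abs, sq_abs, Real.sq_sqrt (by linarith [hc.2])]
    simp
  have hc' : (0 : ℝ) < 2 - c := by linarith [hc.2]
  refine ⟨Real.sqrt (2 - c) • stdVec 0, ?_, ?_⟩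
  · intro h0
    rw [h0, norm_zero] at h2
    linarith [hc.2]
  · rw [fderiv_cutoff_apply_self, h2, show 2 - (2 - c) = c by ring, h]
    simp [hc'.ne']

theorem continuous_cutoff_density :
    Continuous fun y : R4 ↦ fderiv ℝ cutoff y y / ‖y‖ ^ 4 := by
  refine continuous_iff_continuousAt.2 fun y ↦ ?_
  by_cases hy : ‖y‖ < 1
  · refine (continuousAt_const (y := (0 : ℝ))).congr ?_
    filter_upwards [(isOpen_lt continuous_norm continuous_const).mem_nhds hy] with z hz
    simp [fderiv_cutoff_eq_zero hz]
  · have hy' : ‖y‖ ^ 4 ≠ 0 := by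
      have : 0 < ‖y‖ := by linarith
      positivity
    exact ((contDiff_cutoff.continuous_fderiv (by simp)).clm_apply
      continuous_id).continuousAt.div (by fun_prop) hy'

theorem hasCompactSupport_cutoff_density :
    HasCompactSupport fun y : R4 ↦ fderiv ℝ cutoff y y / ‖y‖ ^ 4 := by
  refine HasCompactSupport.intro (isCompact_closedBall (0 : R4) 2) fun y hy ↦ ?_
  have hy' : 2 < ‖y‖ := not_le.1 (mt mem_closedBall_zero_iff.2 hy)
  have : cutoff =ᶠ[𝓝 y] fun _ ↦ 0 := by
    filter_upwards [(isOpen_lt continuous_const continuous_norm).mem_nhds hy'] with z hz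
    exact cutoff_eq_zero (le_of_lt hz)
  rw [this.fderiv_eq]
  simp

/-- A universal constant: the integral of `4 dψ(y) / ‖y‖⁴` along the radial direction. -/
def cutoffConst : ℝ := ∫ y : R4, 4 * (fderiv ℝ cutoff y y / ‖y‖ ^ 4)

/-- The integrand is continuous, nowhere positive and not identically zero. The exact value of the
constant is never needed. -/
theorem cutoffConst_ne_zero : cutoffConst ≠ 0 := by
  obtain ⟨y, hy, h⟩ := exists_fderiv_cutoff_ne_zero
  have := continuous_cutoff_density.neg.integral_pos_of_hasCompactSupport_nonneg_nonzero
    (μ := (volume : Measure R4)) (x := y) (HasCompactSupport.neg hasCompactSupport_cutoff_density)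
    (fun z ↦ by
      have := div_nonpos_of_nonpos_of_nonneg (fderiv_cutoff_apply_self_nonpos z)
        (pow_nonneg (norm_nonneg z) 4)
      simpa using this)
    (neg_ne_zero.2 (div_ne_zero h (pow_ne_zero _ (norm_ne_zero_iff.2 hy))))
  rw [integral_neg'] at this
  rw [cutoffConst, integral_const_mul]
  intro h0
  linarith

end Cutoff

/-! ### The homogeneous model form on ℝ⁴ ∖ 0. -/

section Model

variable {𝒜 : Type*} [NormedRing 𝒜] [NormedAlgebra ℝ 𝒜]

/-- The 1-form `u ↦ ‖y‖⁻² l (y * conj u)` with values in `𝒜`. -/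
def modelForm (l : ℍ[ℝ] →L[ℝ] 𝒜) (y : R4) : R4 →L[ℝ] 𝒜 :=
  (‖y‖ ^ 2)⁻¹ • (l.comp ((ContinuousLinearMap.mul ℝ ℍ[ℝ] (toQuat y)).comp
    (starQuat.comp (toQuat : R4 →L[ℝ] ℍ[ℝ]))))

theorem modelForm_apply (l : ℍ[ℝ] →L[ℝ] 𝒜) (y u : R4) :
    modelForm l y u = (‖y‖ ^ 2)⁻¹ • l (toQuat y * star (toQuat u)) := rfl

theorem norm_modelForm_le (l : ℍ[ℝ] →L[ℝ] 𝒜) (y : R4) : ‖modelForm l y‖ ≤ ‖l‖ * ‖y‖⁻¹ := by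
  refine ContinuousLinearMap.opNorm_le_bound _ (by positivity) fun u ↦ ?_
  rw [modelForm_apply, norm_smul]
  have h1 := l.le_opNorm (toQuat y * star (toQuat u))
  rw [norm_mul, norm_star, LinearIsometryEquiv.norm_map, LinearIsometryEquiv.norm_map] at h1
  by_cases hy : ‖y‖ = 0
  · simp [hy]
  · calc ‖(‖y‖ ^ 2)⁻¹‖ * ‖l (toQuat y * star (toQuat u))‖
        ≤ ‖(‖y‖ ^ 2)⁻¹‖ * (‖l‖ * (‖y‖ * ‖u‖)) := by gcongr
      _ = ‖l‖ * ‖y‖⁻¹ * ‖u‖ := by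
        rw [norm_inv, norm_pow, norm_norm]
        field_simp

/-- Invariance under homotheties: rescaling a form asymptotic to the model makes it converge to the
model itself. -/
theorem modelForm_smul (l : ℍ[ℝ] →L[ℝ] 𝒜) {R : ℝ} (hR : R ≠ 0) (y : R4) :
    R • modelForm l (R • y) = modelForm l y := by
  ext u
  rw [smul_apply, modelForm_apply, modelForm_apply, map_smul, smul_mul_assoc, map_smul, norm_smul,
    smul_smul, smul_smul, mul_pow, Real.norm_eq_abs, sq_abs]
  congr 1
  by_cases hy : ‖y‖ = 0
  · simp [hy]
  · field_simp

/-- The alternating trace of the triple product of `l i`, `l j` and `l k`. -/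
def tripleTrace (τ : 𝒜 →L[ℝ] ℂ) (l : ℍ[ℝ] →L[ℝ] 𝒜) : ℂ :=
  τ (l quatI * (l quatJ * l quatK)) - τ (l quatI * (l quatK * l quatJ))

theorem apply_eq_of_apply_one (l : ℍ[ℝ] →L[ℝ] 𝒜) (hl : l 1 = 0) (q : ℍ[ℝ]) :
    l q = q.imI • l quatI + q.imJ • l quatJ + q.imK • l quatK := by
  have : q = q.re • (1 : ℍ[ℝ]) + q.imI • quatI + q.imJ • quatJ + q.imK • quatK := by
    ext <;> simp
  conv_lhs => rw [this]
  simp [hl]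

theorem modelForm_stdVec (l : ℍ[ℝ] →L[ℝ] 𝒜) (hl : l 1 = 0) (y : R4) :
    (modelForm l y (stdVec 0) = ((‖y‖ ^ 2)⁻¹ * y 1) • l quatI + ((‖y‖ ^ 2)⁻¹ * y 2) • l quatJ +
      ((‖y‖ ^ 2)⁻¹ * y 3) • l quatK) ∧
    (modelForm l y (stdVec 1) = ((‖y‖ ^ 2)⁻¹ * -y 0) • l quatI + ((‖y‖ ^ 2)⁻¹ * -y 3) • l quatJ +
      ((‖y‖ ^ 2)⁻¹ * y 2) • l quatK) ∧
    (modelForm l y (stdVec 2) = ((‖y‖ ^ 2)⁻¹ * y 3) • l quatI + ((‖y‖ ^ 2)⁻¹ * -y 0) • l quatJ +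
      ((‖y‖ ^ 2)⁻¹ * -y 1) • l quatK) ∧
    (modelForm l y (stdVec 3) = ((‖y‖ ^ 2)⁻¹ * -y 2) • l quatI + ((‖y‖ ^ 2)⁻¹ * y 1) • l quatJ +
      ((‖y‖ ^ 2)⁻¹ * -y 0) • l quatK) := by
  refine ⟨?_, ?_, ?_, ?_⟩ <;>
  · rw [modelForm_apply, apply_eq_of_apply_one l hl, Quaternion.imI_mul, Quaternion.imJ_mul,
      Quaternion.imK_mul, Quaternion.re_star, Quaternion.imI_star, Quaternion.imJ_star,
      Quaternion.imK_star, toQuat_apply, toQuat_apply]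
    simp [smul_smul, stdVec]

/-- The Chern–Simons form of a flat connection form. -/
def cubicForm (τ : 𝒜 →L[ℝ] ℂ) (a : R4 →L[ℝ] 𝒜) (u v w : R4) : ℂ :=
  -(4 * (τ (a u * (a v * a w)) - τ (a u * (a w * a v))))

theorem apply_eq_sum_stdVec {G : Type*} [NormedAddCommGroup G] [NormedSpace ℝ G] (L : R4 →L[ℝ] G)
    (y : R4) : L y = y 0 • L (stdVec 0) + y 1 • L (stdVec 1) + y 2 • L (stdVec 2) +
      y 3 • L (stdVec 3) := by
  have : y = y 0 • stdVec 0 + y 1 • stdVec 1 + y 2 • stdVec 2 + y 3 • stdVec 3 := by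
    ext i
    fin_cases i <;> simp [stdVec]
  conv_lhs => rw [this]
  simp only [map_add, map_smul]

/-- Since `l 1 = 0`, the model takes values in the span of `l quatI`, `l quatJ`, `l quatK`. Each
coefficient of the cubic form is thus a 3 × 3 determinant times `tripleTrace τ l`. These
determinants are ±yₘ/‖y‖⁴, and their sum against X reproduces X y. -/
theorem wedge_cubicForm (τ : 𝒜 →L[ℝ] ℂ) (hτ : ∀ x y, τ (x * y) = τ (y * x))
    (l : ℍ[ℝ] →L[ℝ] 𝒜) (hl : l 1 = 0) (X : R4 →L[ℝ] ℝ) {y : R4} (hy : y ≠ 0) :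
    X (stdVec 0) • cubicForm τ (modelForm l y) (stdVec 1) (stdVec 2) (stdVec 3) -
      X (stdVec 1) • cubicForm τ (modelForm l y) (stdVec 0) (stdVec 2) (stdVec 3) +
      X (stdVec 2) • cubicForm τ (modelForm l y) (stdVec 0) (stdVec 1) (stdVec 3) -
      X (stdVec 3) • cubicForm τ (modelForm l y) (stdVec 0) (stdVec 1) (stdVec 2) =
      (4 * (X y / ‖y‖ ^ 4) : ℝ) * tripleTrace τ l := by
  obtain ⟨e0, e1, e2, e3⟩ := modelForm_stdVec l hl y
  have hs : ∀ (r : ℝ) x, (τ : 𝒜 →+ ℂ) (r • x) = r * (τ : 𝒜 →+ ℂ) x := fun r x ↦ by simp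
  have T := trace_alternating (τ : 𝒜 →+ ℂ) hτ hs (l quatI) (l quatJ) (l quatK)
  set c := (‖y‖ ^ 2)⁻¹ with hc
  set r0 : Fin 3 → ℝ := ![c * y 1, c * y 2, c * y 3]
  set r1 : Fin 3 → ℝ := ![c * -y 0, c * -y 3, c * y 2]
  set r2 : Fin 3 → ℝ := ![c * y 3, c * -y 0, c * -y 1]
  set r3 : Fin 3 → ℝ := ![c * -y 2, c * y 1, c * -y 0]
  have t0 := T r1 r2 r3 _ _ _ e1 e2 e3
  have t1 := T r0 r2 r3 _ _ _ e0 e2 e3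
  have t2 := T r0 r1 r3 _ _ _ e0 e1 e3
  have t3 := T r0 r1 r2 _ _ _ e0 e1 e2
  simp only [AddMonoidHom.coe_coe] at t0 t1 t2 t3
  unfold cubicForm tripleTrace
  rw [t0, t1, t2, t3]
  have hX := apply_eq_sum_stdVec X y
  have hn : c * (y 0 ^ 2 + y 1 ^ 2 + y 2 ^ 2 + y 3 ^ 2) = 1 := by
    rw [← norm_sq_R4, hc, inv_mul_cancel₀]
    exact pow_ne_zero _ (norm_ne_zero_iff.2 hy)
  have h4 : X y / ‖y‖ ^ 4 = X y * c ^ 2 := by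
    rw [hc, div_eq_mul_inv, inv_pow, ← pow_mul]
  rw [h4, hX]
  set D := τ (l quatI * (l quatJ * l quatK)) - τ (l quatI * (l quatK * l quatJ))
  simp only [r0, r1, r2, r3, Complex.real_smul]
  simp only [Matrix.cons_val_zero, Matrix.cons_val_one, Matrix.cons_val, smul_eq_mul]
  have hn' : (c : ℂ) * (y 0 ^ 2 + y 1 ^ 2 + y 2 ^ 2 + y 3 ^ 2) = 1 := by exact_mod_cast hn
  push_cast
  linear_combination (4 * (c : ℂ) ^ 2 * D * (y 0 * X (stdVec 0) + y 1 * X (stdVec 1) +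
    y 2 * X (stdVec 2) + y 3 * X (stdVec 3))) * hn'

end Model

/-! ### Rescaling, limits and bounds. -/

section Asymptotics

variable {𝒜 : Type*} [NormedRing 𝒜] [NormedAlgebra ℝ 𝒜]

theorem norm_stdVec (i : Fin 4) : ‖stdVec i‖ = 1 := by simp [stdVec]

/-- The pull-back of a 1-form by the homothety of ratio `R`. -/
def scaleForm (A : R4 → R4 →L[ℝ] 𝒜) (R : ℝ) (x : R4) : R4 →L[ℝ] 𝒜 := R • A (R • x)

theorem contDiffAt_scaleForm {A : R4 → R4 →L[ℝ] 𝒜} (hA : ContDiff ℝ ∞ A) (R : ℝ) (x : R4) :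
    ContDiffAt ℝ ∞ (scaleForm A R) x :=
  (contDiffAt_const (c := R)).smul
    (hA.contDiffAt.comp x ((contDiffAt_const (c := R)).smul contDiffAt_id))

theorem curv_scaleForm {A : R4 → R4 →L[ℝ] 𝒜} (hA : ContDiff ℝ ∞ A) (R : ℝ) (x u v : R4) :
    curv (scaleForm A R) x u v = R ^ 2 • curv A (R • x) u v := by
  have h1 : DifferentiableAt ℝ (fun x ↦ A (R • x)) x :=
    ((hA.differentiable (by simp)) (R • x)).comp x (by fun_prop)
  have h2 : fderiv ℝ (scaleForm A R) x = R ^ 2 • fderiv ℝ A (R • x) := by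
    have e : scaleForm A R = fun x ↦ R • A (R • x) := rfl
    rw [e, fderiv_fun_const_smul h1, fderiv_comp_smul, smul_smul, sq]
  simp only [curv, h2, scaleForm, smul_apply, smul_mul_assoc, mul_smul_comm, smul_smul, smul_add,
    smul_sub, sq]

theorem traceSq_scaleForm (τ : 𝒜 →L[ℝ] ℂ) {A : R4 → R4 →L[ℝ] 𝒜} (hA : ContDiff ℝ ∞ A)
    (R : ℝ) (x : R4) : traceSq τ (scaleForm A R) x = R ^ 4 • traceSq τ A (R • x) := by
  simp only [traceSq, curv_scaleForm hA, smul_mul_assoc, mul_smul_comm, map_smul, smul_smul,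
    Finset.smul_sum, ← pow_add]
  exact Finset.sum_congr rfl fun s _ ↦ smul_comm _ _ _

/-- `traceSq` is the coefficient of a 4-form, so the factor R⁴ produced by rescaling is exactly the
Jacobian of the homothety. -/
theorem integral_cutoff_smul_traceSq_scaleForm (τ : 𝒜 →L[ℝ] ℂ) {A : R4 → R4 →L[ℝ] 𝒜}
    (hA : ContDiff ℝ ∞ A) {R : ℝ} (hR : 0 < R) :
    ∫ x, cutoff x • traceSq τ (scaleForm A R) x = ∫ y, cutoff (R⁻¹ • y) • traceSq τ A y := by
  have h := Measure.integral_comp_smul (volume : Measure R4)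
    (fun y ↦ R ^ 4 • (cutoff (R⁻¹ • y) • traceSq τ A y)) R
  simp only [smul_smul R⁻¹, inv_mul_cancel₀ hR.ne', one_smul] at h
  rw [integral_smul, integral_smul, finrank_euclideanSpace, Fintype.card_fin,
    abs_of_pos (by positivity), smul_smul (R ^ 4)⁻¹, inv_mul_cancel₀ (by positivity), one_smul,
    ← integral_smul] at h
  rw [← h]
  refine integral_congr_ae (Filter.Eventually.of_forall fun x ↦ ?_)
  simp only [traceSq_scaleForm τ hA]
  rw [smul_comm]

theorem norm_chernSimons_le (τ : 𝒜 →L[ℝ] ℂ) {A : R4 → R4 →L[ℝ] 𝒜} {y : R4} {a c : ℝ}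
    (ha : ∀ i, ‖A y (stdVec i)‖ ≤ a) (hc : ∀ i j, ‖curv A y (stdVec i) (stdVec j)‖ ≤ c)
    (i j k : Fin 4) :
    ‖chernSimons τ A (stdVec i) (stdVec j) (stdVec k) y‖ ≤
      12 * (‖τ‖ * (a * c)) + 8 * (‖τ‖ * (a * (a * a))) := by
  have ha0 : 0 ≤ a := (norm_nonneg _).trans (ha 0)
  have hc0 : 0 ≤ c := (norm_nonneg _).trans (hc 0 0)
  have h1 (i j k) : ‖τ (A y (stdVec i) * curv A y (stdVec j) (stdVec k))‖ ≤ ‖τ‖ * (a * c) :=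
    (τ.le_opNorm _).trans (by
      gcongr
      exact (norm_mul_le _ _).trans (mul_le_mul (ha _) (hc _ _) (norm_nonneg _) ha0))
  have h2 (i j k) : ‖τ (A y (stdVec i) * (A y (stdVec j) * A y (stdVec k)))‖ ≤
      ‖τ‖ * (a * (a * a)) :=
    (τ.le_opNorm _).trans (by
      gcongr
      refine (norm_mul_le _ _).trans (mul_le_mul (ha _) ?_ (norm_nonneg _) ha0)
      exact (norm_mul_le _ _).trans (mul_le_mul (ha _) (ha _) (norm_nonneg _) ha0))
  unfold chernSimons
  refine (norm_sub_le _ _).trans ?_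
  rw [norm_mul, norm_mul]
  have e4 : ‖(4 : ℂ)‖ = 4 := by simp
  have b1 := norm_sub_le (τ (A y (stdVec i) * curv A y (stdVec j) (stdVec k)))
    (τ (A y (stdVec j) * curv A y (stdVec i) (stdVec k)))
  have b2 := norm_add_le (τ (A y (stdVec i) * curv A y (stdVec j) (stdVec k)) -
    τ (A y (stdVec j) * curv A y (stdVec i) (stdVec k)))
    (τ (A y (stdVec k) * curv A y (stdVec i) (stdVec j)))
  have b3 := norm_sub_le (τ (A y (stdVec i) * (A y (stdVec j) * A y (stdVec k))))
    (τ (A y (stdVec i) * (A y (stdVec k) * A y (stdVec j))))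
  rw [e4]
  linarith [h1 i j k, h1 j i k, h1 k i j, h2 i j k, h2 i k j]

theorem norm_wedgeChernSimons_le (τ : 𝒜 →L[ℝ] ℂ) {χ : R4 → ℝ} {A : R4 → R4 →L[ℝ] 𝒜} {y : R4}
    {m : ℝ} (h : fderiv ℝ χ y ≠ 0 → ∀ i j k,
      ‖chernSimons τ A (stdVec i) (stdVec j) (stdVec k) y‖ ≤ m) :
    ‖wedgeChernSimons τ χ A y‖ ≤ 4 * (‖fderiv ℝ χ y‖ * m) := by
  by_cases h0 : fderiv ℝ χ y = 0
  · simp [wedgeChernSimons, h0]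
  have h1 (l i j k) : ‖fderiv ℝ χ y (stdVec l) •
      chernSimons τ A (stdVec i) (stdVec j) (stdVec k) y‖ ≤ ‖fderiv ℝ χ y‖ * m := by
    rw [norm_smul]
    have := (fderiv ℝ χ y).le_opNorm (stdVec l)
    rw [norm_stdVec, mul_one] at this
    exact mul_le_mul this (h h0 _ _ _) (norm_nonneg _) (norm_nonneg _)
  unfold wedgeChernSimons
  refine (norm_sub_le _ _).trans ?_
  refine (add_le_add_left (norm_add_le _ _) _).trans ?_
  refine (add_le_add_left (add_le_add_left (norm_sub_le _ _) _) _).trans ?_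
  linarith [h1 0 1 2 3, h1 1 0 2 3, h1 2 0 1 3, h1 3 0 1 2]

theorem continuous_wedgeChernSimons (τ : 𝒜 →L[ℝ] ℂ) {χ : R4 → ℝ} {A : R4 → R4 →L[ℝ] 𝒜}
    (hχ : ContDiff ℝ ∞ χ) (hA : ∀ y, ContDiffAt ℝ ∞ A y) :
    Continuous (wedgeChernSimons τ χ A) := by
  have h (l : Fin 4) : Continuous fun y ↦ fderiv ℝ χ y (stdVec l) :=
    (hχ.continuous_fderiv (by simp)).clm_apply continuous_const
  have h' (i j k : Fin 4) : Continuous (chernSimons τ A (stdVec i) (stdVec j) (stdVec k)) :=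
    continuous_iff_continuousAt.2 fun y ↦ (contDiffAt_chernSimons τ (hA y) _ _ _).continuousAt
  exact ((((h 0).smul (h' 1 2 3)).sub ((h 1).smul (h' 0 2 3))).add ((h 2).smul (h' 0 1 3))).sub
    ((h 3).smul (h' 0 1 2))

/-- When the curvature tends to zero, only the cubic term of the Chern–Simons form survives. -/
theorem tendsto_chernSimons (τ : 𝒜 →L[ℝ] ℂ) {A : ℕ → R4 → R4 →L[ℝ] 𝒜} {a : R4 →L[ℝ] 𝒜} {y : R4}
    (h : Filter.Tendsto (fun n ↦ A n y) Filter.atTop (𝓝 a))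
    (hc : ∀ i j, Filter.Tendsto (fun n ↦ curv (A n) y (stdVec i) (stdVec j)) Filter.atTop (𝓝 0))
    (i j k : Fin 4) :
    Filter.Tendsto (fun n ↦ chernSimons τ (A n) (stdVec i) (stdVec j) (stdVec k) y) Filter.atTop
      (𝓝 (cubicForm τ a (stdVec i) (stdVec j) (stdVec k))) := by
  have h' (i : Fin 4) : Filter.Tendsto (fun n ↦ A n y (stdVec i)) Filter.atTop
      (𝓝 (a (stdVec i))) :=
    ((ContinuousLinearMap.apply ℝ 𝒜 (stdVec i)).continuous.tendsto a).comp h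
  have t {f : ℕ → 𝒜} {b : 𝒜} (hf : Filter.Tendsto f Filter.atTop (𝓝 b)) :
      Filter.Tendsto (fun n ↦ τ (f n)) Filter.atTop (𝓝 (τ b)) := (τ.continuous.tendsto b).comp hf
  have e1 (i j k) := t ((h' i).mul (hc j k))
  have e2 (i j k) := t ((h' i).mul ((h' j).mul (h' k)))
  have := (((((e1 i j k).sub (e1 j i k)).add (e1 k i j)).const_mul 4).sub
    (((e2 i j k).sub (e2 i k j)).const_mul 4))
  simpa [chernSimons, cubicForm] using this

theorem norm_traceSq_le (τ : 𝒜 →L[ℝ] ℂ) {A : R4 → R4 →L[ℝ] 𝒜} {y : R4} {c : ℝ}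
    (hc : ∀ i j, ‖curv A y (stdVec i) (stdVec j)‖ ≤ c) : ‖traceSq τ A y‖ ≤ 24 * (‖τ‖ * (c * c)) := by
  have hc0 : 0 ≤ c := (norm_nonneg _).trans (hc 0 0)
  unfold traceSq
  refine (norm_sum_le _ _).trans ?_
  have : ∀ s ∈ (Finset.univ : Finset (Equiv.Perm (Fin 4))), ‖(s.sign : ℤ) •
      τ (curv A y (stdVec (s 0)) (stdVec (s 1)) * curv A y (stdVec (s 2)) (stdVec (s 3)))‖ ≤
      ‖τ‖ * (c * c) := fun s _ ↦ by
    have h : ‖τ (curv A y (stdVec (s 0)) (stdVec (s 1)) *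
        curv A y (stdVec (s 2)) (stdVec (s 3)))‖ ≤ ‖τ‖ * (c * c) :=
      (τ.le_opNorm _).trans (by
        gcongr
        exact (norm_mul_le _ _).trans (mul_le_mul (hc _ _) (hc _ _) (norm_nonneg _) hc0))
    rcases Int.units_eq_one_or s.sign with e | e <;> simpa [e] using h
  refine (Finset.sum_le_card_nsmul _ _ _ this).trans ?_
  rw [Finset.card_univ, Fintype.card_perm, Fintype.card_fin]
  simp [Nat.factorial]

theorem continuousAt_traceSq (τ : 𝒜 →L[ℝ] ℂ) {A : R4 → R4 →L[ℝ] 𝒜} {y : R4}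
    (hA : ContDiffAt ℝ ∞ A y) : ContinuousAt (traceSq τ A) y := by
  have h (i j k l : Fin 4) : ContinuousAt (fun z ↦ τ (curv A z (stdVec i) (stdVec j) *
      curv A z (stdVec k) (stdVec l))) y :=
    τ.continuous.continuousAt.comp ((contDiffAt_curv hA _ _).mul
      (contDiffAt_curv hA _ _)).continuousAt
  exact tendsto_finsetSum _ fun s _ ↦ (h (s 0) (s 1) (s 2) (s 3)).const_smul _

/-- The integrand is quadratic in the curvature, so it decays like ‖y‖⁻⁸, which is integrable in
dimension four. -/
theorem integrable_traceSq (τ : 𝒜 →L[ℝ] ℂ) {A : R4 → R4 →L[ℝ] 𝒜} (hA : ContDiff ℝ ∞ A) {C : ℝ}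
    (hc : ∀ y, 1 ≤ ‖y‖ → ∀ i j, ‖curv A y (stdVec i) (stdVec j)‖ ≤ C / ‖y‖ ^ 4) :
    Integrable (traceSq τ A) := by
  have hcont : Continuous (traceSq τ A) :=
    continuous_iff_continuousAt.2 fun y ↦ continuousAt_traceSq τ hA.contDiffAt
  refine hcont.locallyIntegrable.integrable_of_isBigO_cocompact
    (g := fun y : R4 ↦ (1 + ‖y‖) ^ (-(8 : ℝ))) ?_
    ((integrable_one_add_norm (by
      rw [finrank_euclideanSpace, Fintype.card_fin]; norm_num)).integrableAtFilter _)
  refine Asymptotics.IsBigO.of_bound (24 * (‖τ‖ * (C * C)) * 2 ^ 8) ?_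
  have : ∀ᶠ y : R4 in Filter.cocompact R4, 1 ≤ ‖y‖ :=
    (tendsto_norm_cocompact_atTop (E := R4)).eventually_ge_atTop 1
  filter_upwards [this] with y hy
  refine (norm_traceSq_le τ (hc y hy)).trans ?_
  have hy0 : 0 < ‖y‖ := by linarith
  rw [Real.norm_of_nonneg (by positivity), Real.rpow_neg (by positivity),
    show (8 : ℝ) = ((8 : ℕ) : ℝ) by norm_num, Real.rpow_natCast]
  have h2 : (1 + ‖y‖) ^ 8 ≤ (2 * ‖y‖) ^ 8 := pow_le_pow_left₀ (by positivity) (by linarith) 8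
  have h3 : (‖y‖ ^ 8)⁻¹ ≤ 2 ^ 8 * ((1 + ‖y‖) ^ 8)⁻¹ := by
    rw [mul_pow] at h2
    rw [inv_le_iff_one_le_mul₀ (by positivity), mul_right_comm, ← div_eq_mul_inv,
      le_div_iff₀ (by positivity), one_mul]
    exact h2
  calc 24 * (‖τ‖ * (C / ‖y‖ ^ 4 * (C / ‖y‖ ^ 4))) = 24 * (‖τ‖ * (C * C)) * (‖y‖ ^ 8)⁻¹ := by
        field_simp
    _ ≤ 24 * (‖τ‖ * (C * C)) * (2 ^ 8 * ((1 + ‖y‖) ^ 8)⁻¹) :=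
        mul_le_mul_of_nonneg_left h3 (mul_nonneg (by norm_num)
          (mul_nonneg (norm_nonneg _) (mul_self_nonneg C)))
    _ = _ := by ring

end Asymptotics

/-! ### Curvature integrals as residues of the model forms. -/

section Residue

variable {𝒜 : Type*} [NormedRing 𝒜] [NormedAlgebra ℝ 𝒜]

theorem integral_density_mul (T : ℂ) :
    ∫ y : R4, ((4 * (fderiv ℝ cutoff y y / ‖y‖ ^ 4) : ℝ) : ℂ) * T = cutoffConst * T := by
  rw [integral_mul_const, cutoffConst]
  congr 1
  exact integral_ofReal

theorem norm_apply_stdVec_le (L : R4 →L[ℝ] 𝒜) (i : Fin 4) : ‖L (stdVec i)‖ ≤ ‖L‖ := by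
  simpa [norm_stdVec] using L.le_opNorm (stdVec i)

/-- A connection form on `ℝ⁴` which is asymptotic at infinity to a model form: the integral of the
trace of the square of the curvature is determined by the model. -/
theorem integral_traceSq_of_asymptotic (τ : 𝒜 →L[ℝ] ℂ) (hτ : ∀ x y, τ (x * y) = τ (y * x))
    (l : ℍ[ℝ] →L[ℝ] 𝒜) (hl : l 1 = 0) {A : R4 → R4 →L[ℝ] 𝒜} (hA : ContDiff ℝ ∞ A) {C : ℝ}
    (hθ : ∀ y, 1 ≤ ‖y‖ → ‖A y - modelForm l y‖ ≤ C / ‖y‖ ^ 2)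
    (hc : ∀ y, 1 ≤ ‖y‖ → ∀ i j, ‖curv A y (stdVec i) (stdVec j)‖ ≤ C / ‖y‖ ^ 4) :
    Integrable (traceSq τ A) ∧ ∫ y, traceSq τ A y = -(cutoffConst * tripleTrace τ l) := by
  have hint := integrable_traceSq τ hA hc
  refine ⟨hint, ?_⟩
  have hC : 0 ≤ C := by
    have := (norm_nonneg _).trans (hc (stdVec 0) (norm_stdVec 0).ge 0 0)
    simpa [norm_stdVec] using this
  -- All radii are at least 1 and the differential of the cutoff vanishes on the open unit ball, so
  -- the assumed bounds apply at R y wherever they are needed.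
  set R : ℕ → ℝ := fun n ↦ (n : ℝ) + 1 with hR
  have hR1 : ∀ n, 1 ≤ R n := fun n ↦ by simp [hR]
  have hR0 : ∀ n, 0 < R n := fun n ↦ zero_lt_one.trans_le (hR1 n)
  have hRinv : Filter.Tendsto (fun n ↦ (R n)⁻¹) Filter.atTop (𝓝 0) := by
    simpa [hR, one_div] using tendsto_one_div_add_atTop_nhds_zero_nat (𝕜 := ℝ)
  -- the left-hand sides
  have hleft : Filter.Tendsto (fun n ↦ ∫ y, cutoff ((R n)⁻¹ • y) • traceSq τ A y) Filter.atTop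
      (𝓝 (∫ y, traceSq τ A y)) := by
    refine tendsto_integral_of_dominated_convergence (fun y ↦ ‖traceSq τ A y‖) (fun n ↦ ?_)
      hint.norm (fun n ↦ Filter.Eventually.of_forall fun y ↦ ?_)
      (Filter.Eventually.of_forall fun y ↦ ?_)
    · exact ((contDiff_cutoff.continuous.comp (continuous_const_smul _)).aestronglyMeasurable).smul
        hint.aestronglyMeasurable
    · rw [norm_smul]
      exact mul_le_of_le_one_left (norm_nonneg _) (norm_cutoff_le _)
    · have h1 : Filter.Tendsto (fun n ↦ cutoff ((R n)⁻¹ • y)) Filter.atTop (𝓝 1) := by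
        have h2 := (contDiff_cutoff.continuous.tendsto (0 : R4)).comp
          ((hRinv.smul_const y).trans (by rw [zero_smul]))
        rwa [cutoff_eq_one (by simp)] at h2
      simpa using h1.smul_const (traceSq τ A y)
  -- the right-hand sides
  have hB : ∀ n y, 1 ≤ ‖y‖ → ‖scaleForm A (R n) y - modelForm l y‖ ≤ C * (R n)⁻¹ := by
    intro n y hy
    have hRy : 1 ≤ ‖R n • y‖ := by
      rw [norm_smul, Real.norm_of_nonneg (hR0 n).le]
      exact one_le_mul_of_one_le_of_one_le (hR1 n) hy
    have e : scaleForm A (R n) y - modelForm l y =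
        R n • (A (R n • y) - modelForm l (R n • y)) := by
      rw [← modelForm_smul l (hR0 n).ne']
      exact (smul_sub _ _ _).symm
    rw [e, norm_smul, Real.norm_of_nonneg (hR0 n).le]
    have h1 := hθ _ hRy
    rw [norm_smul, Real.norm_of_nonneg (hR0 n).le] at h1
    have hRn := hR0 n
    calc R n * ‖A (R n • y) - modelForm l (R n • y)‖ ≤ R n * (C / (R n * ‖y‖) ^ 2) := by gcongr
      _ = C * (R n)⁻¹ / ‖y‖ ^ 2 := by field_simp
      _ ≤ C * (R n)⁻¹ := div_le_self (by positivity) (one_le_pow₀ hy)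
  have hF : ∀ n y, 1 ≤ ‖y‖ → ∀ i j,
      ‖curv (scaleForm A (R n)) y (stdVec i) (stdVec j)‖ ≤ C * (R n)⁻¹ := by
    intro n y hy i j
    have hRn := hR0 n
    have hRy : 1 ≤ ‖R n • y‖ := by
      rw [norm_smul, Real.norm_of_nonneg (hR0 n).le]
      exact one_le_mul_of_one_le_of_one_le (hR1 n) hy
    rw [curv_scaleForm hA, norm_smul, Real.norm_of_nonneg (by positivity)]
    have h1 := hc _ hRy i j
    rw [norm_smul, Real.norm_of_nonneg hRn.le] at h1
    calc R n ^ 2 * ‖curv A (R n • y) (stdVec i) (stdVec j)‖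
        ≤ R n ^ 2 * (C / (R n * ‖y‖) ^ 4) := by gcongr
      _ = C * (R n)⁻¹ / (R n * ‖y‖ ^ 4) := by field_simp
      _ ≤ C * (R n)⁻¹ := div_le_self (by positivity)
          (one_le_mul_of_one_le_of_one_le (hR1 n) (one_le_pow₀ hy))
  have hdψ : ∀ y, fderiv ℝ cutoff y ≠ 0 → 1 ≤ ‖y‖ := fun y h ↦
    not_lt.1 fun h' ↦ h (fderiv_cutoff_eq_zero h')
  have hCn : ∀ n, C * (R n)⁻¹ ≤ C := fun n ↦ mul_le_of_le_one_right hC (inv_le_one_of_one_le₀ (hR1 n))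
  have hright : Filter.Tendsto (fun n ↦ ∫ y, wedgeChernSimons τ cutoff (scaleForm A (R n)) y)
      Filter.atTop (𝓝 (∫ y : R4, ((4 * (fderiv ℝ cutoff y y / ‖y‖ ^ 4) : ℝ) : ℂ) *
        tripleTrace τ l)) := by
    set a := C + ‖l‖
    refine tendsto_integral_of_dominated_convergence
      (fun y ↦ 4 * (‖fderiv ℝ cutoff y‖ * (12 * (‖τ‖ * (a * C)) + 8 * (‖τ‖ * (a * (a * a))))))
      (fun n ↦ ?_) ?_ (fun n ↦ Filter.Eventually.of_forall fun y ↦ ?_)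
      (Filter.Eventually.of_forall fun y ↦ ?_)
    · exact (continuous_wedgeChernSimons τ contDiff_cutoff
        (contDiffAt_scaleForm hA _)).aestronglyMeasurable
    · refine ((Continuous.integrable_of_hasCompactSupport
        (contDiff_cutoff.continuous_fderiv (by simp)).norm
        (hasCompactSupport_cutoff.fderiv ℝ).norm).mul_const _).const_mul _
    · refine norm_wedgeChernSimons_le τ fun h ↦ norm_chernSimons_le τ (fun i ↦ ?_)
        fun i j ↦ (hF n y (hdψ y h) i j).trans (hCn n)
      have h1 := hB n y (hdψ y h)
      have h2 := norm_modelForm_le l y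
      have h3 : ‖l‖ * ‖y‖⁻¹ ≤ ‖l‖ :=
        mul_le_of_le_one_right (norm_nonneg l) (inv_le_one_of_one_le₀ (hdψ y h))
      have h4 := norm_add_le (scaleForm A (R n) y - modelForm l y) (modelForm l y)
      rw [sub_add_cancel] at h4
      refine (norm_apply_stdVec_le _ i).trans ?_
      simp only [a]
      linarith [hCn n]
    · by_cases h : fderiv ℝ cutoff y = 0
      · simp [wedgeChernSimons, h]
      have hy := hdψ y h
      have hy0 : y ≠ 0 := by
        rintro rfl
        rw [norm_zero] at hy
        linarith
      have hz : Filter.Tendsto (fun n ↦ C * (R n)⁻¹) Filter.atTop (𝓝 0) := by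
        simpa using hRinv.const_mul C
      have t1 : Filter.Tendsto (fun n ↦ scaleForm A (R n) y) Filter.atTop (𝓝 (modelForm l y)) :=
        tendsto_iff_norm_sub_tendsto_zero.2
          (squeeze_zero (fun _ ↦ norm_nonneg _) (fun n ↦ hB n y hy) hz)
      have t2 := tendsto_chernSimons τ t1 fun i j ↦
        squeeze_zero_norm (fun n ↦ hF n y hy i j) hz
      rw [← wedge_cubicForm τ hτ l hl (fderiv ℝ cutoff y) hy0]
      exact ((((t2 1 2 3).const_smul _).sub ((t2 0 2 3).const_smul _)).add
        ((t2 0 1 3).const_smul _)).sub ((t2 0 1 2).const_smul _)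
  rw [integral_density_mul] at hright
  -- Stokes' theorem at each radius identifies the two sequences up to sign.
  refine tendsto_nhds_unique hleft (hright.neg.congr fun n ↦ ?_)
  rw [← integral_smul_traceSq τ hτ contDiff_cutoff hasCompactSupport_cutoff
    (fun y _ ↦ contDiffAt_scaleForm hA _ y), integral_cutoff_smul_traceSq_scaleForm τ hA (hR0 n)]

theorem wedgeChernSimons_of_flat (τ : 𝒜 →L[ℝ] ℂ) (hτ : ∀ x y, τ (x * y) = τ (y * x))
    (l : ℍ[ℝ] →L[ℝ] 𝒜) (hl : l 1 = 0) (χ : R4 → ℝ) {A : R4 → R4 →L[ℝ] 𝒜} {y : R4} (hy : y ≠ 0)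
    (h : A y = modelForm l y) (hF : ∀ u v, curv A y u v = 0) :
    wedgeChernSimons τ χ A y = (4 * (fderiv ℝ χ y y / ‖y‖ ^ 4) : ℝ) * tripleTrace τ l := by
  have e (u v w : R4) : chernSimons τ A u v w y = cubicForm τ (modelForm l y) u v w := by
    simp [chernSimons, cubicForm, h, hF]
  rw [← wedge_cubicForm τ hτ l hl _ hy]
  simp only [wedgeChernSimons, e]

theorem fderiv_cutoff_smul (R : ℝ) (y : R4) :
    fderiv ℝ (fun z ↦ cutoff (R • z)) y = R • fderiv ℝ cutoff (R • y) := by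
  rw [fderiv_comp_smul]

theorem fderiv_cutoff_smul_apply_self (R : ℝ) (y : R4) :
    fderiv ℝ (fun z ↦ cutoff (R • z)) y y = fderiv ℝ cutoff (R • y) (R • y) := by
  rw [fderiv_cutoff_smul, map_smul, smul_apply]

theorem density_smul {R : ℝ} (hR : R ≠ 0) (y : R4) :
    fderiv ℝ (fun z ↦ cutoff (R • z)) y y / ‖y‖ ^ 4 =
      R ^ 4 * (fderiv ℝ cutoff (R • y) (R • y) / ‖R • y‖ ^ 4) := by
  have e : ‖R • y‖ ^ 4 = R ^ 4 * ‖y‖ ^ 4 := by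
    rw [norm_smul, mul_pow, Real.norm_eq_abs, Even.pow_abs (by decide)]
  rw [fderiv_cutoff_smul_apply_self, e]
  field_simp

theorem integrable_density : Integrable fun y : R4 ↦ fderiv ℝ cutoff y y / ‖y‖ ^ 4 :=
  continuous_cutoff_density.integrable_of_hasCompactSupport hasCompactSupport_cutoff_density

theorem integrable_density_smul {R : ℝ} (hR : 0 < R) (T : ℂ) :
    Integrable fun y : R4 ↦
      ((4 * (fderiv ℝ (fun z ↦ cutoff (R • z)) y y / ‖y‖ ^ 4) : ℝ) : ℂ) * T := by
  simp only [density_smul hR.ne']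
  exact (((integrable_density.comp_smul hR.ne').const_mul _).const_mul _).ofReal.mul_const _

/-- The density is scale invariant, so the constant does not depend on the radius at which the
cutoff is placed; both ends of the annulus therefore produce the same constant. -/
theorem integral_density_smul {R : ℝ} (hR : 0 < R) (T : ℂ) :
    ∫ y : R4, ((4 * (fderiv ℝ (fun z ↦ cutoff (R • z)) y y / ‖y‖ ^ 4) : ℝ) : ℂ) * T =
      cutoffConst * T := by
  simp only [density_smul hR.ne']
  have h := Measure.integral_comp_smul (volume : Measure R4)
    (fun y ↦ R ^ 4 • (((4 * (fderiv ℝ cutoff y y / ‖y‖ ^ 4) : ℝ) : ℂ) * T)) R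
  rw [integral_smul _ (fun y : R4 ↦ ((4 * (fderiv ℝ cutoff y y / ‖y‖ ^ 4) : ℝ) : ℂ) * T),
    integral_density_mul, finrank_euclideanSpace, Fintype.card_fin, abs_of_pos (by positivity),
    smul_smul (R ^ 4)⁻¹, inv_mul_cancel₀ (by positivity), one_smul] at h
  rw [← h]
  refine integral_congr_ae (Filter.Eventually.of_forall fun y ↦ ?_)
  simp only [Complex.real_smul]
  push_cast
  ring

theorem ae_ne_zero : ∀ᵐ y : R4, y ≠ 0 := by
  simp [ae_iff, measure_singleton]

/-- A connection form on `ℝ⁴ ∖ 0` which agrees with flat model forms near `0` and near infinity. -/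
theorem integral_traceSq_annulus (τ : 𝒜 →L[ℝ] ℂ) (hτ : ∀ x y, τ (x * y) = τ (y * x))
    (l₁ l₂ : ℍ[ℝ] →L[ℝ] 𝒜) (hl₁ : l₁ 1 = 0) (hl₂ : l₂ 1 = 0) {A : R4 → R4 →L[ℝ] 𝒜}
    (hA : ∀ y ≠ 0, ContDiffAt ℝ ∞ A y) {a b : ℝ} (ha : 0 < a)
    (h₁ : ∀ y ≠ 0, ‖y‖ < a → A y = modelForm l₁ y ∧ ∀ u v, curv A y u v = 0)
    (h₂ : ∀ y ≠ 0, b < ‖y‖ → A y = modelForm l₂ y ∧ ∀ u v, curv A y u v = 0) :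
    Integrable (traceSq τ A) ∧
      ∫ y, traceSq τ A y = cutoffConst * tripleTrace τ l₁ - cutoffConst * tripleTrace τ l₂ := by
  -- The condition b < R puts the differential of χ₁ beyond radius b, and 2 / a < R puts the support
  -- of χ₂ inside radius a. Both differentials then live where A is a flat model, and χ₁ - χ₂ is 1
  -- in between.
  obtain ⟨R, hR1, hRb, hRa⟩ : ∃ R : ℝ, 2 ≤ R ∧ b < R ∧ 2 / a < R := by
    refine ⟨max 2 (max b (2 / a)) + 1, ?_, ?_, ?_⟩
    · linarith [le_max_left 2 (max b (2 / a))]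
    · linarith [(le_max_left b (2 / a)).trans (le_max_right 2 (max b (2 / a)))]
    · linarith [(le_max_right b (2 / a)).trans (le_max_right 2 (max b (2 / a)))]
  have hR : 0 < R := by linarith
  have hRa' : 2 < R * a := (div_lt_iff₀ ha).1 hRa
  have hsm (c : ℝ) : ContDiff ℝ ∞ fun y : R4 ↦ cutoff (c • y) :=
    contDiff_cutoff.comp (contDiff_id.const_smul c)
  set χ₁ : R4 → ℝ := fun y ↦ cutoff (R⁻¹ • y) with hχ₁
  set χ₂ : R4 → ℝ := fun y ↦ cutoff (R • y) with hχ₂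
  have n1 : ∀ y : R4, ‖R⁻¹ • y‖ = R⁻¹ * ‖y‖ := fun y ↦ by
    rw [norm_smul, Real.norm_of_nonneg (by positivity)]
  have n2 : ∀ y : R4, ‖R • y‖ = R * ‖y‖ := fun y ↦ by
    rw [norm_smul, Real.norm_of_nonneg hR.le]
  have χ₁_one : ∀ y, ‖y‖ ≤ R → χ₁ y = 1 := fun y hy ↦ cutoff_eq_one (by
    rw [n1, inv_mul_le_iff₀ hR]; linarith)
  have χ₂_one : ∀ y, ‖y‖ ≤ R⁻¹ → χ₂ y = 1 := fun y hy ↦ cutoff_eq_one (by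
    rw [n2, ← le_inv_mul_iff₀ hR]; linarith)
  have χ₂_zero : ∀ y, a ≤ ‖y‖ → χ₂ y = 0 := fun y hy ↦ cutoff_eq_zero (by
    rw [n2]; nlinarith)
  have χ₁_zero : ∀ y, R * 2 ≤ ‖y‖ → χ₁ y = 0 := fun y hy ↦ cutoff_eq_zero (by
    rw [n1, le_inv_mul_iff₀ hR]; exact hy)
  have hRR : R⁻¹ < R := by
    rw [inv_lt_iff_one_lt_mul₀ hR]; nlinarith
  have haR : R⁻¹ < a := by
    rw [inv_lt_iff_one_lt_mul₀ hR]; linarith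
  set χ : R4 → ℝ := fun y ↦ χ₁ y - χ₂ y with hχ
  have dχ : ContDiff ℝ ∞ χ := (hsm _).sub (hsm _)
  have cχ : HasCompactSupport χ := by
    refine HasCompactSupport.intro (isCompact_closedBall (0 : R4) (max (R * 2) a)) fun y hy ↦ ?_
    have hy' : max (R * 2) a < ‖y‖ := not_le.1 (mt mem_closedBall_zero_iff.2 hy)
    rw [max_lt_iff] at hy'
    simp [hχ, χ₁_zero y hy'.1.le, χ₂_zero y hy'.2.le]
  have tχ : ∀ y ∈ tsupport χ, y ≠ 0 := by
    rintro y hy rfl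
    refine (notMem_tsupport_iff_eventuallyEq.2 ?_) hy
    filter_upwards [Metric.ball_mem_nhds (0 : R4) (inv_pos.2 hR)] with z hz
    have hz' := (mem_ball_zero_iff.1 hz).le
    simp [hχ, χ₁_one z (hz'.trans hRR.le), χ₂_one z hz']
  have tS := integral_smul_traceSq τ hτ dχ cχ (A := A) fun y hy ↦ hA y (tχ y hy)
  have flat0 : ∀ y, (∀ u v, curv A y u v = 0) → traceSq τ A y = 0 := fun y h ↦ by
    simp [traceSq, h]
  -- Away from the origin, the curvature vanishes wherever χ differs from 1, so the cutoff does not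
  -- change the integrand.
  have e1 : (fun y ↦ χ y • traceSq τ A y) =ᵐ[volume] traceSq τ A := by
    filter_upwards [ae_ne_zero] with y hy
    by_cases ya : ‖y‖ < a
    · simp [flat0 y (h₁ y hy ya).2]
    · by_cases yb : b < ‖y‖
      · simp [flat0 y (h₂ y hy yb).2]
      · simp [hχ, χ₁_one y (by linarith), χ₂_zero y (by linarith)]
  have i1 : Integrable fun y ↦ χ y • traceSq τ A y :=
    integrable_smul_of_tsupport dχ.continuous cχ subset_rfl fun y hy ↦
      continuousAt_traceSq τ (hA y (tχ y hy))
  refine ⟨i1.congr e1, ?_⟩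
  rw [← integral_congr_ae e1, tS]
  have dz (c : ℝ) (f : R4 → ℝ) (U : Set R4) (hU : IsOpen U) (h : ∀ z ∈ U, f z = c) (y : R4)
      (hy : y ∈ U) : fderiv ℝ f y = 0 := by
    have : f =ᶠ[𝓝 y] fun _ ↦ c := by
      filter_upwards [hU.mem_nhds hy] with z hz using h z hz
    rw [this.fderiv_eq]
    exact fderiv_const_apply c
  have d1 : ∀ y, ‖y‖ < R → fderiv ℝ χ₁ y = 0 := fun y hy ↦
    dz 1 χ₁ {z | ‖z‖ < R} (isOpen_lt continuous_norm continuous_const)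
      (fun z hz ↦ χ₁_one z (le_of_lt hz)) y hy
  have d2 : ∀ y, a ≤ ‖y‖ → fderiv ℝ χ₂ y = 0 := fun y hy ↦
    dz 0 χ₂ {z | 2 < R * ‖z‖} (isOpen_lt continuous_const (by fun_prop))
      (fun z hz ↦ cutoff_eq_zero (by rw [n2]; exact le_of_lt hz)) y
      (show 2 < R * ‖y‖ by nlinarith)
  have dχ' : ∀ y, fderiv ℝ χ y = fderiv ℝ χ₁ y - fderiv ℝ χ₂ y := fun y ↦
    fderiv_fun_sub ((hsm _).differentiable (by simp) y) ((hsm _).differentiable (by simp) y)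
  -- The outer cutoff meets only the model at infinity and the inner one, entering with a minus
  -- sign, only the model at the origin.
  have e2 : wedgeChernSimons τ χ A =ᵐ[volume] fun y ↦
      ((4 * (fderiv ℝ χ₁ y y / ‖y‖ ^ 4) : ℝ) : ℂ) * tripleTrace τ l₂ -
      ((4 * (fderiv ℝ χ₂ y y / ‖y‖ ^ 4) : ℝ) : ℂ) * tripleTrace τ l₁ := by
    filter_upwards [ae_ne_zero] with y hy
    by_cases ya : ‖y‖ < a
    · by_cases yR : ‖y‖ < R
      · rw [wedgeChernSimons_of_flat τ hτ l₁ hl₁ χ hy (h₁ y hy ya).1 (h₁ y hy ya).2, dχ', d1 y yR]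
        simp
        ring
      · rw [wedgeChernSimons_of_flat τ hτ l₂ hl₂ χ hy (h₂ y hy (by linarith)).1
          (h₂ y hy (by linarith)).2, dχ']
        have : fderiv ℝ χ₂ y = 0 :=
          dz 0 χ₂ {z | 2 < R * ‖z‖} (isOpen_lt continuous_const (by fun_prop))
            (fun z hz ↦ cutoff_eq_zero (by rw [n2]; exact le_of_lt hz)) y
            (show 2 < R * ‖y‖ by nlinarith)
        simp [this]
    · by_cases yb : b < ‖y‖
      · rw [wedgeChernSimons_of_flat τ hτ l₂ hl₂ χ hy (h₂ y hy yb).1 (h₂ y hy yb).2, dχ',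
          d2 y (not_lt.1 ya)]
        simp
      · simp [wedgeChernSimons, dχ', d2 y (not_lt.1 ya), d1 y (by linarith)]
  rw [integral_congr_ae e2, integral_sub (integrable_density_smul (inv_pos.2 hR) _)
    (integrable_density_smul hR _), integral_density_smul (inv_pos.2 hR),
    integral_density_smul hR]
  ring

end Residue

/-! ### Squares of compactly supported closed 2-forms. -/

section ClosedForms

open scoped Convolution

variable {f g : R4 → ℝ}

/-- The convolution of two functions on `ℝ⁴`. -/
def conv (f g : R4 → ℝ) : R4 → ℝ := f ⋆[ContinuousLinearMap.mul ℝ ℝ, volume] g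

theorem conv_apply (f g : R4 → ℝ) (x : R4) : conv f g x = ∫ t, f t * g (x - t) := rfl

theorem conv_comm (f g : R4 → ℝ) : conv f g = conv g f := by
  funext x
  rw [conv, convolution_eq_swap, conv_apply]
  exact integral_congr_ae (Filter.Eventually.of_forall fun t ↦ mul_comm _ _)

theorem hasFDerivAt_conv_right (hf : Continuous f) (hg : ContDiff ℝ 1 g)
    (cg : HasCompactSupport g) (x : R4) : ∃ L : R4 →L[ℝ] ℝ, HasFDerivAt (conv f g) L x ∧
      ∀ u, L u = conv f (fun z ↦ fderiv ℝ g z u) x :=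
  ⟨_, cg.hasFDerivAt_convolution_right (ContinuousLinearMap.mul ℝ ℝ)
    (hf.locallyIntegrable (μ := volume)) hg x,
    convolution_precompR_apply (ContinuousLinearMap.mul ℝ ℝ)
      hf.locallyIntegrable (cg.fderiv ℝ) (hg.continuous_fderiv one_ne_zero) x⟩

/-- The derivative may be placed on either factor, so closedness of either form in a convolution can
be used. -/
theorem hasFDerivAt_conv (hf : ContDiff ℝ 1 f) (cf : HasCompactSupport f) (hg : ContDiff ℝ 1 g)
    (cg : HasCompactSupport g) (x : R4) : ∃ L : R4 →L[ℝ] ℝ, HasFDerivAt (conv f g) L x ∧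
      (∀ u, L u = conv (fun z ↦ fderiv ℝ f z u) g x) ∧
      ∀ u, L u = conv f (fun z ↦ fderiv ℝ g z u) x := by
  obtain ⟨L, hL, hr⟩ := hasFDerivAt_conv_right hf.continuous hg cg x
  obtain ⟨L', hL', hl⟩ := hasFDerivAt_conv_right hg.continuous hf cf x
  rw [conv_comm] at hL'
  refine ⟨L, hL, fun u ↦ ?_, hr⟩
  rw [hL.unique hL', hl, conv_comm]

theorem integral_sub_add_eq_zero {f g h : R4 → ℝ} (hf : Integrable f) (hg : Integrable g)
    (hh : Integrable h) (e : ∀ t, f t - g t + h t = 0) :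
    (∫ t, f t) - (∫ t, g t) + ∫ t, h t = 0 := by
  rw [← integral_sub' hf hg, ← integral_add' (hf.sub hg) hh]
  exact integral_eq_zero_of_ae (Filter.Eventually.of_forall e)

/-- `X i j k l m` stands for the derivative in direction m of the pairing of the components (i, j)
and (k, l). The hypotheses express closedness in the first and in the second pair, and for each
direction six instances suffice. -/
theorem sum_eq_zero_of_closed (X : Fin 4 → Fin 4 → Fin 4 → Fin 4 → Fin 4 → ℝ)
    (r1 : ∀ i j k c d, X j k c d i - X i k c d j + X i j c d k = 0)
    (r2 : ∀ i j k c d, X c d j k i - X c d i k j + X c d i j k = 0) (m : Fin 4) :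
    X 0 1 2 3 m - X 0 2 1 3 m + X 0 3 1 2 m + X 2 3 0 1 m - X 1 3 0 2 m + X 1 2 0 3 m = 0 := by
  match m with
  | 0 =>
    linarith [r1 0 2 3 0 1, r1 0 1 3 0 2, r1 0 1 2 0 3, r2 0 2 3 0 1, r2 0 1 3 0 2, r2 0 1 2 0 3]
  | 1 =>
    linarith [r1 1 2 3 0 1, r1 0 1 3 1 2, r1 0 1 2 1 3, r2 1 2 3 0 1, r2 0 1 3 1 2, r2 0 1 2 1 3]
  | 2 =>
    linarith [r1 1 2 3 0 2, r1 0 2 3 1 2, r1 0 1 2 2 3, r2 1 2 3 0 2, r2 0 2 3 1 2, r2 0 1 2 2 3]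
  | 3 =>
    linarith [r1 1 2 3 0 3, r1 0 2 3 1 3, r1 0 1 3 2 3, r2 1 2 3 0 3, r2 0 2 3 1 3, r2 0 1 3 2 3]

/-- The integral of the square of a closed 2-form with compact support on `ℝ⁴` vanishes. -/
theorem integral_sq_closed (β : Fin 4 → Fin 4 → R4 → ℝ) (hβ : ∀ i j, ContDiff ℝ ∞ (β i j))
    (cβ : ∀ i j, HasCompactSupport (β i j))
    (closed : ∀ i j k y, fderiv ℝ (β j k) y (stdVec i) - fderiv ℝ (β i k) y (stdVec j) +
      fderiv ℝ (β i j) y (stdVec k) = 0) :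
    ∫ y, (β 0 1 y * β 2 3 y - β 0 2 y * β 1 3 y + β 0 3 y * β 1 2 y) = 0 := by
  have hβ1 (i j) : ContDiff ℝ 1 (β i j) := (hβ i j).of_le (by exact_mod_cast le_top)
  -- With one factor reflected, the convolution at x is ∫ β(t) β(t - x), the pairing of β with a
  -- translate of itself.
  set g : Fin 4 → Fin 4 → R4 → ℝ := fun i j y ↦ β i j (-y) with hg
  have hg1 (i j) : ContDiff ℝ 1 (g i j) := (hβ1 i j).comp contDiff_neg
  have cg (i j) : HasCompactSupport (g i j) := (cβ i j).comp_homeomorph (Homeomorph.neg R4)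
  have dg (i j y u) : fderiv ℝ (g i j) y u = - fderiv ℝ (β i j) (-y) u := by
    have h : HasFDerivAt (g i j) _ y :=
      ((hβ1 i j).differentiable one_ne_zero (-y)).hasFDerivAt.comp y (hasFDerivAt_id y).neg
    rw [h.fderiv]
    simp
  -- I x is the polarized integral of β against its translate by x. Closedness makes its derivative
  -- zero, so I is constant; it has compact support, so it vanishes. Its value at 0 is twice the
  -- required integral.
  obtain ⟨I, hI⟩ : ∃ I, I = conv (β 0 1) (g 2 3) - conv (β 0 2) (g 1 3) + conv (β 0 3) (g 1 2) +
    conv (β 2 3) (g 0 1) - conv (β 1 3) (g 0 2) + conv (β 1 2) (g 0 3) := ⟨_, rfl⟩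
  have cc (i j k l) : HasCompactSupport (conv (β i j) (g k l)) :=
    HasCompactSupport.convolution (ContinuousLinearMap.mul ℝ ℝ) (cβ i j) (cg k l)
  have cI : HasCompactSupport I := hI ▸
    (((((cc 0 1 2 3).sub (cc 0 2 1 3)).add (cc 0 3 1 2)).add (cc 2 3 0 1)).sub (cc 1 3 0 2)).add
      (cc 1 2 0 3)
  have hdI : ∀ x, HasFDerivAt I (0 : R4 →L[ℝ] ℝ) x := by
    intro x
    choose L hL hl hr using fun i j k l ↦
      hasFDerivAt_conv (hβ1 i j) (cβ i j) (hg1 k l) (cg k l) x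
    have h := (((((hL 0 1 2 3).sub (hL 0 2 1 3)).add (hL 0 3 1 2)).add (hL 2 3 0 1)).sub
      (hL 1 3 0 2)).add (hL 1 2 0 3)
    have cd (i j u) : Continuous (fun z ↦ fderiv ℝ (β i j) z u) ∧
        HasCompactSupport (fun z ↦ fderiv ℝ (β i j) z u) :=
      ⟨((hβ1 i j).continuous_fderiv one_ne_zero).clm_apply continuous_const,
        (cβ i j).fderiv_apply ℝ u⟩
    have cd' (i j u) : Continuous (fun z ↦ fderiv ℝ (g i j) z u) ∧
        HasCompactSupport (fun z ↦ fderiv ℝ (g i j) z u) :=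
      ⟨((hg1 i j).continuous_fderiv one_ne_zero).clm_apply continuous_const,
        (cg i j).fderiv_apply ℝ u⟩
    have i1 (a b u c d) : Integrable fun t ↦ fderiv ℝ (β a b) t u * g c d (x - t) :=
      (cd a b u).2.convolutionExists_left (ContinuousLinearMap.mul ℝ ℝ) (cd a b u).1
        (hg1 c d).continuous.locallyIntegrable x
    have i2 (a b u c d) : Integrable fun t ↦ β a b t * fderiv ℝ (g c d) (x - t) u :=
      (cβ a b).convolutionExists_left (ContinuousLinearMap.mul ℝ ℝ) (hβ1 a b).continuous
        (cd' c d u).1.locallyIntegrable x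
    have r1 (i j k c d) : L j k c d (stdVec i) - L i k c d (stdVec j) + L i j c d (stdVec k) = 0 := by
      rw [hl, hl, hl]
      refine integral_sub_add_eq_zero (i1 _ _ _ _ _) (i1 _ _ _ _ _) (i1 _ _ _ _ _) fun t ↦ ?_
      simp only [ContinuousLinearMap.mul_apply']
      rw [← sub_mul, ← add_mul, closed i j k t, zero_mul]
    have r2 (i j k c d) : L c d j k (stdVec i) - L c d i k (stdVec j) + L c d i j (stdVec k) = 0 := by
      rw [hr, hr, hr]
      refine integral_sub_add_eq_zero (i2 _ _ _ _ _) (i2 _ _ _ _ _) (i2 _ _ _ _ _) fun t ↦ ?_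
      simp only [ContinuousLinearMap.mul_apply']
      rw [← mul_sub, ← mul_add, dg, dg, dg]
      have := closed i j k (-(x - t))
      linear_combination (-β c d t) * this
    rw [← hI] at h
    refine h.congr_fderiv ?_
    ext u
    rw [apply_eq_sum_stdVec _ u, zero_apply]
    simp only [add_apply, sub_apply, smul_eq_mul]
    have z := sum_eq_zero_of_closed (fun i j k l m ↦ L i j k l (stdVec m)) r1 r2
    linear_combination u 0 * z 0 + u 1 * z 1 + u 2 * z 2 + u 3 * z 3
  have hI0 : I 0 = 0 := by
    obtain ⟨x, hx⟩ := (Set.ne_univ_iff_exists_notMem _).1 cI.isCompact.ne_univ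
    rw [is_const_of_fderiv_eq_zero (𝕜 := ℝ) (fun x ↦ (hdI x).differentiableAt)
      (fun x ↦ (hdI x).fderiv) 0 x]
    exact image_eq_zero_of_notMem_tsupport hx
  have e (i j k l) : conv (β i j) (g k l) 0 = ∫ t, β i j t * β k l t := by
    simp [conv_apply, hg]
  have it (i j k l) : Integrable fun t ↦ β i j t * β k l t :=
    ((hβ1 i j).continuous.mul (hβ1 k l).continuous).integrable_of_hasCompactSupport
      (cβ i j).mul_right
  have s (i j k l) : ∫ t, β i j t * β k l t = ∫ t, β k l t * β i j t :=
    integral_congr_ae (Filter.Eventually.of_forall fun t ↦ mul_comm _ _)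
  have t1 := integral_sub (it 0 1 2 3) (it 0 2 1 3)
  have t2 := integral_add ((it 0 1 2 3).sub (it 0 2 1 3)) (it 0 3 1 2)
  simp only [Pi.sub_apply] at t2
  rw [t2, t1]
  simp only [hI, Pi.add_apply, Pi.sub_apply, e] at hI0
  rw [s 2 3, s 1 3, s 1 2] at hI0
  linarith

end ClosedForms

/-! ### Normalization of quaternions. -/

section UnitQuaternions

open Classical in
/-- The unit quaternion `q / ‖q‖`; the value at `0` is not used. -/
def unitQuat (q : ℍ[ℝ]) : SU2 :=
  if h : q = 0 then 1
  else ⟨‖q‖⁻¹ • q, by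
    rw [mem_sphere_zero_iff_norm, norm_smul, norm_inv, norm_norm,
      inv_mul_cancel₀ (norm_ne_zero_iff.2 h)]⟩

theorem toEquator_eq (b : S4) : toEquator b = unitQuat (quaternionPart b) := rfl

theorem coe_unitQuat {q : ℍ[ℝ]} (h : q ≠ 0) : (unitQuat q : ℍ[ℝ]) = ‖q‖⁻¹ • q := by
  simp [unitQuat, h]

theorem contMDiffAt_unitQuat {q : ℍ[ℝ]} (h : q ≠ 0) :
    ContMDiffAt 𝓘(ℝ, ℍ[ℝ]) (𝓡 3) ∞ unitQuat q := by
  let U : TopologicalSpace.Opens ℍ[ℝ] := ⟨{q | q ≠ 0}, isOpen_ne⟩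
  have h1 : ContMDiff 𝓘(ℝ, ℍ[ℝ]) 𝓘(ℝ, ℍ[ℝ]) ∞ (fun b : U ↦ ‖(b : ℍ[ℝ])‖⁻¹ • (b : ℍ[ℝ])) := by
    intro b
    have h2 : ContDiffAt ℝ ∞ (fun q : ℍ[ℝ] ↦ ‖q‖⁻¹ • q) b :=
      ((contDiffAt_norm ℝ b.2).inv (norm_ne_zero_iff.2 b.2)).smul contDiffAt_id
    exact (contMDiffAt_subtype_iff (f := fun b : ℍ[ℝ] ↦ ‖b‖⁻¹ • b)).2 h2.contMDiffAt
  have h3 := h1.codRestrict_sphere (n := 3) (fun b ↦ by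
    rw [mem_sphere_zero_iff_norm, norm_smul, norm_inv, norm_norm,
      inv_mul_cancel₀ (norm_ne_zero_iff.2 b.2)])
  refine (contMDiffAt_subtype_iff (U := U) (f := unitQuat) (x := ⟨q, h⟩)).1 ?_
  refine (h3.congr fun c ↦ ?_) ⟨q, h⟩
  ext1
  exact coe_unitQuat c.2

theorem unitQuat_smul {c : ℝ} (hc : 0 < c) (q : ℍ[ℝ]) : unitQuat (c • q) = unitQuat q := by
  by_cases h : q = 0
  · simp [h]
  ext1
  rw [coe_unitQuat (smul_ne_zero hc.ne' h), coe_unitQuat h, norm_smul, Real.norm_of_nonneg hc.le,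
    smul_smul, mul_inv, mul_right_comm, inv_mul_cancel₀ hc.ne', one_mul]

theorem unitQuat_mul {p q : ℍ[ℝ]} (hp : p ≠ 0) (hq : q ≠ 0) :
    unitQuat (p * q) = unitQuat p * unitQuat q := by
  ext1
  rw [coe_unitQuat (mul_ne_zero hp hq)]
  change _ = (unitQuat p : ℍ[ℝ]) * (unitQuat q : ℍ[ℝ])
  rw [coe_unitQuat hp, coe_unitQuat hq, norm_mul, smul_mul_smul_comm, mul_inv]

theorem unitQuat_one : unitQuat 1 = 1 := by
  ext1
  rw [coe_unitQuat one_ne_zero]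
  simp

theorem unitQuat_star {q : ℍ[ℝ]} (hq : q ≠ 0) : unitQuat (star q) = (unitQuat q)⁻¹ := by
  rw [eq_inv_iff_mul_eq_one, ← unitQuat_mul (star_ne_zero.2 hq) hq, Quaternion.star_mul_self]
  have h : (0 : ℝ) < Quaternion.normSq q :=
    lt_of_le_of_ne Quaternion.normSq_nonneg (Ne.symm (Quaternion.normSq_ne_zero.2 hq))
  rw [show ((Quaternion.normSq q : ℝ) : ℍ[ℝ]) = Quaternion.normSq q • (1 : ℍ[ℝ]) by
    rw [← Quaternion.coe_mul_eq_smul, mul_one], unitQuat_smul h, unitQuat_one]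

theorem toQuat_ne_zero {y : R4} (hy : y ≠ 0) : toQuat y ≠ 0 := by
  simpa using hy

end UnitQuaternions

/-! ### The differential of a representation and the transition gauge. -/

namespace SmoothRep

variable {W : Type*} [NormedAddCommGroup W] [NormedSpace ℝ W] (ρ : SmoothRep W)

/-- The extension of a representation of `SU(2)` to the non-zero quaternions which is constant on
rays. -/
def radialExt (q : ℍ[ℝ]) : W →L[ℝ] W := ρ.toHom (unitQuat q)

/-- The differential of a representation of `SU(2)`, extended by zero to the real quaternions. -/
def liftDeriv : ℍ[ℝ] →L[ℝ] (W →L[ℝ] W) := fderiv ℝ ρ.radialExt 1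

theorem contDiffAt_radialExt {q : ℍ[ℝ]} (hq : q ≠ 0) : ContDiffAt ℝ ∞ ρ.radialExt q :=
  ((ρ.smooth (unitQuat q)).comp q (contMDiffAt_unitQuat hq)).contDiffAt

theorem hasFDerivAt_radialExt_one : HasFDerivAt ρ.radialExt ρ.liftDeriv 1 :=
  ((ρ.contDiffAt_radialExt one_ne_zero).differentiableAt (by simp)).hasFDerivAt

/-- `radialExt` is constant along the ray through 1. -/
theorem liftDeriv_one : ρ.liftDeriv 1 = 0 := by
  have h1 : HasDerivAt (fun t : ℝ ↦ t • (1 : ℍ[ℝ])) 1 1 := by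
    simpa using (hasDerivAt_id (1 : ℝ)).smul_const (1 : ℍ[ℝ])
  have h0 : HasFDerivAt ρ.radialExt ρ.liftDeriv ((1 : ℝ) • (1 : ℍ[ℝ])) := by
    rw [one_smul]
    exact ρ.hasFDerivAt_radialExt_one
  have h2 := h0.comp_hasDerivAt 1 h1
  refine h2.unique ((hasDerivAt_const (1 : ℝ) (ρ.radialExt 1)).congr_of_eventuallyEq ?_)
  filter_upwards [lt_mem_nhds (zero_lt_one : (0 : ℝ) < 1)] with t ht
  simp [radialExt, unitQuat_smul ht]

/-- The change of gauge `y ↦ ρ (y / ‖y‖)⁻¹` on `ℝ⁴ ∖ 0`. -/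
def gauge (y : R4) : W →L[ℝ] W := ρ.toHom (unitQuat (toQuat y))⁻¹

theorem gauge_eq_radialExt {y : R4} (hy : y ≠ 0) :
    ρ.gauge y = ρ.radialExt (star (toQuat y)) := by
  rw [gauge, radialExt, unitQuat_star (toQuat_ne_zero hy)]

theorem isUnit_toHom (g : SU2) : IsUnit (ρ.toHom g) :=
  (Group.isUnit g).map ρ.toHom

theorem isUnit_gauge (y : R4) : IsUnit (ρ.gauge y) := ρ.isUnit_toHom _

theorem inverse_gauge (y : R4) : Ring.inverse (ρ.gauge y) = ρ.toHom (unitQuat (toQuat y)) := by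
  have h : ρ.gauge y * ρ.toHom (unitQuat (toQuat y)) = 1 := by
    rw [gauge, ← map_mul, inv_mul_cancel, map_one]
  rw [← one_mul (ρ.toHom _), ← Ring.inverse_mul_cancel _ (ρ.isUnit_gauge y), mul_assoc, h, mul_one]

theorem contDiffAt_gauge {y : R4} (hy : y ≠ 0) : ContDiffAt ℝ ∞ ρ.gauge y := by
  have h : ContDiffAt ℝ ∞ (fun y : R4 ↦ ρ.radialExt (starQuat (toQuat y))) y :=
    ContDiffAt.comp (g := ρ.radialExt) (f := fun y : R4 ↦ starQuat (toQuat y)) y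
      (ρ.contDiffAt_radialExt (star_ne_zero.2 (toQuat_ne_zero hy)))
      ((starQuat.contDiff.comp toQuat.contDiff).contDiffAt)
  refine h.congr_of_eventuallyEq ?_
  filter_upwards [isOpen_ne.mem_nhds hy] with z hz
  exact ρ.gauge_eq_radialExt hz

/-- By multiplicativity ψ(w) = ψ(y) ρ̃(y w̄ / ‖y‖²) for nonzero w, where ρ̃ is `radialExt`. The
argument is linear in w and equals 1 at w = y, so the derivative at y reduces to the derivative of
ρ̃ at 1, and ψ⁻¹dψ is the model form. -/
theorem fderiv_gauge {y : R4} (hy : y ≠ 0) (u : R4) :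
    fderiv ℝ ρ.gauge y u = ρ.gauge y * modelForm ρ.liftDeriv y u := by
  have hq := toQuat_ne_zero hy
  have hn : ‖y‖ ^ 2 ≠ 0 := pow_ne_zero 2 (norm_ne_zero_iff.2 hy)
  set L : R4 →L[ℝ] ℍ[ℝ] := (‖y‖ ^ 2)⁻¹ • ((ContinuousLinearMap.mul ℝ ℍ[ℝ] (toQuat y)).comp
    (starQuat.comp (toQuat : R4 →L[ℝ] ℍ[ℝ]))) with hL
  have hLa : ∀ w, L w = (‖y‖ ^ 2)⁻¹ • (toQuat y * star (toQuat w)) := fun w ↦ rfl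
  have hLy : L y = 1 := by
    rw [hLa, Quaternion.self_mul_star, Quaternion.normSq_eq_norm_mul_self,
      LinearIsometryEquiv.norm_map, ← sq, ← Quaternion.coe_smul, smul_eq_mul, inv_mul_cancel₀ hn]
    rfl
  have h1 : HasFDerivAt (fun w ↦ ρ.gauge y * ρ.radialExt (L w))
      ((ContinuousLinearMap.mul ℝ (W →L[ℝ] W) (ρ.gauge y)).comp (ρ.liftDeriv.comp L)) y := by
    have h2 : HasFDerivAt (fun w ↦ ρ.radialExt (L w)) (ρ.liftDeriv.comp L) y :=
      (hLy.symm ▸ ρ.hasFDerivAt_radialExt_one :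
        HasFDerivAt ρ.radialExt ρ.liftDeriv (L y)).comp y L.hasFDerivAt
    exact (ContinuousLinearMap.mul ℝ (W →L[ℝ] W) (ρ.gauge y)).hasFDerivAt.comp y h2
  have h3 : ρ.gauge =ᶠ[𝓝 y] fun w ↦ ρ.gauge y * ρ.radialExt (L w) := by
    filter_upwards [isOpen_ne.mem_nhds hy] with w hw
    have hw' := star_ne_zero.2 (toQuat_ne_zero hw)
    have hqs := star_ne_zero.2 hq
    rw [hLa, ρ.gauge_eq_radialExt hw, ρ.gauge_eq_radialExt hy, radialExt, radialExt, radialExt,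
      unitQuat_smul (by positivity), unitQuat_mul hq hw', ← map_mul, ← mul_assoc,
      unitQuat_star hq, inv_mul_cancel, one_mul]
  rw [h3.fderiv_eq, h1.fderiv, modelForm_apply]
  simp only [ContinuousLinearMap.comp_apply, ContinuousLinearMap.mul_apply', hLa, map_smul]
  exact (mul_smul_comm _ _ _).symm

theorem gaugeTransform_gauge [CompleteSpace W] {A : R4 → R4 →L[ℝ] W →L[ℝ] W} {y : R4} (hy : y ≠ 0)
    (u : R4) : gaugeTransform ρ.gauge A y u = modelForm ρ.liftDeriv y u +
      ρ.toHom (unitQuat (toQuat y)) * (A y u * ρ.gauge y) := by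
  rw [gaugeTransform_apply, ρ.fderiv_gauge hy, mul_add, ← mul_assoc,
    Ring.inverse_mul_cancel _ (ρ.isUnit_gauge y), one_mul, inverse_gauge]

theorem exists_norm_toHom_le : ∃ C : ℝ, ∀ g, ‖ρ.toHom g‖ ≤ C := by
  obtain ⟨C, hC⟩ := isCompact_univ.exists_bound_of_continuousOn (ρ.smooth.continuous.continuousOn)
  exact ⟨C, fun g ↦ hC g trivial⟩

end SmoothRep

/-! ### Naturality and bounds of the curvature. -/

section CurvatureCalculus

variable {Y : Type*} [NormedAddCommGroup Y] [NormedSpace ℝ Y]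
  {Z : Type*} [NormedAddCommGroup Z] [NormedSpace ℝ Z]
  {𝒜 : Type*} [NormedRing 𝒜] [NormedAlgebra ℝ 𝒜]

theorem curv_comp {A : Y → Y →L[ℝ] 𝒜} {z : Z → Y} {x : Z} (hA : DifferentiableAt ℝ A (z x))
    (hz : ContDiffAt ℝ ∞ z x) (u v : Z) :
    curv (fun x ↦ (A (z x)).comp (fderiv ℝ z x)) x u v =
      curv A (z x) (fderiv ℝ z x u) (fderiv ℝ z x v) := by
  have h1 : DifferentiableAt ℝ z x := hz.differentiableAt (by simp)
  have h2 : DifferentiableAt ℝ (fderiv ℝ z) x :=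
    (hz.fderiv_right (m := ∞) (by simp)).differentiableAt (by simp)
  have h3 : DifferentiableAt ℝ (fun x ↦ A (z x)) x := hA.comp x h1
  have h4 : fderiv ℝ (fun x ↦ A (z x)) x = (fderiv ℝ A (z x)).comp (fderiv ℝ z x) :=
    fderiv_comp x hA h1
  have hs : fderiv ℝ (fderiv ℝ z) x u v = fderiv ℝ (fderiv ℝ z) x v u :=
    (hz.isSymmSndFDerivAt two_le_infty).eq u v
  simp only [curv, fderiv_clm_comp h3 h2, h4]
  simp [hs]

theorem norm_curv_le (A : Y → Y →L[ℝ] 𝒜) (y u v : Y) :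
    ‖curv A y u v‖ ≤ 2 * (‖fderiv ℝ A y‖ + ‖A y‖ * ‖A y‖) * (‖u‖ * ‖v‖) := by
  have h1 (u v : Y) : ‖fderiv ℝ A y u v‖ ≤ ‖fderiv ℝ A y‖ * ‖u‖ * ‖v‖ :=
    (fderiv ℝ A y).le_opNorm₂ u v
  have h2 (u v : Y) : ‖A y u * A y v‖ ≤ (‖A y‖ * ‖u‖) * (‖A y‖ * ‖v‖) :=
    (norm_mul_le _ _).trans (mul_le_mul ((A y).le_opNorm _) ((A y).le_opNorm _)
      (norm_nonneg _) (by positivity))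
  unfold curv
  refine (norm_add_le _ _).trans ((add_le_add (norm_sub_le _ _) (norm_sub_le _ _)).trans ?_)
  nlinarith [h1 u v, h1 v u, h2 u v, h2 v u]

/-- Compatibility is required on one commutator only. This admits the projection onto a commutant,
which is multiplicative just on commuting elements of the right kind, and traces, for which both
sides of `hτ` vanish. -/
theorem curv_map {ℬ : Type*} [NormedRing ℬ] [NormedAlgebra ℝ ℬ] (τ : 𝒜 →L[ℝ] ℬ)
    {A : Y → Y →L[ℝ] 𝒜} {y : Y} (hA : DifferentiableAt ℝ A y) (u v : Y)
    (hτ : τ (A y u * A y v - A y v * A y u) = τ (A y u) * τ (A y v) - τ (A y v) * τ (A y u)) :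
    curv (fun y ↦ τ.comp (A y)) y u v = τ (curv A y u v) := by
  have h : HasFDerivAt (fun y ↦ τ.comp (A y))
      ((ContinuousLinearMap.compL ℝ Y 𝒜 ℬ τ).comp (fderiv ℝ A y)) y :=
    (ContinuousLinearMap.compL ℝ Y 𝒜 ℬ τ).hasFDerivAt.comp y hA.hasFDerivAt
  rw [curv, curv, h.fderiv, map_add, map_sub, hτ]
  rfl

theorem continuous_norm_comp {X G : Type*} [TopologicalSpace X] [NormedAddCommGroup G] {f : X → G}
    (hf : Continuous f) : Continuous fun x ↦ ‖f x‖ := hf.norm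

theorem exists_bound_closedBall [ProperSpace Y] {A : Y → Y →L[ℝ] 𝒜} (hA : ContDiff ℝ ∞ A) :
    ∃ c, 0 ≤ c ∧ ∀ y, ‖y‖ ≤ 1 → ‖A y‖ ≤ c ∧ ∀ u v, ‖curv A y u v‖ ≤ c * (‖u‖ * ‖v‖) := by
  have h1 : Continuous A := hA.continuous
  have h2 : Continuous (fderiv ℝ A) := hA.continuous_fderiv (by simp)
  have h3 : Continuous fun y ↦ ‖A y‖ + 2 * (‖fderiv ℝ A y‖ + ‖A y‖ * ‖A y‖) :=
    (continuous_norm_comp h1).add (continuous_const.mul ((@continuous_norm_comp _ _ _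
      ContinuousLinearMap.toNormedAddCommGroup _ h2).add
      ((continuous_norm_comp h1).mul (continuous_norm_comp h1))))
  obtain ⟨c, hc⟩ := (isCompact_closedBall (0 : Y) 1).exists_bound_of_continuousOn h3.continuousOn
  have hc' : ∀ y : Y, ‖y‖ ≤ 1 → ‖A y‖ + 2 * (‖fderiv ℝ A y‖ + ‖A y‖ * ‖A y‖) ≤ c := fun y hy ↦
    (le_abs_self _).trans (hc y (mem_closedBall_zero_iff.2 hy))
  have h0 : ∀ y, 0 ≤ 2 * (‖fderiv ℝ A y‖ + ‖A y‖ * ‖A y‖) := fun y ↦ by positivity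
  refine ⟨c, (add_nonneg (norm_nonneg _) (h0 0)).trans (hc' 0 (by simp)), fun y hy ↦
    ⟨by linarith [hc' y hy, h0 y], fun u v ↦ (norm_curv_le A y u v).trans ?_⟩⟩
  exact mul_le_mul_of_nonneg_right (by linarith [hc' y hy, norm_nonneg (A y)]) (by positivity)

end CurvatureCalculus

/-! ### Inversion and decay at infinity. -/

section Inversion

/-- The inversion `y ↦ y / ‖y‖²` of `ℝ⁴`. -/
def inversion (y : R4) : R4 := (‖y‖ ^ 2)⁻¹ • y

theorem norm_inversion (y : R4) : ‖inversion y‖ = ‖y‖⁻¹ := by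
  rw [inversion, norm_smul, norm_inv, norm_pow, norm_norm]
  by_cases h : ‖y‖ = 0
  · simp [h]
  · field_simp

theorem contDiffAt_inversion {y : R4} (hy : y ≠ 0) : ContDiffAt ℝ ∞ inversion y :=
  ((contDiff_norm_sq ℝ).contDiffAt.inv (pow_ne_zero 2 (norm_ne_zero_iff.2 hy))).smul contDiffAt_id

theorem norm_fderiv_inversion_le {y : R4} (hy : y ≠ 0) :
    ‖fderiv ℝ inversion y‖ ≤ 3 / ‖y‖ ^ 2 := by
  have hn : 0 < ‖y‖ := norm_pos_iff.2 hy
  have h1 : HasFDerivAt (fun y : R4 ↦ (‖y‖ ^ 2)⁻¹) _ y :=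
    (hasFDerivAt_inv (pow_ne_zero 2 hn.ne')).comp y (hasStrictFDerivAt_norm_sq y).hasFDerivAt
  have h2 : HasFDerivAt inversion _ y := h1.smul (hasFDerivAt_id y)
  refine ContinuousLinearMap.opNorm_le_bound _ (by positivity) fun u ↦ ?_
  rw [h2.fderiv]
  simp only [add_apply, smul_apply, ContinuousLinearMap.smulRight_apply,
    ContinuousLinearMap.comp_apply, ContinuousLinearMap.id_apply]
  refine (norm_add_le _ _).trans ?_
  have h3 : |inner ℝ y u| ≤ ‖y‖ * ‖u‖ := abs_real_inner_le_norm y u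
  simp only [norm_smul, norm_inv, norm_pow, norm_norm]
  have h4 : ‖(ContinuousLinearMap.toSpanSingleton ℝ (-((‖y‖ ^ 2) ^ 2)⁻¹)) ((2 • (innerSL ℝ y)) u)‖ ≤
      2 * ((‖y‖ * ‖u‖) * ((‖y‖ ^ 2) ^ 2)⁻¹) := by
    simp only [ContinuousLinearMap.toSpanSingleton_apply, smul_apply, innerSL_apply_apply, smul_eq_mul, nsmul_eq_mul,
      Real.norm_eq_abs, abs_mul, abs_neg, abs_inv, abs_pow, abs_norm]
    rw [show |((2 : ℕ) : ℝ)| = 2 by norm_num]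
    nlinarith [h3, inv_nonneg.2 (pow_nonneg (pow_nonneg hn.le 2) 2)]
  refine (add_le_add_right (mul_le_mul_of_nonneg_right h4 hn.le) _).trans (le_of_eq ?_)
  field_simp
  ring

end Inversion

/-- The pull-back by inversion of a smooth 1-form on `ℝ⁴`, in the gauge of a representation, is
asymptotic to a model form. -/
theorem SmoothRep.exists_asymptotic_bound {W : Type*} [NormedAddCommGroup W] [NormedSpace ℝ W]
    [CompleteSpace W] (ρ : SmoothRep W) {A A' : R4 → R4 →L[ℝ] W →L[ℝ] W} (hA' : ContDiff ℝ ∞ A')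
    (h : ∀ y ≠ 0, A y = gaugeTransform ρ.gauge
      (fun x ↦ (A' (inversion x)).comp (fderiv ℝ inversion x)) y) :
    ∃ C, (∀ y, 1 ≤ ‖y‖ → ‖A y - modelForm ρ.liftDeriv y‖ ≤ C / ‖y‖ ^ 2) ∧
      ∀ y, 1 ≤ ‖y‖ → ∀ i j, ‖curv A y (stdVec i) (stdVec j)‖ ≤ C / ‖y‖ ^ 4 := by
  obtain ⟨r, hr⟩ := ρ.exists_norm_toHom_le
  have hr0 : 0 ≤ r := (norm_nonneg _).trans (hr 1)
  obtain ⟨c, hc0, hc⟩ := exists_bound_closedBall hA'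
  have hz : ∀ y : R4, 1 ≤ ‖y‖ → ‖inversion y‖ ≤ 1 := fun y hy ↦ by
    rw [norm_inversion]
    exact inv_le_one_of_one_le₀ hy
  have hy0 : ∀ y : R4, 1 ≤ ‖y‖ → y ≠ 0 := by
    rintro y hy rfl
    rw [norm_zero] at hy
    linarith
  have hD : ∀ y : R4, 1 ≤ ‖y‖ → ∀ u, ‖fderiv ℝ inversion y u‖ ≤ 3 / ‖y‖ ^ 2 * ‖u‖ := fun y hy u ↦
    (ContinuousLinearMap.le_opNorm _ _).trans
      (mul_le_mul_of_nonneg_right (norm_fderiv_inversion_le (hy0 y hy)) (norm_nonneg _))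
  have conj : ∀ (g g' : SU2) (x : W →L[ℝ] W) (m : ℝ), 0 ≤ m → ‖x‖ ≤ m →
      ‖ρ.toHom g * (x * ρ.toHom g')‖ ≤ r * (m * r) := fun g g' x m hm hx ↦
    (norm_mul_le _ _).trans (mul_le_mul (hr _) ((norm_mul_le _ _).trans
      (mul_le_mul hx (hr _) (norm_nonneg _) hm)) (norm_nonneg _) hr0)
  -- The bound 3/‖y‖² for the derivative of the inversion enters once for the 1-form and twice,
  -- giving 9, for the curvature; each r bounds one side of the conjugation by ρ.
  refine ⟨max (r * (c * 3 * r)) (r * (c * 9 * r)), fun y hy ↦ ?_, fun y hy i j ↦ ?_⟩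
  · have hyp : 0 < ‖y‖ := by linarith
    refine ContinuousLinearMap.opNorm_le_bound _
      (div_nonneg (le_max_of_le_left (by positivity)) (by positivity)) fun u ↦ ?_
    rw [sub_apply, h y (hy0 y hy), ρ.gaugeTransform_gauge (hy0 y hy), add_sub_cancel_left]
    have h1 : ‖A' (inversion y) (fderiv ℝ inversion y u)‖ ≤ c * (3 / ‖y‖ ^ 2 * ‖u‖) :=
      (ContinuousLinearMap.le_opNorm _ _).trans (mul_le_mul
        (hc _ (hz y hy)).1 (hD y hy u) (norm_nonneg _) hc0)
    refine (conj _ _ _ _ (by positivity) h1).trans ?_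
    calc r * (c * (3 / ‖y‖ ^ 2 * ‖u‖) * r) = r * (c * 3 * r) / ‖y‖ ^ 2 * ‖u‖ := by field_simp
      _ ≤ _ := by gcongr; exact le_max_left _ _
  · have hyp : 0 < ‖y‖ := by linarith
    have e : A =ᶠ[𝓝 y] gaugeTransform ρ.gauge
        (fun x ↦ (A' (inversion x)).comp (fderiv ℝ inversion x)) := by
      filter_upwards [isOpen_ne.mem_nhds (hy0 y hy)] with z hz using h z hz
    have sm := contDiffAt_inversion (hy0 y hy)
    have hB : ContDiffAt ℝ ∞ (fun x ↦ (A' (inversion x)).comp (fderiv ℝ inversion x)) y :=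
      ContDiffAt.clm_comp (hA'.contDiffAt.comp y sm) (sm.fderiv_right (by simp))
    have h2 := mul_curv_gaugeTransform (ρ.isUnit_gauge y) (ρ.contDiffAt_gauge (hy0 y hy)) hB
      (stdVec i) (stdVec j)
    have h3 : curv A y (stdVec i) (stdVec j) = ρ.toHom (unitQuat (toQuat y)) *
        (curv A' (inversion y) (fderiv ℝ inversion y (stdVec i)) (fderiv ℝ inversion y (stdVec j)) *
          ρ.gauge y) := by
      rw [← curv_comp ((hA'.differentiable (by simp)) _) sm, ← h2, ← inverse_gauge, ← mul_assoc,
        Ring.inverse_mul_cancel _ (ρ.isUnit_gauge y), one_mul, curv_congr e]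
    rw [h3]
    have h4 : ‖curv A' (inversion y) (fderiv ℝ inversion y (stdVec i))
        (fderiv ℝ inversion y (stdVec j))‖ ≤ c * ((3 / ‖y‖ ^ 2) * (3 / ‖y‖ ^ 2)) := by
      have h5 (i : Fin 4) : ‖fderiv ℝ inversion y (stdVec i)‖ ≤ 3 / ‖y‖ ^ 2 := by
        simpa [norm_stdVec] using hD y hy (stdVec i)
      exact ((hc _ (hz y hy)).2 _ _).trans (mul_le_mul_of_nonneg_left (mul_le_mul (h5 i) (h5 j)
        (norm_nonneg _) (by positivity)) hc0)
    refine (conj _ _ _ _ (by positivity) h4).trans ?_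
    calc r * (c * (3 / ‖y‖ ^ 2 * (3 / ‖y‖ ^ 2)) * r) = r * (c * 9 * r) / ‖y‖ ^ 4 := by
          field_simp
          ring
      _ ≤ _ := by gcongr; exact le_max_right _ _

/-! ### The complex trace and the Chern integrand. -/

section ComplexTrace

theorem complexTrace_conj {V W : Type*} [AddCommGroup V] [Module ℝ V] [AddCommGroup W] [Module ℝ W]
    (e : W →ₗ[ℝ] V) (he : Function.Bijective e) {J A : W →ₗ[ℝ] W} {J' A' : V →ₗ[ℝ] V}
    (hJ : ∀ w, e (J w) = J' (e w)) (hA : ∀ w, e (A w) = A' (e w)) :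
    complexTrace J' A' = complexTrace J A := by
  set E := LinearEquiv.ofBijective e he
  have hA' : A' = E.conj A := by
    ext v
    obtain ⟨w, rfl⟩ := E.surjective v
    rw [LinearEquiv.conj_apply_apply, LinearEquiv.symm_apply_apply]
    exact (hA w).symm
  have hJ' : J' ∘ₗ A' = E.conj (J ∘ₗ A) := by
    ext v
    obtain ⟨w, rfl⟩ := E.surjective v
    rw [LinearEquiv.conj_apply_apply, LinearEquiv.symm_apply_apply]
    exact (congrArg J' (hA w)).symm.trans (hJ (A w)).symm
  rw [complexTrace, complexTrace, hJ', hA', LinearMap.trace_conj', LinearMap.trace_conj']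

variable {W : Type*} [NormedAddCommGroup W] [NormedSpace ℝ W]

/-- The algebra of endomorphisms which commute with `J`. -/
abbrev Commutant (J : W →L[ℝ] W) : Subalgebra ℝ (W →L[ℝ] W) := Subalgebra.centralizer ℝ {J}

theorem mem_commutant {J a : W →L[ℝ] W} : a ∈ Commutant J ↔ J * a = a * J := by
  simp [Subalgebra.mem_centralizer_iff]

/-- The inclusion of the commutant. -/
def commutantVal (J : W →L[ℝ] W) : Commutant J →L[ℝ] (W →L[ℝ] W) :=
  ⟨(Commutant J).val.toLinearMap, continuous_subtype_val⟩

variable [FiniteDimensional ℝ W]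

/-- The projection onto the commutant of a complex structure. -/
def commutantProj (J : W →L[ℝ] W) (hJ : J * J = -1) : (W →L[ℝ] W) →L[ℝ] Commutant J :=
  LinearMap.toContinuousLinearMap
    { toFun := fun a ↦ ⟨(2⁻¹ : ℝ) • (a - J * a * J), by
        rw [mem_commutant, mul_smul_comm, smul_mul_assoc, mul_sub, sub_mul, ← mul_assoc, ← mul_assoc,
          hJ, mul_assoc (J * a) J J, hJ]
        congr 1
        noncomm_ring⟩
      map_add' := fun a b ↦ Subtype.ext (by
        change (2⁻¹ : ℝ) • (a + b - J * (a + b) * J) =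
          (2⁻¹ : ℝ) • (a - J * a * J) + (2⁻¹ : ℝ) • (b - J * b * J)
        rw [← smul_add]
        congr 1
        noncomm_ring)
      map_smul' := fun c a ↦ Subtype.ext (by
        change (2⁻¹ : ℝ) • (c • a - J * (c • a) * J) = c • (2⁻¹ : ℝ) • (a - J * a * J)
        rw [smul_comm c, mul_smul_comm, smul_mul_assoc, smul_sub c]) }

theorem commutantProj_coe {J : W →L[ℝ] W} (hJ : J * J = -1) {a : W →L[ℝ] W} (ha : J * a = a * J) :
    (commutantProj J hJ a : W →L[ℝ] W) = a := by
  change (2⁻¹ : ℝ) • (a - J * a * J) = a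
  rw [ha, mul_assoc, hJ, mul_neg_one, sub_neg_eq_add, ← two_smul ℝ a, smul_smul,
    inv_mul_cancel₀ two_ne_zero, one_smul]

/-- The complex trace as a linear function on all endomorphisms. -/
def complexTraceCLM (J : W →L[ℝ] W) : (W →L[ℝ] W) →L[ℝ] ℂ :=
  LinearMap.toContinuousLinearMap
    { toFun := fun a ↦ complexTrace (J : W →ₗ[ℝ] W) (a : W →ₗ[ℝ] W)
      map_add' := fun a b ↦ by
        rw [complexTrace, complexTrace, complexTrace, ContinuousLinearMap.toLinearMap_add,
          LinearMap.comp_add, map_add, map_add]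
        apply Complex.ext <;> simp <;> ring
      map_smul' := fun c a ↦ by
        rw [complexTrace, complexTrace, ContinuousLinearMap.toLinearMap_smul, LinearMap.comp_smul,
          map_smul, map_smul]
        apply Complex.ext <;> simp <;> ring }

theorem complexTraceCLM_apply (J a : W →L[ℝ] W) :
    complexTraceCLM J a = complexTrace (J : W →ₗ[ℝ] W) (a : W →ₗ[ℝ] W) := rfl

/-- If a commutes with J, then J a b = a (J b), and the real trace is cyclic. For two arbitrary
endomorphisms this argument is not available, which is why the residue formula is applied in the
algebra `Commutant J`. -/
theorem complexTraceCLM_mul_comm {J a : W →L[ℝ] W} (ha : J * a = a * J) (b : W →L[ℝ] W) :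
    complexTraceCLM J (a * b) = complexTraceCLM J (b * a) := by
  have h1 : LinearMap.trace ℝ W ((a * b : W →L[ℝ] W) : W →ₗ[ℝ] W) =
      LinearMap.trace ℝ W ((b * a : W →L[ℝ] W) : W →ₗ[ℝ] W) :=
    LinearMap.trace_mul_comm ℝ (a : W →ₗ[ℝ] W) (b : W →ₗ[ℝ] W)
  have h2 : LinearMap.trace ℝ W ((J : W →ₗ[ℝ] W) ∘ₗ ((a * b : W →L[ℝ] W) : W →ₗ[ℝ] W)) =
      LinearMap.trace ℝ W ((J : W →ₗ[ℝ] W) ∘ₗ ((b * a : W →L[ℝ] W) : W →ₗ[ℝ] W)) := by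
    have e : (J : W →ₗ[ℝ] W) ∘ₗ ((a * b : W →L[ℝ] W) : W →ₗ[ℝ] W) =
        (a : W →ₗ[ℝ] W) * ((J * b : W →L[ℝ] W) : W →ₗ[ℝ] W) := by
      ext w
      exact congrArg (fun f : W →L[ℝ] W ↦ f (b w)) ha
    rw [e, LinearMap.trace_mul_comm]
    rfl
  rw [complexTraceCLM_apply, complexTraceCLM_apply, complexTrace, complexTrace, h1, h2]

/-- The complex trace on the commutant of the complex structure. -/
def commutantTrace (J : W →L[ℝ] W) : Commutant J →L[ℝ] ℂ :=
  (complexTraceCLM J).comp (commutantVal J)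

theorem commutantTrace_mul_comm {J : W →L[ℝ] W} (a b : Commutant J) :
    commutantTrace J (a * b) = commutantTrace J (b * a) :=
  complexTraceCLM_mul_comm (mem_commutant.1 a.2) b.1

theorem tripleTrace_complex (l : ℍ[ℝ] →L[ℝ] ℂ) : tripleTrace (ContinuousLinearMap.id ℝ ℂ) l = 0 := by
  rw [tripleTrace, mul_comm (l quatK), sub_self]

/-- The values on the standard basis of `tr (F ∧ F) - tr F ∧ tr F`, up to normalization. -/
def chernIntegrand (tr : (W →L[ℝ] W) → ℂ) (A : R4 → R4 →L[ℝ] W →L[ℝ] W) (y : R4) : ℂ :=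
  ∑ s : Equiv.Perm (Fin 4), ((s.sign : ℤ) : ℂ) *
    (tr (curv A y (stdVec (s 0)) (stdVec (s 1)) * curv A y (stdVec (s 2)) (stdVec (s 3))) -
      tr (curv A y (stdVec (s 0)) (stdVec (s 1))) * tr (curv A y (stdVec (s 2)) (stdVec (s 3))))

theorem SmoothRep.commute_liftDeriv (ρ : SmoothRep W) {J : W →L[ℝ] W}
    (hρ : ∀ g, J * ρ.toHom g = ρ.toHom g * J) (q : ℍ[ℝ]) :
    J * ρ.liftDeriv q = ρ.liftDeriv q * J := by
  have h1 := (ContinuousLinearMap.mul ℝ (W →L[ℝ] W) J).hasFDerivAt.comp (1 : ℍ[ℝ])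
    ρ.hasFDerivAt_radialExt_one
  have h2 := ((ContinuousLinearMap.mul ℝ (W →L[ℝ] W)).flip J).hasFDerivAt.comp (1 : ℍ[ℝ])
    ρ.hasFDerivAt_radialExt_one
  have e : (ContinuousLinearMap.mul ℝ (W →L[ℝ] W) J) ∘ ρ.radialExt =
      ((ContinuousLinearMap.mul ℝ (W →L[ℝ] W)).flip J) ∘ ρ.radialExt := by
    funext q
    exact hρ _
  rw [e] at h1
  exact congrArg (fun L ↦ L q) (h1.unique h2)

/-- The residue formula is applied twice: to the trace on `Commutant J`, and to the scalar form tr A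
with values in ℂ. The second residue vanishes because ℂ is commutative, so tr F ∧ tr F integrates to
zero. -/
theorem integral_chernIntegrand_of_asymptotic (ρ : SmoothRep W) {J : W →L[ℝ] W} (hJ : J * J = -1)
    (hρ : ∀ g, J * ρ.toHom g = ρ.toHom g * J) {A : R4 → R4 →L[ℝ] W →L[ℝ] W}
    (hA : ContDiff ℝ ∞ A) (hAJ : ∀ y u, J * A y u = A y u * J) {C : ℝ}
    (hθ : ∀ y, 1 ≤ ‖y‖ → ‖A y - modelForm ρ.liftDeriv y‖ ≤ C / ‖y‖ ^ 2)
    (hc : ∀ y, 1 ≤ ‖y‖ → ∀ i j, ‖curv A y (stdVec i) (stdVec j)‖ ≤ C / ‖y‖ ^ 4) :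
    ∫ y, chernIntegrand (complexTraceCLM J) A y =
      -(cutoffConst * tripleTrace (complexTraceCLM J) ρ.liftDeriv) := by
  have dA (y) : DifferentiableAt ℝ A y := hA.differentiable (by simp) y
  set pr := commutantProj J hJ
  set τ := commutantTrace J
  set A' : R4 → R4 →L[ℝ] Commutant J := fun y ↦ pr.comp (A y) with hA'
  set l' : ℍ[ℝ] →L[ℝ] Commutant J := pr.comp ρ.liftDeriv with hl'
  have sA' : ContDiff ℝ ∞ A' := contDiff_const.clm_comp hA
  have cA' (y u v) : curv A' y u v = pr (curv A y u v) := by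
    refine curv_map pr (dA y) u v (Subtype.ext ?_)
    have h1 := hAJ y u
    have h2 := hAJ y v
    rw [commutantProj_coe]
    · change _ = (pr (A y u) : W →L[ℝ] W) * (pr (A y v) : W →L[ℝ] W) -
        (pr (A y v) : W →L[ℝ] W) * (pr (A y u) : W →L[ℝ] W)
      rw [commutantProj_coe hJ h1, commutantProj_coe hJ h2]
    · rw [mul_sub, sub_mul, ← mul_assoc, h1, mul_assoc, h2, ← mul_assoc, ← mul_assoc, h2,
        mul_assoc (A y v), h1, ← mul_assoc]
  have vA' (y u v) : ((curv A' y u v : Commutant J) : W →L[ℝ] W) = curv A y u v := by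
    have e : (fun y ↦ (commutantVal J).comp (A' y)) = A := by
      funext y
      ext1 u
      exact commutantProj_coe hJ (hAJ y u)
    have := curv_map (commutantVal J) (sA'.differentiable (by simp) y) u v rfl
    rw [e] at this
    exact this.symm
  have mA' (y) : modelForm l' y = pr.comp (modelForm ρ.liftDeriv y) := by
    ext1 u
    change _ = pr (modelForm ρ.liftDeriv y u)
    rw [modelForm_apply, modelForm_apply, map_smul]
    rfl
  have sub (y) : A' y - modelForm l' y = pr.comp (A y - modelForm ρ.liftDeriv y) := by
    rw [mA', ContinuousLinearMap.comp_sub]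
  have b1 : ∀ y, 1 ≤ ‖y‖ → ‖A' y - modelForm l' y‖ ≤ (‖pr‖ * C) / ‖y‖ ^ 2 := fun y hy ↦ by
    rw [sub, mul_div_assoc]
    exact (ContinuousLinearMap.opNorm_comp_le _ _).trans
      (mul_le_mul_of_nonneg_left (hθ y hy) (norm_nonneg pr))
  have b2 : ∀ y, 1 ≤ ‖y‖ → ∀ i j, ‖curv A' y (stdVec i) (stdVec j)‖ ≤ (‖pr‖ * C) / ‖y‖ ^ 4 :=
    fun y hy i j ↦ by
      rw [cA', mul_div_assoc]
      exact (pr.le_opNorm _).trans (mul_le_mul_of_nonneg_left (hc y hy i j) (norm_nonneg pr))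
  have hl1 : l' 1 = 0 := by
    rw [hl', ContinuousLinearMap.comp_apply, ρ.liftDeriv_one, map_zero]
  obtain ⟨i1, e1⟩ := integral_traceSq_of_asymptotic τ commutantTrace_mul_comm l' hl1 sA' b1 b2
  -- the trace part
  set a : R4 → R4 →L[ℝ] ℂ := fun y ↦ τ.comp (A' y) with ha
  have sa : ContDiff ℝ ∞ a := contDiff_const.clm_comp sA'
  have ca (y u v) : curv a y u v = τ (curv A' y u v) := by
    refine curv_map τ (sA'.differentiable (by simp) y) u v ?_
    rw [map_sub, commutantTrace_mul_comm, sub_self, mul_comm, sub_self]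
  have ma (y) : modelForm (τ.comp l') y = τ.comp (modelForm l' y) := by
    ext1 u
    change _ = τ (modelForm l' y u)
    rw [modelForm_apply, modelForm_apply, map_smul]
    rfl
  have b3 : ∀ y, 1 ≤ ‖y‖ → ‖a y - modelForm (τ.comp l') y‖ ≤ (‖τ‖ * (‖pr‖ * C)) / ‖y‖ ^ 2 :=
    fun y hy ↦ by
      have e : a y - modelForm (τ.comp l') y = τ.comp (A' y - modelForm l' y) := by
        rw [ma, ContinuousLinearMap.comp_sub]
      rw [e, mul_div_assoc]
      exact (ContinuousLinearMap.opNorm_comp_le _ _).trans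
        (mul_le_mul_of_nonneg_left (b1 y hy) (norm_nonneg τ))
  have b4 : ∀ y, 1 ≤ ‖y‖ → ∀ i j, ‖curv a y (stdVec i) (stdVec j)‖ ≤
      (‖τ‖ * (‖pr‖ * C)) / ‖y‖ ^ 4 := fun y hy i j ↦ by
    rw [ca, mul_div_assoc]
    exact (τ.le_opNorm _).trans (mul_le_mul_of_nonneg_left (b2 y hy i j) (norm_nonneg τ))
  obtain ⟨i2, e2⟩ := integral_traceSq_of_asymptotic (ContinuousLinearMap.id ℝ ℂ)
    (fun x y ↦ mul_comm _ _) (τ.comp l') (by rw [ContinuousLinearMap.comp_apply, hl1, map_zero])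
    sa b3 b4
  rw [tripleTrace_complex, mul_zero, neg_zero] at e2
  have key : ∀ y, chernIntegrand (complexTraceCLM J) A y =
      traceSq τ A' y - traceSq (ContinuousLinearMap.id ℝ ℂ) a y := fun y ↦ by
    rw [chernIntegrand, traceSq, traceSq, ← Finset.sum_sub_distrib]
    refine Finset.sum_congr rfl fun s _ ↦ ?_
    rw [ca, ca, ← smul_sub, zsmul_eq_mul, ← vA', ← vA']
    rfl
  have T : tripleTrace τ l' = tripleTrace (complexTraceCLM J) ρ.liftDeriv := by
    have h (q) : (l' q : W →L[ℝ] W) = ρ.liftDeriv q :=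
      commutantProj_coe hJ (ρ.commute_liftDeriv hρ q)
    rw [tripleTrace, tripleTrace, ← h, ← h, ← h]
    rfl
  rw [integral_congr_ae (Filter.Eventually.of_forall key), integral_sub i1 i2, e1, e2, T, sub_zero]

end ComplexTrace

/-! ### The second Chern form in a frame along a map. -/

section Along

variable {E : Type*} [NormedAddCommGroup E] [NormedSpace ℝ E] [FiniteDimensional ℝ E]
  {B : Type*} [TopologicalSpace B] [ChartedSpace E B] [IsManifold 𝓘(ℝ, E) ∞ B] [T2Space B]
  {F : Type*} [NormedAddCommGroup F] [NormedSpace ℝ F] [FiniteDimensional ℝ F]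
  {V : B → Type*} [TopologicalSpace (TotalSpace F V)]
  [∀ x, AddCommGroup (V x)] [∀ x, Module ℝ (V x)] [∀ x, TopologicalSpace (V x)]
  [∀ x, IsTopologicalAddGroup (V x)] [∀ x, ContinuousSMul ℝ (V x)]
  [FiberBundle F V] [VectorBundle ℝ F V] [ContMDiffVectorBundle ∞ F V 𝓘(ℝ, E)]

theorem connAlong_congr_frame {Y : Type*} [NormedAddCommGroup Y] [NormedSpace ℝ Y]
    (cov : CovariantDerivative 𝓘(ℝ, E) F V) {f : Y → B} {φ φ' : Π y, F →L[ℝ] V (f y)} {y : Y}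
    (h : ∀ᶠ z in 𝓝 y, φ z = φ' z) : connAlong cov f φ y = connAlong cov f φ' y := by
  refine gaugeTransform_congr ?_ rfl
  filter_upwards [h] with z hz
  rw [gaugeCoord, gaugeCoord, hz]

/-- The frame is given over the base, since frames along f and along f' take values in different
fibre types. -/
theorem connAlong_congr_map {Y : Type*} [NormedAddCommGroup Y] [NormedSpace ℝ Y]
    (cov : CovariantDerivative 𝓘(ℝ, E) F V) {f f' : Y → B} (Φ : Π b, F →L[ℝ] V b) {y : Y}
    (h : f =ᶠ[𝓝 y] f') :
    connAlong cov f (fun z ↦ Φ (f z)) y = connAlong cov f' (fun z ↦ Φ (f' z)) y := by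
  have h0 := h.self_of_nhds
  rw [connAlong, connAlong, h0]
  refine gaugeTransform_congr ?_ ?_
  · filter_upwards [h] with z hz
    rw [gaugeCoord, gaugeCoord, hz]
  · have e : (extChartAt 𝓘(ℝ, E) (f' y) ∘ f) =ᶠ[𝓝 y] (extChartAt 𝓘(ℝ, E) (f' y) ∘ f') := by
      filter_upwards [h] with z hz
      exact congrArg _ hz
    rw [pullbackForm, pullbackForm, e.fderiv_eq, h0]

/-- The isomorphism φ y carries K to J and `curv` to `curvature`, and the complex trace is invariant
under conjugation. K has to represent J only at the point y. -/
theorem secondChernForm_eq_chernIntegrand {J : Π x : B, V x →L[ℝ] V x}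
    (D : ComplexConnection 𝓘(ℝ, E) F J) {f : R4 → B} {φ : Π y, F →L[ℝ] V (f y)} {y : R4}
    (h : ∀ᶠ z in 𝓝 y, IsGaugeAt (E := E) f φ z) {K : F →L[ℝ] F}
    (hK : ∀ w, φ y (K w) = J (f y) (φ y w)) :
    D.secondChernForm (f y) (fun i ↦ mfderiv 𝓘(ℝ, R4) 𝓘(ℝ, E) f y (stdVec i)) =
      (1 / (8 * (Real.pi : ℂ) ^ 2)) *
        ((1 / 4) * chernIntegrand (complexTraceCLM K) (connAlong D.cov f φ) y) := by
  rw [ComplexConnection.secondChernForm, chernIntegrand]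
  have c := fun i j ↦ curv_connAlong D.cov D.smooth h (stdVec i) (stdVec j)
  have hb : Function.Bijective (φ y : F →ₗ[ℝ] V (f y)) := h.self_of_nhds.bijective
  have h1 (i j k l : Fin 4) := complexTrace_conj (φ y : F →ₗ[ℝ] V (f y)) hb
    (J := (K : F →ₗ[ℝ] F)) (J' := (J (f y) : V (f y) →ₗ[ℝ] V (f y)))
    (A := (curv (connAlong D.cov f φ) y (stdVec i) (stdVec j) *
      curv (connAlong D.cov f φ) y (stdVec k) (stdVec l) : F →L[ℝ] F))
    (A' := curvature D.cov D.smooth (f y) (mfderiv 𝓘(ℝ, R4) 𝓘(ℝ, E) f y (stdVec i))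
      (mfderiv 𝓘(ℝ, R4) 𝓘(ℝ, E) f y (stdVec j)) ∘ₗ
      curvature D.cov D.smooth (f y) (mfderiv 𝓘(ℝ, R4) 𝓘(ℝ, E) f y (stdVec k))
      (mfderiv 𝓘(ℝ, R4) 𝓘(ℝ, E) f y (stdVec l))) hK
    (fun w ↦ (c i j _).trans (congrArg _ (c k l w)))
  have h2 (i j : Fin 4) := complexTrace_conj (φ y : F →ₗ[ℝ] V (f y)) hb
    (J := (K : F →ₗ[ℝ] F)) (J' := (J (f y) : V (f y) →ₗ[ℝ] V (f y)))
    (A := (curv (connAlong D.cov f φ) y (stdVec i) (stdVec j) : F →L[ℝ] F))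
    (A' := curvature D.cov D.smooth (f y) (mfderiv 𝓘(ℝ, R4) 𝓘(ℝ, E) f y (stdVec i))
      (mfderiv 𝓘(ℝ, R4) 𝓘(ℝ, E) f y (stdVec j))) hK (c i j)
  refine congrArg _ (congrArg _ (Finset.sum_congr rfl fun s _ ↦ ?_))
  rw [complexTraceCLM_apply, complexTraceCLM_apply, complexTraceCLM_apply, ← h1, ← h2, ← h2]

end Along

/-! ### Stereographic charts at the two poles. -/

section Stereographic

theorem contMDiff_inverseStereographic : ContMDiff (𝓡 4) (𝓡 4) ∞ inverseStereographic := by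
  have : Fact (Module.finrank ℝ (EuclideanSpace ℝ (Fin 5)) = 4 + 1) := ⟨by simp⟩
  have hn : ContDiff ℝ ∞ fun y : R4 ↦ ‖y‖ ^ 2 := contDiff_norm_sq ℝ
  have h0 (y : R4) : 1 + ‖y‖ ^ 2 ≠ 0 := by positivity
  have hc (i : Fin 4) : ContDiff ℝ ∞ fun y : R4 ↦ y i := contDiff_euclidean.1 contDiff_id i
  have h : ContDiff ℝ ∞ fun y : R4 ↦ (inverseStereographic y).1 := by
    refine contDiff_euclidean.2 fun i ↦ ?_
    fin_cases i
    · exact (contDiff_const.mul (hc 0)).div (contDiff_const.add hn) h0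
    · exact (contDiff_const.mul (hc 1)).div (contDiff_const.add hn) h0
    · exact (contDiff_const.mul (hc 2)).div (contDiff_const.add hn) h0
    · exact (contDiff_const.mul (hc 3)).div (contDiff_const.add hn) h0
    · exact (contDiff_const.sub hn).div (contDiff_const.add hn) h0
  exact h.contMDiff.codRestrict_sphere (n := 4) (fun y ↦ (inverseStereographic y).2)

/-- The reflection of `S⁴` which exchanges the poles. -/
def poleReflection (b : S4) : S4 :=
  ⟨!₂[b.1 0, b.1 1, b.1 2, b.1 3, -b.1 4], by
    have hb : ‖b.1‖ ^ 2 = 1 := by simp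
    rw [EuclideanSpace.norm_sq_eq] at hb
    rw [mem_sphere_zero_iff_norm, ← sq_eq_sq₀ (norm_nonneg _) zero_le_one,
      EuclideanSpace.norm_sq_eq, one_pow]
    refine Eq.trans ?_ hb
    simp [Fin.sum_univ_five]⟩

theorem contMDiff_poleReflection : ContMDiff (𝓡 4) (𝓡 4) ∞ poleReflection := by
  have : Fact (Module.finrank ℝ (EuclideanSpace ℝ (Fin 5)) = 4 + 1) := ⟨by simp⟩
  have hc (i : Fin 5) : ContDiff ℝ ∞ fun y : EuclideanSpace ℝ (Fin 5) ↦ y i :=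
    contDiff_euclidean.1 contDiff_id i
  have h : ContDiff ℝ ∞ fun b : EuclideanSpace ℝ (Fin 5) ↦
      (!₂[b 0, b 1, b 2, b 3, -b 4] : EuclideanSpace ℝ (Fin 5)) := by
    refine contDiff_euclidean.2 fun i ↦ ?_
    fin_cases i
    · exact hc 0
    · exact hc 1
    · exact hc 2
    · exact hc 3
    · exact (hc 4).neg
  exact (h.contMDiff.comp contMDiff_coe_sphere).codRestrict_sphere (n := 4)
    (fun b ↦ (poleReflection b).2)

/-- The charts at the two poles differ by inversion, so behaviour at infinity in one chart becomes
smoothness at the origin in the other. -/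
theorem inverseStereographic_eq_poleReflection {y : R4} (hy : y ≠ 0) :
    inverseStereographic y = poleReflection (inverseStereographic (inversion y)) := by
  have hn : ‖y‖ ≠ 0 := norm_ne_zero_iff.2 hy
  have h0 : 1 + ‖y‖ ^ 2 ≠ 0 := by positivity
  have h1 : 1 + (‖y‖⁻¹) ^ 2 ≠ 0 := by positivity
  have hi (i : Fin 4) : inversion y i = (‖y‖ ^ 2)⁻¹ * y i := rfl
  have h2 (c : ℝ) : 2 * c / (1 + ‖y‖ ^ 2) = 2 * ((‖y‖ ^ 2)⁻¹ * c) / (1 + (‖y‖⁻¹) ^ 2) := by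
    field_simp
    ring
  refine Subtype.ext (PiLp.ext fun i ↦ ?_)
  fin_cases i
  · change _ = 2 * inversion y 0 / (1 + ‖inversion y‖ ^ 2)
    rw [hi, norm_inversion, ← h2]
    rfl
  · change _ = 2 * inversion y 1 / (1 + ‖inversion y‖ ^ 2)
    rw [hi, norm_inversion, ← h2]
    rfl
  · change _ = 2 * inversion y 2 / (1 + ‖inversion y‖ ^ 2)
    rw [hi, norm_inversion, ← h2]
    rfl
  · change _ = 2 * inversion y 3 / (1 + ‖inversion y‖ ^ 2)
    rw [hi, norm_inversion, ← h2]
    rfl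
  · change (1 - ‖y‖ ^ 2) / (1 + ‖y‖ ^ 2) = -((1 - ‖inversion y‖ ^ 2) / (1 + ‖inversion y‖ ^ 2))
    rw [norm_inversion]
    field_simp
    ring

theorem quaternionPart_inverseStereographic (y : R4) :
    quaternionPart (inverseStereographic y) = (2 / (1 + ‖y‖ ^ 2)) • toQuat y := by
  have h (c : ℝ) : 2 * c / (1 + ‖y‖ ^ 2) = 2 / (1 + ‖y‖ ^ 2) * c := by ring
  ext
  · exact h (y 0)
  · exact h (y 1)
  · exact h (y 2)
  · exact h (y 3)

theorem toEquator_inverseStereographic (y : R4) :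
    toEquator (inverseStereographic y) = unitQuat (toQuat y) := by
  rw [toEquator_eq, quaternionPart_inverseStereographic, unitQuat_smul (by positivity)]

theorem inverseStereographic_mem_poleComplement (y : R4) :
    inverseStereographic y ∈ poleComplement true := by
  change (1 - ‖y‖ ^ 2) / (1 + ‖y‖ ^ 2) ≠ -1
  have h0 : 1 + ‖y‖ ^ 2 ≠ 0 := by positivity
  rw [Ne, div_eq_iff h0]
  intro h
  linarith

theorem poleReflection_mem_poleComplement {b : S4} (hb : b ∈ poleComplement true) :
    poleReflection b ∈ poleComplement false := fun h ↦ hb (neg_eq_iff_eq_neg.1 h)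

end Stereographic

/-! ### The second Chern number of an associated bundle. -/

namespace SmoothRep

variable {W : Type*} [NormedAddCommGroup W] [NormedSpace ℝ W] [FiniteDimensional ℝ W]
  (ρ : SmoothRep W)

/-- The frame of the associated bundle over the complement of a pole. -/
def frame (i : Bool) (b : S4) : W →L[ℝ] ρ.AssociatedBundle b :=
  ρ.bundleCore.coordChange i (ρ.bundleCore.indexAt b) b

instance (i : Bool) : MemTrivializationAtlas (F := W) (E := ρ.AssociatedBundle)
    (ρ.bundleCore.localTriv i) :=
  ⟨i, rfl⟩

theorem frame_true {b : S4} (h1 : b ∈ poleComplement true) (h2 : b ∈ poleComplement false) :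
    ρ.frame true b = (ρ.frame false b).comp (ρ.toHom (toEquator b)⁻¹) := by
  ext w
  exact (ρ.bundleCore.coordChange_comp true false (ρ.bundleCore.indexAt b) b
    ⟨⟨h1, h2⟩, ρ.bundleCore.mem_baseSet_at b⟩ w).symm

theorem bijective_frame (i : Bool) (b : S4) : Function.Bijective (ρ.frame i b) :=
  ContinuousLinearMap.isUnit_iff_bijective.1 (ρ.isUnit_toHom _)

theorem isGaugeAt_frame {Y : Type*} [NormedAddCommGroup Y] [NormedSpace ℝ Y] {i : Bool}
    {f : Y → S4} {y : Y} (hf : ContMDiffAt 𝓘(ℝ, Y) (𝓡 4) ∞ f y) (hy : f y ∈ poleComplement i) :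
    IsGaugeAt (E := EuclideanSpace ℝ (Fin 4)) f (fun z ↦ ρ.frame i (f z)) y where
  contMDiffAt := hf
  contMDiffAt_frame w := by
    refine ((ρ.bundleCore.localTriv i).contMDiffAt_iff (IB := 𝓡 4)
      (f := fun z ↦ (⟨f z, ρ.frame i (f z) w⟩ : TotalSpace W ρ.AssociatedBundle)) (x₀ := y)
      ((ρ.bundleCore.mem_localTriv_source i
        (⟨f y, ρ.frame i (f y) w⟩ : TotalSpace W ρ.AssociatedBundle)).2 hy)).2 ⟨hf, (contMDiffAt_const (c := w)).congr_of_eventuallyEq ?_⟩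
    filter_upwards [hf.continuousAt.preimage_mem_nhds ((isOpen_poleComplement i).mem_nhds hy)]
      with z hz
    refine (ρ.bundleCore.coordChange_comp i (ρ.bundleCore.indexAt (f z)) i (f z)
      ⟨⟨hz, ρ.bundleCore.mem_baseSet_at _⟩, hz⟩ w).trans ?_
    exact ρ.bundleCore.coordChange_self i (f z) hz w
  bijective := ρ.bijective_frame i _

variable {J : W →L[ℝ] W}

/-- The coordinate changes are values of ρ and commute with J, so J is the same constant matrix in
each trivialization. -/
theorem mdifferentiableAt_inducedEndomorphism (hρ : ∀ g, J * ρ.toHom g = ρ.toHom g * J) (b : S4) :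
    MDifferentiableAt (𝓡 4) 𝓘(ℝ, W →L[ℝ] W)
      (fun z ↦ (toFib W b z).comp
        ((ρ.inducedEndomorphism J z).comp (fromFib W ρ.AssociatedBundle b z))) b := by
  refine (mdifferentiableAt_const (c := J)).congr_of_eventuallyEq ?_
  filter_upwards [(trivializationAt W ρ.AssociatedBundle b).open_baseSet.mem_nhds
    (mem_baseSet_trivializationAt W ρ.AssociatedBundle b)] with z hz
  have h : toFib (V := ρ.AssociatedBundle) W b z = (ρ.bundleCore.coordChange (ρ.bundleCore.indexAt z)
      (ρ.bundleCore.indexAt b) z : W →L[ℝ] W) :=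
    ρ.bundleCore.localTriv_continuousLinearMapAt (i := ρ.bundleCore.indexAt b) hz
  ext w
  refine Eq.trans ?_ (congrArg J (toFib_fromFib hz w))
  change toFib (V := ρ.AssociatedBundle) W b z
    (ρ.inducedEndomorphism J z (fromFib W ρ.AssociatedBundle b z w)) = _
  rw [h]
  exact congrArg (fun L : W →L[ℝ] W ↦ L (fromFib W ρ.AssociatedBundle b z w)) (hρ _).symm

/-- The frame off one pole is smooth on all of ℝ⁴ and off the origin equals the other frame times
`ρ.gauge`. Whatever the connection, its form is therefore asymptotic to the model of `ρ.liftDeriv`,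
and the residue formula applies. -/
theorem integralS4_secondChernForm (hJ : J * J = -1) (hρ : ∀ g, J * ρ.toHom g = ρ.toHom g * J)
    (D : ComplexConnection (𝓡 4) W (ρ.inducedEndomorphism J)) :
    integralS4 D.secondChernForm = (1 / (8 * (Real.pi : ℂ) ^ 2)) *
      ((1 / 4) * -(cutoffConst * tripleTrace (complexTraceCLM J) ρ.liftDeriv)) := by
  have : CompleteSpace W := FiniteDimensional.complete ℝ W
  let f : R4 → S4 := inverseStereographic
  let f' : R4 → S4 := poleReflection ∘ inverseStereographic
  have sf : ContMDiff 𝓘(ℝ, R4) (𝓡 4) ∞ f := contMDiff_inverseStereographic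
  have sf' : ContMDiff 𝓘(ℝ, R4) (𝓡 4) ∞ f' :=
    contMDiff_poleReflection.comp contMDiff_inverseStereographic
  have mf (y) : f y ∈ poleComplement true := inverseStereographic_mem_poleComplement y
  have mf' (y) : f' y ∈ poleComplement false := poleReflection_mem_poleComplement (mf y)
  have g (y) := ρ.isGaugeAt_frame (sf y) (mf y)
  have g' (y) := ρ.isGaugeAt_frame (sf' y) (mf' y)
  set A := connAlong D.cov f (fun z ↦ ρ.frame true (f z)) with hAdef
  set A' := connAlong D.cov f' (fun z ↦ ρ.frame false (f' z)) with hAdef'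
  have sA : ContDiff ℝ ∞ A := contDiff_iff_contDiffAt.2 fun y ↦
    contDiffAt_connAlong D.cov D.smooth (Filter.Eventually.of_forall g)
  have sA' : ContDiff ℝ ∞ A' := contDiff_iff_contDiffAt.2 fun y ↦
    contDiffAt_connAlong D.cov D.smooth (Filter.Eventually.of_forall g')
  have hff (y) (hy : y ≠ 0) : f y = (f' ∘ inversion) y := inverseStereographic_eq_poleReflection hy
  have hcomm (i : Bool) (b : S4) (w : W) :
      ρ.frame i b (J w) = ρ.inducedEndomorphism J b (ρ.frame i b w) :=
    congrArg (fun L : W →L[ℝ] W ↦ L w) (hρ _).symm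
  -- In this frame the complex structure is the constant J, so its parallelism reads 0 = [J, A].
  have hAJ (y u) : J * A y u = A y u * J := by
    have h := (fderiv_complexStructure D (ρ.mdifferentiableAt_inducedEndomorphism hρ (f y)) (g y)
      (K := fun _ ↦ J) (Filter.Eventually.of_forall fun z w ↦ hcomm true (f z) w) u).2
    rw [fderiv_const_apply, zero_apply] at h
    exact (sub_eq_zero.1 h.symm)
  have hch (y) (hy : y ≠ 0) : A y = gaugeTransform ρ.gauge
      (fun x ↦ (A' (inversion x)).comp (fderiv ℝ inversion x)) y := by
    have e1 : A y = connAlong D.cov f (fun z ↦ (ρ.frame false (f z)).comp (ρ.gauge z)) y := by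
      refine connAlong_congr_frame D.cov ?_
      filter_upwards [isOpen_ne.mem_nhds hy] with z hz
      have h1 : f z ∈ poleComplement false := by
        rw [hff z hz]
        exact mf' _
      rw [ρ.frame_true (mf z) h1, toEquator_inverseStereographic]
      rfl
    have h1 : f y ∈ poleComplement false := by
      rw [hff y hy]
      exact mf' _
    rw [e1, connAlong_mul D.cov (ρ.isGaugeAt_frame (sf y) h1) (ρ.isUnit_gauge y)
      ((ρ.contDiffAt_gauge hy).differentiableAt (by simp))]
    refine gaugeTransform_congr Filter.EventuallyEq.rfl ?_
    have e2 : f =ᶠ[𝓝 y] f' ∘ inversion := by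
      filter_upwards [isOpen_ne.mem_nhds hy] with z hz using hff z hz
    have e3 := connAlong_comp D.cov (f := f') (φ := fun z ↦ ρ.frame false (f' z))
      (z := inversion) (x := y) (g' (inversion y))
      ((contDiffAt_inversion hy).differentiableAt (by simp))
    exact (connAlong_congr_map D.cov (ρ.frame false) e2).trans e3
  obtain ⟨C, hθ, hc⟩ := ρ.exists_asymptotic_bound sA' hch
  have key (y : R4) : D.secondChernForm (f y) (fun i ↦ mfderiv 𝓘(ℝ, R4) (𝓡 4) f y (stdVec i)) =
      (1 / (8 * (Real.pi : ℂ) ^ 2)) * ((1 / 4) * chernIntegrand (complexTraceCLM J) A y) :=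
    secondChernForm_eq_chernIntegrand D (Filter.Eventually.of_forall g) (hcomm true (f y))
  rw [← integral_chernIntegrand_of_asymptotic ρ hJ hρ sA hAJ hθ hc, ← integral_const_mul,
    ← integral_const_mul]
  exact integral_congr_ae (Filter.Eventually.of_forall key)

end SmoothRep

/-! ### Operations on frames along a map. -/

section Gauges

variable {E : Type*} [NormedAddCommGroup E] [NormedSpace ℝ E] [FiniteDimensional ℝ E]
  {B : Type*} [TopologicalSpace B] [ChartedSpace E B] [IsManifold 𝓘(ℝ, E) ∞ B] [T2Space B]
  {F : Type*} [NormedAddCommGroup F] [NormedSpace ℝ F] [FiniteDimensional ℝ F]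
  {V : B → Type*} [TopologicalSpace (TotalSpace F V)]
  [∀ x, AddCommGroup (V x)] [∀ x, Module ℝ (V x)] [∀ x, TopologicalSpace (V x)]
  [∀ x, IsTopologicalAddGroup (V x)] [∀ x, ContinuousSMul ℝ (V x)]
  [FiberBundle F V] [VectorBundle ℝ F V] [ContMDiffVectorBundle ∞ F V 𝓘(ℝ, E)]
  {Y : Type*} [NormedAddCommGroup Y] [NormedSpace ℝ Y] {f : Y → B} {φ : Π y, F →L[ℝ] V (f y)}
  {y : Y}

theorem IsGaugeAt.comp {Z : Type*} [NormedAddCommGroup Z] [NormedSpace ℝ Z] {z : Z → Y} {x : Z}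
    (h : IsGaugeAt (E := E) f φ (z x)) (hz : ContDiffAt ℝ ∞ z x) :
    IsGaugeAt (E := E) (f ∘ z) (fun x ↦ φ (z x)) x where
  contMDiffAt := h.contMDiffAt.comp x hz.contMDiffAt
  contMDiffAt_frame w := (h.contMDiffAt_frame w).comp x hz.contMDiffAt
  bijective := h.bijective

theorem IsGaugeAt.mul_const (h : IsGaugeAt (E := E) f φ y) {k : F →L[ℝ] F} (hk : IsUnit k) :
    IsGaugeAt (E := E) f (fun z ↦ (φ z).comp k) y where
  contMDiffAt := h.contMDiffAt
  contMDiffAt_frame w := h.contMDiffAt_frame (k w)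
  bijective := by
    have : CompleteSpace F := FiniteDimensional.complete ℝ F
    exact h.bijective.comp (ContinuousLinearMap.isUnit_iff_bijective.1 hk)

end Gauges

/-! ### Framed paths in a connected manifold. -/

section FramedPaths

variable {E : Type*} [NormedAddCommGroup E] [NormedSpace ℝ E] [FiniteDimensional ℝ E]
  {M : Type*} [TopologicalSpace M] [ChartedSpace E M] [IsManifold 𝓘(ℝ, E) ∞ M] [T2Space M]
  {Y : Type*} [NormedAddCommGroup Y] [NormedSpace ℝ Y]

/-- The model space as the tangent space at `x`. -/
def tangentFrame (x : M) (L : E →L[ℝ] E) : E →L[ℝ] TangentSpace 𝓘(ℝ, E) x := L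

/-- The isomorphisms `P` identify the trivial bundle smoothly with the tangent bundle along `f`. -/
abbrev IsTangentGaugeAt (f : Y → M) (P : Y → E →L[ℝ] E) (y : Y) : Prop :=
  IsGaugeAt (E := E) (V := TangentSpace 𝓘(ℝ, E)) f (fun z ↦ tangentFrame (f z) (P z)) y

theorem IsTangentGaugeAt.congr {f f' : Y → M} {P P' : Y → E →L[ℝ] E} {y : Y}
    (h : IsTangentGaugeAt f P y) (hf : f' =ᶠ[𝓝 y] f) (hP : P' =ᶠ[𝓝 y] P) :
    IsTangentGaugeAt f' P' y where
  contMDiffAt := h.contMDiffAt.congr_of_eventuallyEq hf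
  contMDiffAt_frame w := by
    refine (h.contMDiffAt_frame w).congr_of_eventuallyEq ?_
    filter_upwards [hf, hP] with z h1 h2
    rw [h1, h2]
  bijective := by
    have := h.bijective
    rw [tangentFrame] at this ⊢
    rw [hP.self_of_nhds]
    exact this

/-- There is a smooth framed path from `x` to `y` which is constant near its ends. -/
def FramedJoined (x y : M) : Prop :=
  ∃ (γ : ℝ → M) (P : ℝ → E →L[ℝ] E) (T : ℝ), 0 ≤ T ∧ (∀ t, IsTangentGaugeAt γ P t) ∧
    (∀ t ≤ 0, γ t = x ∧ P t = P 0) ∧ ∀ t, T ≤ t → γ t = y ∧ P t = P T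

theorem FramedJoined.symm {x y : M} (h : FramedJoined (E := E) x y) :
    FramedJoined (E := E) y x := by
  obtain ⟨γ, P, T, hT, hg, h0, h1⟩ := h
  refine ⟨fun t ↦ γ (T - t), fun t ↦ P (T - t), T, hT, fun t ↦ ?_, fun t ht ↦ ?_, fun t ht ↦ ?_⟩
  · exact IsGaugeAt.comp (z := fun t ↦ T - t) (hg (T - t))
      (contDiff_const.sub contDiff_id).contDiffAt
  · simpa using h1 (T - t) (by linarith)
  · simpa using h0 (T - t) (by linarith)

theorem FramedJoined.trans {x y z : M} (h : FramedJoined (E := E) x y)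
    (h' : FramedJoined (E := E) y z) : FramedJoined (E := E) x z := by
  have : CompleteSpace E := FiniteDimensional.complete ℝ E
  obtain ⟨γ, P, T, hT, hg, h0, h1⟩ := h
  obtain ⟨γ', P', T', hT', hg', h0', h1'⟩ := h'
  have hu (t) : IsUnit (P t) := ContinuousLinearMap.isUnit_iff_bijective.2 (hg t).bijective
  have hu' (t) : IsUnit (P' t) := ContinuousLinearMap.isUnit_iff_bijective.2 (hg' t).bijective
  -- Multiplication by k makes the second frame start where the first one ends.
  set k := Ring.inverse (P' 0) * P T with hk
  have hku : IsUnit k := (hu' 0).ringInverse.mul (hu T)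
  have hPk : P' 0 * k = P T := by rw [hk, ← mul_assoc, Ring.mul_inverse_cancel _ (hu' 0), one_mul]
  -- The second path is delayed by T + 2, so both framed paths are constant and agree on (T, T + 2);
  -- switching at T + 1 is then smooth.
  have gl (t : ℝ) (ht : T < t) (ht' : t < T + 2) :
      γ t = γ' (t - (T + 2)) ∧ P t = P' (t - (T + 2)) * k := by
    obtain ⟨a, b⟩ := h1 t ht.le
    obtain ⟨c, d⟩ := h0' (t - (T + 2)) (by linarith)
    rw [a, b, c, d, hPk]
    exact ⟨rfl, rfl⟩
  refine ⟨fun t ↦ if t < T + 1 then γ t else γ' (t - (T + 2)),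
    fun t ↦ if t < T + 1 then P t else P' (t - (T + 2)) * k, T' + (T + 2), by linarith,
    fun t ↦ ?_, fun t ht ↦ ?_, fun t ht ↦ ?_⟩
  · rcases lt_or_ge t (T + 1) with ht | ht
    · refine (hg t).congr ?_ ?_ <;>
      · filter_upwards [gt_mem_nhds ht] with s hs
        rw [if_pos hs]
    · have hc : IsTangentGaugeAt (fun t ↦ γ' (t - (T + 2))) (fun t ↦ P' (t - (T + 2)) * k) t :=
        (IsGaugeAt.comp (z := fun t ↦ t - (T + 2)) (hg' (t - (T + 2)))
          (contDiff_id.sub contDiff_const).contDiffAt).mul_const hku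
      refine hc.congr ?_ ?_
      · filter_upwards [lt_mem_nhds (show T < t by linarith)] with s hs
        split_ifs with h
        · exact (gl s hs (by linarith)).1
        · rfl
      · filter_upwards [lt_mem_nhds (show T < t by linarith)] with s hs
        split_ifs with h
        · exact (gl s hs (by linarith)).2
        · rfl
  · beta_reduce
    rw [if_pos (by linarith), if_pos (by linarith), if_pos (by linarith)]
    exact h0 t ht
  · beta_reduce
    rw [if_neg (by linarith), if_neg (by linarith), if_neg (by linarith), add_sub_cancel_right]
    obtain ⟨a, b⟩ := h1' (t - (T + 2)) (by linarith)
    exact ⟨a, by rw [b]⟩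

/-- A straight segment in the chart at x, traversed with `Real.smoothTransition` so that it rests at
both ends, and framed by the trivialization at x. -/
theorem eventually_framedJoined (x : M) : ∀ᶠ y in 𝓝 x, FramedJoined (E := E) x y := by
  set e := chartAt E x
  have hx : x ∈ e.source := mem_chart_source E x
  obtain ⟨r, hr, hball⟩ := Metric.isOpen_iff.1 e.open_target (e x) (e.map_source hx)
  filter_upwards [e.open_source.mem_nhds hx,
    (e.continuousAt hx).preimage_mem_nhds (Metric.ball_mem_nhds (e x) hr)] with y hy hyr
  let c : ℝ → E := fun t ↦ e x + Real.smoothTransition t • (e y - e x)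
  have hc : ContDiff ℝ ∞ c := contDiff_const.add
    ((Real.smoothTransition.contDiff (n := ⊤)).of_le (by simp) |>.smul contDiff_const)
  have hct (t) : c t ∈ e.target := by
    refine hball ?_
    rw [mem_ball_iff_norm, add_sub_cancel_left, norm_smul,
      Real.norm_of_nonneg (Real.smoothTransition.nonneg t)]
    exact (mul_le_of_le_one_left (norm_nonneg _) (Real.smoothTransition.le_one t)).trans_lt
      (mem_ball_iff_norm.1 hyr)
  have hγ (t) : e.symm (c t) ∈ e.source := e.map_target (hct t)
  have hγ' (t) : e.symm (c t) ∈ (trivializationAt E (TangentSpace 𝓘(ℝ, E)) x).baseSet := hγ t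
  have hs : ContMDiff 𝓘(ℝ, ℝ) 𝓘(ℝ, E) ∞ fun t ↦ e.symm (c t) := fun t ↦
    ((contMDiffOn_chart_symm (I := 𝓘(ℝ, E)) (x := x) (n := ∞)).contMDiffAt
      (e.open_target.mem_nhds (hct t))).comp t hc.contDiffAt.contMDiffAt
  have e0 (t : ℝ) (ht : t ≤ 0) : e.symm (c t) = x := by
    simp only [c, Real.smoothTransition.zero_of_nonpos ht, zero_smul, add_zero]
    exact e.left_inv hx
  have e1 (t : ℝ) (ht : 1 ≤ t) : e.symm (c t) = y := by
    simp only [c, Real.smoothTransition.one_of_one_le ht, one_smul, add_sub_cancel]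
    exact e.left_inv hy
  let Q : M → E →L[ℝ] E := fun z ↦ fromFib E (TangentSpace 𝓘(ℝ, E)) x z
  refine ⟨fun t ↦ e.symm (c t), fun t ↦ Q (e.symm (c t)), 1,
    zero_le_one, fun t ↦ ⟨hs t, fun w ↦ ?_, ?_⟩, fun t ht ↦ ⟨e0 t ht, ?_⟩, fun t ht ↦ ⟨e1 t ht, ?_⟩⟩
  · exact (contMDiffAt_fromFib (E := E) (V := TangentSpace 𝓘(ℝ, E)) le_rfl (hγ' t) w).comp t (hs t)
  · exact Function.bijective_iff_has_inverse.2
      ⟨toFib E x (e.symm (c t)), toFib_fromFib (hγ' t), fromFib_toFib (hγ' t)⟩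
  · exact congrArg Q ((e0 t ht).trans (e0 0 le_rfl).symm)
  · exact congrArg Q ((e1 t ht).trans (e1 1 le_rfl).symm)

/-- Being joined by a framed path is an equivalence relation with open classes, so connectedness
leaves a single class. -/
theorem framedJoined [ConnectedSpace M] (x y : M) : FramedJoined (E := E) x y := by
  have h : IsClopen {y | FramedJoined (E := E) x y} := by
    constructor
    · rw [← isOpen_compl_iff, isOpen_iff_mem_nhds]
      intro y hy
      filter_upwards [eventually_framedJoined (E := E) y] with z hz hxz
      exact hy (FramedJoined.trans hxz hz.symm)
    · rw [isOpen_iff_mem_nhds]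
      intro y hy
      filter_upwards [eventually_framedJoined (E := E) y] with z hz
      exact FramedJoined.trans hy hz
  have := h.eq_univ ⟨x, (eventually_framedJoined (E := E) x).self_of_nhds⟩
  exact Set.eq_univ_iff_forall.1 this y

/-- A smooth framed path defined on the line, constant outside of `[-1/2, 1/2]`. -/
theorem exists_framedPath [ConnectedSpace M] (x₁ x₂ : M) :
    ∃ (γ : ℝ → M) (P : ℝ → E →L[ℝ] E) (P₁ P₂ : E →L[ℝ] E), IsUnit P₁ ∧ IsUnit P₂ ∧
      (∀ t, IsTangentGaugeAt γ P t) ∧ (∀ t, 1 / 2 ≤ t → γ t = x₁ ∧ P t = P₁) ∧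
      ∀ t ≤ -(1 / 2), γ t = x₂ ∧ P t = P₂ := by
  have : CompleteSpace E := FiniteDimensional.complete ℝ E
  obtain ⟨γ, P, T, hT, hg, h0, h1⟩ := framedJoined (E := E) x₂ x₁
  have hu (t) : IsUnit (P t) := ContinuousLinearMap.isUnit_iff_bijective.2 (hg t).bijective
  refine ⟨fun t ↦ γ (T * (t + 1 / 2)), fun t ↦ P (T * (t + 1 / 2)), P T, P 0, hu T, hu 0,
    fun t ↦ ?_, fun t ht ↦ ?_, fun t ht ↦ ?_⟩
  · exact IsGaugeAt.comp (z := fun t ↦ T * (t + 1 / 2)) (hg (T * (t + 1 / 2)))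
      (contDiff_const.mul (contDiff_id.add contDiff_const)).contDiffAt
  · exact h1 _ (by nlinarith)
  · exact h0 _ (by nlinarith)

end FramedPaths

/-! ### Traces of curvature as closed 2-forms. -/

section ClosedTraceForms

variable {𝒜 : Type*} [NormedRing 𝒜] [NormedAlgebra ℝ 𝒜]

/-- The Bianchi identity. -/
theorem bianchi {A : R4 → R4 →L[ℝ] 𝒜} {y : R4} (dA : ContDiffAt ℝ ∞ A y) (u v w : R4) :
    fderiv ℝ (fun z ↦ curv A z v w) y u - fderiv ℝ (fun z ↦ curv A z u w) y v +
      fderiv ℝ (fun z ↦ curv A z u v) y w =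
    (curv A y v w * A y u - A y u * curv A y v w) - (curv A y u w * A y v - A y v * curv A y u w) +
      (curv A y u v * A y w - A y w * curv A y u v) := by
  have s (p q r : R4) : fderiv ℝ (fderiv ℝ A) y p q r = fderiv ℝ (fderiv ℝ A) y q p r :=
    congrArg (fun L ↦ L r) ((dA.isSymmSndFDerivAt two_le_infty).eq p q)
  rw [fderiv_curv dA, fderiv_curv dA, fderiv_curv dA, s v u w, s w u v, s w v u]
  unfold curv
  noncomm_ring

/-- The value of a traced curvature form on the standard basis, extended by zero to the origin. -/
def traceForm (t : 𝒜 →L[ℝ] ℝ) (K : R4 → 𝒜) (A : R4 → R4 →L[ℝ] 𝒜) (i j : Fin 4) (y : R4) : ℝ :=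
  Set.indicator {0}ᶜ (fun y ↦ t (K y * curv A y (stdVec i) (stdVec j))) y

/-- The value of `β ∧ β` on the standard basis, up to normalization. -/
def wedgeSq (β : Fin 4 → Fin 4 → R4 → ℝ) (y : R4) : ℝ :=
  β 0 1 y * β 2 3 y - β 0 2 y * β 1 3 y + β 0 3 y * β 1 2 y

variable {t : 𝒜 →L[ℝ] ℝ} {K : R4 → 𝒜} {A : R4 → R4 →L[ℝ] 𝒜}

theorem traceForm_of_ne {y : R4} (hy : y ≠ 0) (i j : Fin 4) :
    traceForm t K A i j y = t (K y * curv A y (stdVec i) (stdVec j)) :=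
  Set.indicator_of_mem hy _

theorem traceForm_eventuallyEq {y : R4} (hy : y ≠ 0) (i j : Fin 4) :
    traceForm t K A i j =ᶠ[𝓝 y] fun z ↦ t (K z * curv A z (stdVec i) (stdVec j)) := by
  filter_upwards [isOpen_ne.mem_nhds hy] with z hz using traceForm_of_ne hz i j

variable {a b : ℝ}

/-- Flatness near the origin makes the extension by zero smooth there, although A itself may be
singular. -/
theorem traceForm_eventuallyEq_zero (ha : 0 < a)
    (h₁ : ∀ y ≠ 0, ‖y‖ < a → ∀ u v, curv A y u v = 0) (i j : Fin 4) :
    traceForm t K A i j =ᶠ[𝓝 0] 0 := by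
  filter_upwards [Metric.ball_mem_nhds (0 : R4) ha] with z hz
  by_cases h : z = 0
  · simp [traceForm, h]
  · rw [traceForm_of_ne h, h₁ z h (mem_ball_zero_iff.1 hz), mul_zero, map_zero]
    rfl

theorem contDiff_traceForm (hA : ∀ y ≠ 0, ContDiffAt ℝ ∞ A y) (hK : ∀ y ≠ 0, ContDiffAt ℝ ∞ K y)
    (ha : 0 < a) (h₁ : ∀ y ≠ 0, ‖y‖ < a → ∀ u v, curv A y u v = 0) (i j : Fin 4) :
    ContDiff ℝ ∞ (traceForm t K A i j) := by
  refine contDiff_iff_contDiffAt.2 fun y ↦ ?_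
  by_cases hy : y = 0
  · rw [hy]
    exact contDiffAt_const.congr_of_eventuallyEq (traceForm_eventuallyEq_zero ha h₁ i j)
  · exact (t.contDiff.contDiffAt.comp y ((hK y hy).mul
      (contDiffAt_curv (hA y hy) _ _))).congr_of_eventuallyEq (traceForm_eventuallyEq hy i j)

theorem hasCompactSupport_traceForm (h₂ : ∀ y ≠ 0, b < ‖y‖ → ∀ u v, curv A y u v = 0)
    (i j : Fin 4) : HasCompactSupport (traceForm t K A i j) := by
  refine HasCompactSupport.intro (isCompact_closedBall (0 : R4) b) fun y hy ↦ ?_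
  by_cases h : y = 0
  · simp [traceForm, h]
  · rw [traceForm_of_ne h, h₂ y h (by simpa using hy), mul_zero, map_zero]

/-- Insert the Bianchi identity and dK = [K, A] into d tr(K F): for each direction the result is the
trace of a commutator of K F with A. -/
theorem traceForm_closed (ht : ∀ x y, t (x * y) = t (y * x))
    (hA : ∀ y ≠ 0, ContDiffAt ℝ ∞ A y) (hK : ∀ y ≠ 0, ContDiffAt ℝ ∞ K y)
    (dK : ∀ y ≠ 0, ∀ u, fderiv ℝ K y u = K y * A y u - A y u * K y)
    (ha : 0 < a) (h₁ : ∀ y ≠ 0, ‖y‖ < a → ∀ u v, curv A y u v = 0) (i j k : Fin 4) (y : R4) :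
    fderiv ℝ (traceForm t K A j k) y (stdVec i) - fderiv ℝ (traceForm t K A i k) y (stdVec j) +
      fderiv ℝ (traceForm t K A i j) y (stdVec k) = 0 := by
  by_cases hy : y = 0
  · rw [hy, (traceForm_eventuallyEq_zero ha h₁ j k).fderiv_eq,
      (traceForm_eventuallyEq_zero ha h₁ i k).fderiv_eq,
      (traceForm_eventuallyEq_zero ha h₁ i j).fderiv_eq]
    simp
  have dF (u v : R4) : DifferentiableAt ℝ (fun z ↦ curv A z u v) y :=
    (contDiffAt_curv (hA y hy) u v).differentiableAt (by simp)
  have dK' : DifferentiableAt ℝ K y := (hK y hy).differentiableAt (by simp)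
  have e (p q r : Fin 4) : fderiv ℝ (traceForm t K A p q) y (stdVec r) =
      t ((K y * A y (stdVec r) - A y (stdVec r) * K y) * curv A y (stdVec p) (stdVec q) +
        K y * fderiv ℝ (fun z ↦ curv A z (stdVec p) (stdVec q)) y (stdVec r)) := by
    rw [(traceForm_eventuallyEq hy p q).fderiv_eq, ← dK y hy,
      ← fderiv_mul_apply dK' (dF _ _)]
    exact congrArg (fun L ↦ L (stdVec r))
      (t.hasFDerivAt.comp y (dK'.fun_mul (dF (stdVec p) (stdVec q))).hasFDerivAt).fderiv
  have c (x m : 𝒜) : t ((K y * x - x * K y) * m + K y * (m * x - x * m)) = 0 := by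
    have : (K y * x - x * K y) * m + K y * (m * x - x * m) = (K y * m) * x - x * (K y * m) := by
      noncomm_ring
    rw [this, map_sub, ht, sub_self]
  rw [e, e, e, ← map_sub, ← map_add]
  have hb := congrArg (K y * ·) (bianchi (hA y hy) (stdVec i) (stdVec j) (stdVec k))
  simp only [mul_add, mul_sub] at hb
  have cc := congrArg₂ (· + ·) (congrArg₂ (· - ·) (c (A y (stdVec i)) (curv A y (stdVec j) (stdVec k)))
    (c (A y (stdVec j)) (curv A y (stdVec i) (stdVec k))))
    (c (A y (stdVec k)) (curv A y (stdVec i) (stdVec j)))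
  simp only [← map_sub, ← map_add, sub_zero, add_zero] at cc
  rw [← cc]
  congr 1
  simp only [mul_sub]
  rw [← sub_eq_zero] at hb ⊢
  rw [← hb]
  abel

theorem integral_wedgeSq_traceForm (ht : ∀ x y, t (x * y) = t (y * x))
    (hA : ∀ y ≠ 0, ContDiffAt ℝ ∞ A y) (hK : ∀ y ≠ 0, ContDiffAt ℝ ∞ K y)
    (dK : ∀ y ≠ 0, ∀ u, fderiv ℝ K y u = K y * A y u - A y u * K y)
    (ha : 0 < a) (h₁ : ∀ y ≠ 0, ‖y‖ < a → ∀ u v, curv A y u v = 0)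
    (h₂ : ∀ y ≠ 0, b < ‖y‖ → ∀ u v, curv A y u v = 0) :
    Integrable (wedgeSq (traceForm t K A)) ∧ ∫ y, wedgeSq (traceForm t K A) y = 0 := by
  have s := contDiff_traceForm (t := t) hA hK ha h₁
  have c := hasCompactSupport_traceForm (t := t) (K := K) h₂
  have m (i j k l : Fin 4) : Integrable
      (fun y ↦ traceForm t K A i j y * traceForm t K A k l y) :=
    ((s i j).continuous.mul (s k l).continuous).integrable_of_hasCompactSupport
      ((c i j).mul_right)
  exact ⟨((m 0 1 2 3).sub (m 0 2 1 3)).add (m 0 3 1 2),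
    integral_sq_closed _ s c (traceForm_closed ht hA hK dK ha h₁)⟩

end ClosedTraceForms

/-! ### The real part of the Chern integrand. -/

section RealTrace

variable {W : Type*} [NormedAddCommGroup W] [NormedSpace ℝ W] [FiniteDimensional ℝ W]

/-- The trace of endomorphisms as a continuous linear function. -/
def traceCLM : (W →L[ℝ] W) →L[ℝ] ℝ :=
  LinearMap.toContinuousLinearMap
    { toFun := fun a ↦ LinearMap.trace ℝ W (a : W →ₗ[ℝ] W)
      map_add' := fun a b ↦ by rw [ContinuousLinearMap.toLinearMap_add, map_add]
      map_smul' := fun c a ↦ by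
        rw [ContinuousLinearMap.toLinearMap_smul, map_smul]
        rfl }

theorem traceCLM_mul_comm (a b : W →L[ℝ] W) : traceCLM (a * b) = traceCLM (b * a) :=
  LinearMap.trace_mul_comm ℝ (a : W →ₗ[ℝ] W) (b : W →ₗ[ℝ] W)

/-- Half of the trace, as a complex number. -/
def halfTrace : (W →L[ℝ] W) →L[ℝ] ℂ := (2⁻¹ : ℝ) • Complex.ofRealCLM.comp traceCLM

theorem halfTrace_apply (a : W →L[ℝ] W) : halfTrace a = ((2⁻¹ * traceCLM a : ℝ) : ℂ) := by
  rw [Complex.ofReal_mul]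
  rfl

theorem halfTrace_mul_comm (a b : W →L[ℝ] W) : halfTrace (a * b) = halfTrace (b * a) := by
  rw [halfTrace_apply, halfTrace_apply, traceCLM_mul_comm]

theorem complexTraceCLM_eq (J a : W →L[ℝ] W) :
    complexTraceCLM J a = ⟨2⁻¹ * traceCLM a, -(2⁻¹ * traceCLM (J * a))⟩ := by
  rw [complexTraceCLM_apply, complexTrace, div_eq_inv_mul, div_eq_inv_mul]
  rfl

theorem sum_perm_traceForm {K : R4 → W →L[ℝ] W} {A : R4 → R4 →L[ℝ] W →L[ℝ] W} {y : R4}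
    (hy : y ≠ 0) : (∑ s : Equiv.Perm (Fin 4), (s.sign : ℤ) •
      ((traceCLM (K y * curv A y (stdVec (s 0)) (stdVec (s 1))) *
        traceCLM (K y * curv A y (stdVec (s 2)) (stdVec (s 3))) : ℝ) : ℂ)) =
      ((8 * wedgeSq (traceForm traceCLM K A) y : ℝ) : ℂ) := by
  let f : (W →L[ℝ] W) →+ ℂ := AddMonoidHom.mk' (fun a ↦ ((traceCLM (K y * a) : ℝ) : ℂ))
    fun a b ↦ by rw [mul_add, map_add, Complex.ofReal_add]
  have h := sum_perm_alternating (B := curv A y) (fun u v ↦ curv_swap A y u v)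
    ((AddMonoidHom.mul.comp f).compl₂ f) (fun a b ↦ mul_comm _ _)
  simp only [wedgeSq, traceForm_of_ne hy]
  push_cast
  refine Eq.trans (Finset.sum_congr rfl fun s _ ↦ ?_) h
  rfl

/-- The complex trace is ½ tr F - (i/2) tr(K F), so the real part of its square is ¼ (tr F)² - ¼ (tr
K F)². The eight equal terms of the permutation sum turn ¼ into 2. -/
theorem re_chernIntegrand {K : R4 → W →L[ℝ] W} {A : R4 → R4 →L[ℝ] W →L[ℝ] W} {y : R4}
    (hy : y ≠ 0) : (chernIntegrand (complexTraceCLM (K y)) A y).re =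
      (traceSq halfTrace A y).re - 2 * wedgeSq (traceForm traceCLM (fun _ ↦ 1) A) y +
        2 * wedgeSq (traceForm traceCLM K A) y := by
  have h1 := congrArg Complex.re (sum_perm_traceForm (K := fun _ ↦ 1) (A := A) hy)
  have h2 := congrArg Complex.re (sum_perm_traceForm (K := K) (A := A) hy)
  rw [Complex.re_sum, Complex.ofReal_re] at h1 h2
  rw [show ∀ p q r : ℝ, p - 2 * q + 2 * r = p - 4⁻¹ * (8 * q) + 4⁻¹ * (8 * r) by intros; ring,
    ← h1, ← h2, chernIntegrand, traceSq, Complex.re_sum, Complex.re_sum, Finset.mul_sum,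
    Finset.mul_sum, ← Finset.sum_sub_distrib, ← Finset.sum_add_distrib]
  refine Finset.sum_congr rfl fun s _ ↦ ?_
  simp only [complexTraceCLM_eq, halfTrace_apply, zsmul_eq_mul, one_mul]
  simp
  ring

end RealTrace

/-! ### Chern integrals on ℝ⁴ ∖ 0 with flat ends. -/

section Annulus

variable {W : Type*} [NormedAddCommGroup W] [NormedSpace ℝ W] [FiniteDimensional ℝ W]
  {K : R4 → W →L[ℝ] W} {A : R4 → R4 →L[ℝ] W →L[ℝ] W}

theorem continuousAt_complexTraceCLM {X : R4 → W →L[ℝ] W} {y : R4} (hK : ContinuousAt K y)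
    (hX : ContinuousAt X y) : ContinuousAt (fun z ↦ complexTraceCLM (K z) (X z)) y := by
  simp only [complexTraceCLM_eq, Complex.mk_eq_add_mul_I]
  have h1 : ContinuousAt (fun z ↦ traceCLM (X z)) y := traceCLM.continuous.continuousAt.comp hX
  have h2 : ContinuousAt (fun z ↦ traceCLM (K z * X z)) y :=
    ContinuousAt.comp (g := (traceCLM : (W →L[ℝ] W) →L[ℝ] ℝ)) traceCLM.continuous.continuousAt
      (hK.mul hX)
  exact (Complex.continuous_ofReal.continuousAt.comp (continuousAt_const.mul h1)).add
    ((Complex.continuous_ofReal.continuousAt.comp (continuousAt_const.mul h2).neg).mul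
      continuousAt_const)

theorem continuousAt_chernIntegrand {y : R4} (hA : ContDiffAt ℝ ∞ A y) (hK : ContinuousAt K y) :
    ContinuousAt (fun z ↦ chernIntegrand (complexTraceCLM (K z)) A z) y := by
  have c (u v : R4) : ContinuousAt (fun z ↦ curv A z u v) y :=
    (contDiffAt_curv hA u v).continuousAt
  unfold chernIntegrand
  refine tendsto_finsetSum _ fun s _ ↦ ?_
  exact tendsto_const_nhds.mul ((continuousAt_complexTraceCLM hK ((c _ _).mul (c _ _))).sub
    ((continuousAt_complexTraceCLM hK (c _ _)).mul (continuousAt_complexTraceCLM hK (c _ _))))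

variable {a b : ℝ}

theorem integrable_chernIntegrand_annulus (hA : ∀ y ≠ 0, ContDiffAt ℝ ∞ A y)
    (hK : ∀ y ≠ 0, ContinuousAt K y) (ha : 0 < a)
    (h₁ : ∀ y ≠ 0, ‖y‖ < a → ∀ u v, curv A y u v = 0)
    (h₂ : ∀ y ≠ 0, b < ‖y‖ → ∀ u v, curv A y u v = 0) :
    Integrable fun y ↦ chernIntegrand (complexTraceCLM (K y)) A y := by
  set G := fun y ↦ chernIntegrand (complexTraceCLM (K y)) A y with hG
  have z (y : R4) (h : ∀ u v, curv A y u v = 0) : G y = 0 := by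
    simp only [hG, chernIntegrand, h, mul_zero, map_zero, sub_zero, Finset.sum_const_zero]
  set S : Set R4 := Metric.closedBall 0 b \ Metric.ball 0 a
  have hS : IsCompact S := (isCompact_closedBall 0 b).diff Metric.isOpen_ball
  have hS0 (y : R4) (hy : y ∈ S) : y ≠ 0 := by
    rintro rfl
    exact hy.2 (Metric.mem_ball_self ha)
  have hcont : ContinuousOn G S := fun y hy ↦
    (continuousAt_chernIntegrand (hA y (hS0 y hy)) (hK y (hS0 y hy))).continuousWithinAt
  have hi := hcont.integrableOn_compact hS (μ := volume)
  have hi2 : Integrable (S.indicator G) := (integrable_indicator_iff hS.measurableSet).2 hi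
  refine hi2.congr ?_
  filter_upwards [ae_ne_zero] with y hy
  by_cases h : y ∈ S
  · exact Set.indicator_of_mem h _
  · rw [Set.indicator_of_notMem h]
    symm
    apply z
    by_cases h' : ‖y‖ < a
    · exact h₁ y hy h'
    · refine h₂ y hy (not_le.1 fun hb ↦ h ⟨by simpa using hb, by simpa using h'⟩)

/-- The squares of the closed compactly supported forms tr F and tr(K F) integrate to zero, leaving
the residue of the real trace. Since that trace is cyclic on all endomorphisms, the frame need not
be complex linear and K may vary. -/
theorem re_integral_chernIntegrand_annulus (hA : ∀ y ≠ 0, ContDiffAt ℝ ∞ A y)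
    (hK : ∀ y ≠ 0, ContDiffAt ℝ ∞ K y)
    (dK : ∀ y ≠ 0, ∀ u, fderiv ℝ K y u = K y * A y u - A y u * K y)
    {l₁ l₂ : ℍ[ℝ] →L[ℝ] W →L[ℝ] W} (hl₁ : l₁ 1 = 0) (hl₂ : l₂ 1 = 0) (ha : 0 < a)
    (h₁ : ∀ y ≠ 0, ‖y‖ < a → A y = modelForm l₁ y ∧ ∀ u v, curv A y u v = 0)
    (h₂ : ∀ y ≠ 0, b < ‖y‖ → A y = modelForm l₂ y ∧ ∀ u v, curv A y u v = 0) :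
    (∫ y, chernIntegrand (complexTraceCLM (K y)) A y).re =
      (cutoffConst * tripleTrace halfTrace l₁ - cutoffConst * tripleTrace halfTrace l₂).re := by
  have c₁ := fun y hy h ↦ (h₁ y hy h).2
  have c₂ := fun y hy h ↦ (h₂ y hy h).2
  obtain ⟨i0, e0⟩ := integral_traceSq_annulus halfTrace halfTrace_mul_comm l₁ l₂ hl₁ hl₂ hA ha h₁ h₂
  obtain ⟨i1, e1⟩ := integral_wedgeSq_traceForm (K := fun _ ↦ 1) traceCLM_mul_comm hA
    (fun _ _ ↦ contDiffAt_const) (fun y _ u ↦ by simp) ha c₁ c₂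
  obtain ⟨i2, e2⟩ := integral_wedgeSq_traceForm traceCLM_mul_comm hA hK dK ha c₁ c₂
  have i := integrable_chernIntegrand_annulus hA (fun y hy ↦ (hK y hy).continuousAt) ha c₁ c₂
  rw [← e0]
  have r0 : (∫ y, traceSq halfTrace A y).re = ∫ y, (traceSq halfTrace A y).re :=
    (integral_re i0).symm
  have r1 : (∫ y, chernIntegrand (complexTraceCLM (K y)) A y).re =
      ∫ y, (chernIntegrand (complexTraceCLM (K y)) A y).re := (integral_re i).symm
  have i0' : Integrable fun y ↦ (traceSq halfTrace A y).re := i0.re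
  have e : (fun y ↦ (chernIntegrand (complexTraceCLM (K y)) A y).re) =ᵐ[volume] fun y ↦
      (traceSq halfTrace A y).re - 2 * wedgeSq (traceForm traceCLM (fun _ ↦ 1) A) y +
        2 * wedgeSq (traceForm traceCLM K A) y := by
    filter_upwards [ae_ne_zero] with y hy using re_chernIntegrand hy
  have i01 : Integrable fun y ↦
      (traceSq halfTrace A y).re - 2 * wedgeSq (traceForm traceCLM (fun _ ↦ 1) A) y :=
    i0'.sub (i1.const_mul 2)
  rw [r0, r1, integral_congr_ae e, integral_add i01 (i2.const_mul 2),
    integral_sub i0' (i1.const_mul 2), integral_const_mul, integral_const_mul, e1, e2]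
  ring

end Annulus

/-! ### Smoothness of the complex structure in a frame. -/

section Frames

variable {E : Type*} [NormedAddCommGroup E] [NormedSpace ℝ E] [FiniteDimensional ℝ E]
  {B : Type*} [TopologicalSpace B] [ChartedSpace E B] [IsManifold 𝓘(ℝ, E) ∞ B] [T2Space B]
  {F : Type*} [NormedAddCommGroup F] [NormedSpace ℝ F] [FiniteDimensional ℝ F]
  {V : B → Type*} [TopologicalSpace (TotalSpace F V)]
  [∀ x, AddCommGroup (V x)] [∀ x, Module ℝ (V x)] [∀ x, TopologicalSpace (V x)]
  [∀ x, IsTopologicalAddGroup (V x)] [∀ x, ContinuousSMul ℝ (V x)]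
  [FiberBundle F V] [VectorBundle ℝ F V] [ContMDiffVectorBundle ∞ F V 𝓘(ℝ, E)]
  {Y : Type*} [NormedAddCommGroup Y] [NormedSpace ℝ Y] {f : Y → B} {φ : Π y, F →L[ℝ] V (f y)}
  {y : Y}

/-- The complex structure of a bundle in a gauge is smooth. -/
theorem contDiffAt_complexStructure {J : Π x : B, V x →L[ℝ] V x}
    (hJ : ContMDiffAt 𝓘(ℝ, E) 𝓘(ℝ, F →L[ℝ] F) ∞
      (fun z ↦ (toFib F (f y) z).comp ((J z).comp (fromFib F V (f y) z))) (f y))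
    (h : IsGaugeAt (E := E) f φ y)
    {K : Y → F →L[ℝ] F} (hK : ∀ᶠ z in 𝓝 y, ∀ w, φ z (K z w) = J (f z) (φ z w)) :
    ContDiffAt ℝ ∞ K y := by
  have : CompleteSpace F := FiniteDimensional.complete ℝ F
  have hy := mem_chartDomain (E := E) (F := F) (V := V) (f y)
  have hψ := isUnit_gaugeCoord hy.1 h.bijective
  have dψ := contDiffAt_gaugeCoord h hy.1
  let JE : B → F →L[ℝ] F := fun z ↦ (toFib F (f y) z).comp ((J z).comp (fromFib F V (f y) z))
  have dJ : ContDiffAt ℝ ∞ (JE ∘ f) y := (hJ.comp y h.contMDiffAt).contDiffAt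
  have e : K =ᶠ[𝓝 y] fun z ↦ Ring.inverse (gaugeCoord (f y) f φ z) *
      ((JE ∘ f) z * gaugeCoord (f y) f φ z) := by
    filter_upwards [hK, eventually_mem_chartDomain h.contMDiffAt hy,
      isUnit_eventually hψ dψ.continuousAt] with z h1 h2 h3
    have h4 : gaugeCoord (f y) f φ z * K z = (JE ∘ f) z * gaugeCoord (f y) f φ z := by
      ext w
      change toFib F (f y) (f z) (φ z (K z w)) = toFib F (f y) (f z) (J (f z)
        (fromFib F V (f y) (f z) (toFib F (f y) (f z) (φ z w))))
      rw [fromFib_toFib h2.1, h1]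
    rw [← h4, ← mul_assoc, Ring.inverse_mul_cancel _ h3, one_mul]
  exact ((contDiffAt_inverse hψ dψ).mul (dJ.mul dψ)).congr_of_eventuallyEq e

end Frames

/-! ### Tangent frames along locally constant maps. -/

section Tangent

variable {E : Type*} [NormedAddCommGroup E] [NormedSpace ℝ E] [FiniteDimensional ℝ E]
  {M : Type*} [TopologicalSpace M] [ChartedSpace E M] [IsManifold 𝓘(ℝ, E) ∞ M] [T2Space M]
  {Y : Type*} [NormedAddCommGroup Y] [NormedSpace ℝ Y]

theorem SymplecticForm.CompatibleAlmostComplexStructure.contMDiffAt_inTangentCoordinates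
    {Ω : SymplecticForm E M} (𝒥 : Ω.CompatibleAlmostComplexStructure) (x : M) :
    ContMDiffAt 𝓘(ℝ, E) 𝓘(ℝ, E →L[ℝ] E) ∞ (fun z ↦ (toFib E x z).comp
      ((𝒥.J z).comp (fromFib E (TangentSpace 𝓘(ℝ, E)) x z))) x :=
  ((contMDiffAt_hom_bundle _).1 (𝒥.smooth x)).2

/-- The coordinates on the tangent space at `x` in the trivialization at `x`. -/
def tangentCoord (x : M) : E →L[ℝ] E := toFib (V := TangentSpace 𝓘(ℝ, E)) E x x

theorem isUnit_tangentCoord (x : M) : IsUnit (tangentCoord (E := E) x) := by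
  have : CompleteSpace E := FiniteDimensional.complete ℝ E
  exact ContinuousLinearMap.isUnit_iff_bijective.2 (toFib_bijective (F := E)
    (V := TangentSpace 𝓘(ℝ, E)) (mem_baseSet_trivializationAt E (TangentSpace 𝓘(ℝ, E)) x))

/-- A locally constant map pulls the connection form back to zero, so only the logarithmic
derivative of the frame is left. -/
theorem connAlong_tangent_const (cov : CovariantDerivative 𝓘(ℝ, E) E (TangentSpace 𝓘(ℝ, E) (M := M)))
    {f : Y → M} {Q : Y → E →L[ℝ] E} {x : M} {y : Y} (hf : ∀ᶠ z in 𝓝 y, f z = x) :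
    connAlong cov f (fun z ↦ tangentFrame (f z) (Q z)) y =
      gaugeTransform (fun z ↦ tangentCoord x * Q z) (fun _ ↦ 0) y := by
  have hy := hf.self_of_nhds
  refine gaugeTransform_congr ?_ ?_
  · filter_upwards [hf] with z hz
    rw [gaugeCoord, hy, hz]
    rfl
  · have e : (extChartAt 𝓘(ℝ, E) (f y) ∘ f) =ᶠ[𝓝 y] fun _ ↦ extChartAt 𝓘(ℝ, E) (f y) x := by
      filter_upwards [hf] with z hz
      exact congrArg _ hz
    rw [pullbackForm, e.fderiv_eq, fderiv_const_apply, ContinuousLinearMap.comp_zero]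

/-- In ψ⁻¹dψ a constant left factor cancels and a constant right factor conjugates. -/
theorem gaugeTransform_conj_gauge (ρ : SmoothRep E) {L P : E →L[ℝ] E} (hL : IsUnit L)
    (hP : IsUnit P) {y : R4} (hy : y ≠ 0) :
    gaugeTransform (fun z ↦ L * (ρ.gauge z * P)) (fun _ ↦ 0) y =
      modelForm ((ContinuousLinearMap.mul ℝ (E →L[ℝ] E) (Ring.inverse P)).comp
        (((ContinuousLinearMap.mul ℝ (E →L[ℝ] E)).flip P).comp ρ.liftDeriv)) y := by
  have : CompleteSpace E := FiniteDimensional.complete ℝ E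
  symm
  refine (gaugeTransform_eq_iff (ψ := fun z ↦ L * (ρ.gauge z * P))
    (hL.mul ((ρ.isUnit_gauge y).mul hP))).2 fun u ↦ ?_
  have d := ((ρ.contDiffAt_gauge hy).differentiableAt (by simp)).hasFDerivAt
  have h := ((ContinuousLinearMap.mul ℝ (E →L[ℝ] E) L).hasFDerivAt.comp y
    (((ContinuousLinearMap.mul ℝ (E →L[ℝ] E)).flip P).hasFDerivAt.comp y d)).fderiv
  rw [zero_apply, zero_mul, add_zero]
  refine Eq.trans ?_ (congrArg (fun D ↦ D u) h).symm
  change _ = L * (fderiv ℝ ρ.gauge y u * P)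
  rw [ρ.fderiv_gauge hy, modelForm_apply, modelForm_apply]
  change L * (ρ.gauge y * P) * ((‖y‖ ^ 2)⁻¹ • (Ring.inverse P * (ρ.liftDeriv _ * P))) = _
  rw [mul_smul_comm, mul_smul_comm, smul_mul_assoc, mul_smul_comm, mul_assoc, mul_assoc,
    ← mul_assoc P, Ring.mul_inverse_cancel _ hP, one_mul, mul_assoc]

end Tangent

/-! ### Frames moved by the group action. -/

section EquivariantFrames

variable {E : Type*} [NormedAddCommGroup E] [NormedSpace ℝ E] [FiniteDimensional ℝ E]
  {M : Type*} [TopologicalSpace M] [ChartedSpace E M] [IsManifold 𝓘(ℝ, E) ∞ M] [T2Space M]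
  [MulAction SU2 M] [ContMDiffSMul (𝓡 3) 𝓘(ℝ, E) ∞ SU2 M]
  {Y : Type*} [NormedAddCommGroup Y] [NormedSpace ℝ Y]

theorem isUnit_differentialAt (x : M) (g : SU2) : IsUnit (differentialAt (E := E) x g) := by
  have : CompleteSpace E := FiniteDimensional.complete ℝ E
  have hs (k : SU2) (z : M) : MDifferentiableAt 𝓘(ℝ, E) 𝓘(ℝ, E) (fun y : M ↦ k • y) z :=
    (contMDiff_smul_const k).mdifferentiable (by simp) z
  have h1 : differentialAt (E := E) (g • x) g⁻¹ * differentialAt (E := E) x g = 1 := by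
    have h2 : (fun y : M ↦ g⁻¹ • y) ∘ (fun y : M ↦ g • y) = id := by
      funext y
      exact inv_smul_smul g y
    have h3 := mfderiv_comp x (hs g⁻¹ (g • x)) (hs g x)
    rw [h2, mfderiv_id] at h3
    exact h3.symm
  rw [ContinuousLinearMap.isUnit_iff_bijective]
  have hi : Function.Injective (differentialAt (E := E) x g) := fun v w h ↦ by
    have e (v : E) : differentialAt (E := E) (g • x) g⁻¹ (differentialAt (E := E) x g v) = v :=
      congrArg (fun L : E →L[ℝ] E ↦ L v) h1
    rw [← e v, h, e w]
  exact ⟨hi, (LinearMap.injective_iff_surjective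
    (f := (differentialAt (E := E) x g : E →ₗ[ℝ] E))).1 hi⟩

/-- In coordinates the new frame is the old one composed with the differential of the action, which
depends smoothly on the group element and the point jointly. -/
theorem IsTangentGaugeAt.smul {f : Y → M} {P : Y → E →L[ℝ] E} {y : Y}
    (h : IsTangentGaugeAt f P y) {g : Y → SU2} (hg : ContMDiffAt 𝓘(ℝ, Y) (𝓡 3) ∞ g y) :
    IsTangentGaugeAt (fun z ↦ g z • f z) (fun z ↦ differentialAt (f z) (g z) * P z) y := by
  have : CompleteSpace E := FiniteDimensional.complete ℝ E
  have hf := h.contMDiffAt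
  have ha := contMDiff_smul (I := 𝓡 3) (I' := 𝓘(ℝ, E)) (n := ∞) (G := SU2) (M := M)
  have hgf : ContMDiffAt 𝓘(ℝ, Y) 𝓘(ℝ, E) ∞ (fun z ↦ g z • f z) y :=
    (ha (g y, f y)).comp y (hg.prodMk hf)
  refine ⟨hgf, fun w ↦ ?_, ?_⟩
  · have b0 := mem_baseSet_trivializationAt E (TangentSpace 𝓘(ℝ, E)) (g y • f y)
    have b1 := mem_baseSet_trivializationAt E (TangentSpace 𝓘(ℝ, E)) (f y)
    refine ((trivializationAt E (TangentSpace 𝓘(ℝ, E)) (g y • f y)).contMDiffAt_iff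
      (IB := 𝓘(ℝ, E)) (f := fun z ↦ (⟨g z • f z, tangentFrame (g z • f z)
        (differentialAt (f z) (g z) * P z) w⟩ : TangentBundle 𝓘(ℝ, E) M)) (x₀ := y)
      ((trivializationAt E (TangentSpace 𝓘(ℝ, E)) (g y • f y)).mem_source.2 b0)).2 ⟨hgf, ?_⟩
    have h1 := ContMDiffAt.mfderiv (I := 𝓘(ℝ, E)) (I' := 𝓘(ℝ, E)) (J := 𝓘(ℝ, Y)) (x₀ := y)
      (n := ∞) (m := ∞) (fun (z : Y) (m : M) ↦ g z • m) f
      ((ha (g y, f y)).comp (y, f y) ((hg.comp (y, f y) contMDiffAt_fst).prodMk contMDiffAt_snd))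
      hf le_rfl
    have h2 := ((trivializationAt E (TangentSpace 𝓘(ℝ, E)) (f y)).contMDiffAt_iff
      (IB := 𝓘(ℝ, E)) ((trivializationAt E (TangentSpace 𝓘(ℝ, E)) (f y)).mem_source.2 b1)).1
      (h.contMDiffAt_frame w)
    refine (h1.clm_apply h2.2).congr_of_eventuallyEq ?_
    filter_upwards [hgf.continuousAt.preimage_mem_nhds
      ((trivializationAt E (TangentSpace 𝓘(ℝ, E)) (g y • f y)).open_baseSet.mem_nhds b0),
      hf.continuousAt.preimage_mem_nhds
      ((trivializationAt E (TangentSpace 𝓘(ℝ, E)) (f y)).open_baseSet.mem_nhds b1)] with z h3 h4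
    rw [← toFib_eq h3, ← toFib_eq h4]
    change _ = toFib E (g y • f y) (g z • f z)
      (mfderiv 𝓘(ℝ, E) 𝓘(ℝ, E) (fun m : M ↦ g z • m) (f z)
        (fromFib E (TangentSpace 𝓘(ℝ, E)) (f y) (f z) (toFib E (f y) (f z) _)))
    rw [fromFib_toFib h4]
    rfl
  · have h1 := h.bijective
    exact (ContinuousLinearMap.isUnit_iff_bijective.1 (isUnit_differentialAt (E := E) (f y) (g y))).comp h1

/-- Over a fixed point the frame alone determines the form, which is a pure gauge and hence flat. -/
theorem connAlong_isotropy_end (cov : CovariantDerivative 𝓘(ℝ, E) E (TangentSpace 𝓘(ℝ, E) (M := M)))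
    {f : R4 → M} {Q : R4 → E →L[ℝ] E} {x : M} (ρ : SmoothRep E) {P : E →L[ℝ] E} (hP : IsUnit P)
    {y : R4} (hy : y ≠ 0) (h : ∀ᶠ z in 𝓝 y, f z = x ∧ Q z = ρ.gauge z * P) :
    let A := connAlong cov f (fun z ↦ tangentFrame (f z) (Q z))
    A y = modelForm ((ContinuousLinearMap.mul ℝ (E →L[ℝ] E) (Ring.inverse P)).comp
        (((ContinuousLinearMap.mul ℝ (E →L[ℝ] E)).flip P).comp ρ.liftDeriv)) y ∧
      ∀ u v, curv A y u v = 0 := by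
  have : CompleteSpace E := FiniteDimensional.complete ℝ E
  intro A
  set ψ : R4 → E →L[ℝ] E := fun z ↦ tangentCoord x * (ρ.gauge z * P) with hψ
  have hu : IsUnit (ψ y) := (isUnit_tangentCoord x).mul ((ρ.isUnit_gauge y).mul hP)
  have sψ : ContDiffAt ℝ ∞ ψ y :=
    contDiffAt_const.mul ((ρ.contDiffAt_gauge hy).mul contDiffAt_const)
  have e : A =ᶠ[𝓝 y] gaugeTransform ψ (fun _ ↦ 0) := by
    filter_upwards [eventually_eventually_nhds.2 h] with z hz
    refine (connAlong_tangent_const cov (hz.mono fun w hw ↦ hw.1)).trans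
      (gaugeTransform_congr ?_ rfl)
    filter_upwards [hz] with w hw
    rw [hψ, hw.2]
  refine ⟨e.self_of_nhds.trans (gaugeTransform_conj_gauge ρ (isUnit_tangentCoord x) hP hy),
    fun u v ↦ ?_⟩
  have h1 := mul_curv_gaugeTransform hu sψ (A := fun _ ↦ (0 : R4 →L[ℝ] E →L[ℝ] E))
    contDiffAt_const u v
  have h0 : curv (fun _ ↦ (0 : R4 →L[ℝ] E →L[ℝ] E)) y u v = 0 := by
    simp [curv]
  rw [h0, zero_mul] at h1
  rw [curv_congr e, ← one_mul (curv _ _ _ _), ← Ring.inverse_mul_cancel _ hu, mul_assoc, h1,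
    mul_zero]

theorem tripleTrace_conj {𝒜 : Type*} [NormedRing 𝒜] [NormedAlgebra ℝ 𝒜] {τ : 𝒜 →L[ℝ] ℂ}
    (hτ : ∀ x y, τ (x * y) = τ (y * x)) (l : ℍ[ℝ] →L[ℝ] 𝒜) {P : 𝒜} (hP : IsUnit P) :
    tripleTrace τ ((ContinuousLinearMap.mul ℝ 𝒜 (Ring.inverse P)).comp
      (((ContinuousLinearMap.mul ℝ 𝒜).flip P).comp l)) = tripleTrace τ l := by
  have h (a b c : 𝒜) : τ (Ring.inverse P * (a * P) * ((Ring.inverse P * (b * P)) *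
      (Ring.inverse P * (c * P)))) = τ (a * (b * c)) := by
    have : Ring.inverse P * (a * P) * ((Ring.inverse P * (b * P)) * (Ring.inverse P * (c * P))) =
        Ring.inverse P * (a * (P * Ring.inverse P) * b * (P * Ring.inverse P) * c * P) := by
      noncomm_ring
    rw [this, hτ, Ring.mul_inverse_cancel _ hP, mul_one, mul_one, mul_assoc (a * b * c),
      Ring.mul_inverse_cancel _ hP, mul_one, mul_assoc]
  exact congrArg₂ (· - ·) (h _ _ _) (h _ _ _)

end EquivariantFrames

/-! ### The sphere swept out by the orbits along a path. -/

section SphereFamily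

variable {E : Type*} [NormedAddCommGroup E] [NormedSpace ℝ E] [FiniteDimensional ℝ E]
  {M : Type*} [TopologicalSpace M] [ChartedSpace E M] [IsManifold 𝓘(ℝ, E) ∞ M] [T2Space M]
  [MulAction SU2 M] [ContMDiffSMul (𝓡 3) 𝓘(ℝ, E) ∞ SU2 M]

theorem contMDiff_height : ContMDiff (𝓡 4) 𝓘(ℝ, ℝ) ∞ fun b : S4 ↦ b.1 4 := by
  have : Fact (Module.finrank ℝ (EuclideanSpace ℝ (Fin 5)) = 4 + 1) := ⟨by simp⟩
  have hc : ContDiff ℝ ∞ fun y : EuclideanSpace ℝ (Fin 5) ↦ y 4 := contDiff_euclidean.1 contDiff_id 4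
  exact hc.contMDiff.comp contMDiff_coe_sphere

/-- The map from the sphere which sweeps out the orbits of the points of a path. -/
def orbitSphere (γ : ℝ → M) (b : S4) : M := (toEquator b)⁻¹ • γ (b.1 4)

/-- Near the poles, where `toEquator` is not smooth, the path rests at a fixed point and the map is
constant. -/
theorem contMDiff_orbitSphere {γ : ℝ → M} (hγ : ContMDiff 𝓘(ℝ, ℝ) 𝓘(ℝ, E) ∞ γ) {x₁ x₂ : M}
    (hx₁ : ∀ g : SU2, g • x₁ = x₁) (hx₂ : ∀ g : SU2, g • x₂ = x₂)
    (h₁ : ∀ t, 1 / 2 ≤ t → γ t = x₁) (h₂ : ∀ t ≤ -(1 / 2), γ t = x₂) :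
    ContMDiff (𝓡 4) 𝓘(ℝ, E) ∞ (orbitSphere γ) := by
  intro b
  have hc := (contMDiff_height b).continuousAt
  rcases lt_or_ge (1 / 2) (b.1 4) with h | h
  · refine (contMDiffAt_const (c := x₁)).congr_of_eventuallyEq ?_
    filter_upwards [hc.eventually (lt_mem_nhds h)] with z hz
    rw [orbitSphere, h₁ _ hz.le, hx₁]
  rcases lt_or_ge (b.1 4) (-(1 / 2)) with h' | h'
  · refine (contMDiffAt_const (c := x₂)).congr_of_eventuallyEq ?_
    filter_upwards [hc.eventually (gt_mem_nhds h')] with z hz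
    rw [orbitSphere, h₂ _ hz.le, hx₂]
  have hq : quaternionPart b ≠ 0 := quaternionPart_ne_zero (by linarith) (by linarith)
  have hs := (contMDiffOn_toEquator b hq).contMDiffAt
    ((isOpen_ne_fun contMDiff_quaternionPart.continuous continuous_const).mem_nhds hq)
  exact (contMDiff_smul (I := 𝓡 3) (I' := 𝓘(ℝ, E)) (n := ∞) (G := SU2) (M := M)
    ((toEquator b)⁻¹, γ (b.1 4))).comp b
    (((contMDiff_inv_SU2 _).comp b hs).prodMk ((hγ _).comp b (contMDiff_height b)))

theorem orbitSphere_inverseStereographic (γ : ℝ → M) (y : R4) :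
    orbitSphere γ (inverseStereographic y) =
      (unitQuat (toQuat y))⁻¹ • γ ((1 - ‖y‖ ^ 2) / (1 + ‖y‖ ^ 2)) := by
  rw [orbitSphere, toEquator_inverseStereographic]
  rfl

end SphereFamily

/-! ### Comparison of the isotropy representations at two fixed points. -/

section Monotone

variable {E : Type*} [NormedAddCommGroup E] [NormedSpace ℝ E] [FiniteDimensional ℝ E]
  {M : Type*} [TopologicalSpace M] [ChartedSpace E M] [IsManifold 𝓘(ℝ, E) ∞ M] [T2Space M]
  [MulAction SU2 M] [ContMDiffSMul (𝓡 3) 𝓘(ℝ, E) ∞ SU2 M]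

/-- Monotonicity is tested on the orbit sphere of a framed path; its Chern integral is a nonzero
multiple of an integral whose real part is `cutoffConst` times the difference of the two sides. -/
theorem re_tripleTrace_isotropyRep_eq [ConnectedSpace M] {Ω : SymplecticForm E M}
    (𝒥 : Ω.CompatibleAlmostComplexStructure) (D : ComplexConnection 𝓘(ℝ, E) E 𝒥.J)
    (hD : IsMonotone D.secondChernForm) {x₁ x₂ : M} (hx₁ : ∀ g : SU2, g • x₁ = x₁)
    (hx₂ : ∀ g : SU2, g • x₂ = x₂) :
    (tripleTrace halfTrace (isotropyRep (E := E) x₁ hx₁).liftDeriv).re =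
      (tripleTrace halfTrace (isotropyRep (E := E) x₂ hx₂).liftDeriv).re := by
  have : CompleteSpace E := FiniteDimensional.complete ℝ E
  obtain ⟨γ, P, P₁, P₂, hP₁, hP₂, hg, h₁, h₂⟩ := exists_framedPath (E := E) x₁ x₂
  have hγ : ContMDiff 𝓘(ℝ, ℝ) 𝓘(ℝ, E) ∞ γ := fun t ↦ (hg t).contMDiffAt
  have sf := contMDiff_orbitSphere hγ hx₁ hx₂ (fun t ht ↦ (h₁ t ht).1) (fun t ht ↦ (h₂ t ht).1)
  let F : R4 → M := fun y ↦ orbitSphere γ (inverseStereographic y)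
  let h : R4 → ℝ := fun y ↦ (1 - ‖y‖ ^ 2) / (1 + ‖y‖ ^ 2)
  let g : R4 → SU2 := fun y ↦ (unitQuat (toQuat y))⁻¹
  -- Where the path rests at a fixed point, this frame is the isotropy representation at `g y` times
  -- the constant frame of the path, that is, `gauge` times a constant.
  let Q : R4 → E →L[ℝ] E := fun y ↦ differentialAt (γ (h y)) (g y) * P (h y)
  have hn : ContDiff ℝ ∞ fun y : R4 ↦ ‖y‖ ^ 2 := contDiff_norm_sq ℝ
  have h0 (y : R4) : 1 + ‖y‖ ^ 2 ≠ 0 := by positivity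
  have sh : ContDiff ℝ ∞ h := (contDiff_const.sub hn).div (contDiff_const.add hn) h0
  have hF : F = fun y ↦ g y • γ (h y) := funext fun y ↦ orbitSphere_inverseStereographic γ y
  have sg (y : R4) (hy : y ≠ 0) : ContMDiffAt 𝓘(ℝ, R4) (𝓡 3) ∞ g y :=
    (contMDiff_inv_SU2 _).comp y ((contMDiffAt_unitQuat (toQuat_ne_zero hy)).comp y
      toQuat.contDiff.contMDiff.contMDiffAt)
  have G (y : R4) (hy : y ≠ 0) : IsTangentGaugeAt F Q y := by
    rw [hF]
    exact IsTangentGaugeAt.smul (IsGaugeAt.comp (z := h) (hg (h y)) sh.contDiffAt) (sg y hy)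
  have G' (y : R4) (hy : y ≠ 0) : ∀ᶠ z in 𝓝 y, IsTangentGaugeAt F Q z := by
    filter_upwards [isOpen_ne.mem_nhds hy] with z hz using G z hz
  set A := connAlong D.cov F (fun z ↦ tangentFrame (F z) (Q z)) with hAdef
  have sA (y : R4) (hy : y ≠ 0) : ContDiffAt ℝ ∞ A y := contDiffAt_connAlong D.cov D.smooth (G' y hy)
  let Jm : M → E →L[ℝ] E := fun x ↦ 𝒥.J x
  -- The matrix of 𝒥 in the moved frame. It varies, since neither the action nor the frame of the
  -- path is assumed to respect 𝒥.
  let K : R4 → E →L[ℝ] E := fun y ↦ Ring.inverse (Q y) * (Jm (F y) * Q y)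
  have hK (y : R4) (hy : y ≠ 0) (w : E) : tangentFrame (F y) (Q y) (K y w) =
      𝒥.J (F y) (tangentFrame (F y) (Q y) w) := by
    have hu : IsUnit (Q y) := ContinuousLinearMap.isUnit_iff_bijective.2 (G y hy).bijective
    have e : Q y * K y = Jm (F y) * Q y := by
      rw [← mul_assoc, Ring.mul_inverse_cancel _ hu, one_mul]
    exact congrArg (fun L : E →L[ℝ] E ↦ L w) e
  have hK' (y : R4) (hy : y ≠ 0) : ∀ᶠ z in 𝓝 y, ∀ w, tangentFrame (F z) (Q z) (K z w) =
      𝒥.J (F z) (tangentFrame (F z) (Q z) w) := by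
    filter_upwards [isOpen_ne.mem_nhds hy] with z hz using hK z hz
  have hJ (x : M) := 𝒥.contMDiffAt_inTangentCoordinates x
  have sK (y : R4) (hy : y ≠ 0) : ContDiffAt ℝ ∞ K y :=
    contDiffAt_complexStructure (hJ (F y)) (G y hy) (hK' y hy)
  have dK (y : R4) (hy : y ≠ 0) (u : R4) : fderiv ℝ K y u = K y * A y u - A y u * K y :=
    (fderiv_complexStructure D ((hJ (F y)).mdifferentiableAt (by simp)) (G y hy) (hK' y hy) u).2
  have end₁ (y : R4) (hy : y ≠ 0) (hya : ‖y‖ < 1 / 2) : ∀ᶠ z in 𝓝 y, F z = x₁ ∧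
      Q z = (isotropyRep (E := E) x₁ hx₁).gauge z * P₁ := by
    filter_upwards [Metric.isOpen_ball.mem_nhds (mem_ball_zero_iff.2 hya)] with z hz
    have hz' : ‖z‖ < 1 / 2 := mem_ball_zero_iff.1 hz
    -- For ‖z‖ < 1/2 the height exceeds 3/5, hence lies in the range where the path rests at x₁.
    have hh : 1 / 2 ≤ h z := by
      rw [le_div_iff₀ (by positivity)]
      nlinarith [norm_nonneg z]
    obtain ⟨e1, e2⟩ := h₁ _ hh
    refine ⟨?_, ?_⟩
    · rw [hF]
      exact (congrArg _ e1).trans (hx₁ _)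
    · change differentialAt (γ (h z)) (g z) * P (h z) = _
      rw [e1, e2]
      rfl
  have end₂ (y : R4) (hy : y ≠ 0) (hyb : 2 < ‖y‖) : ∀ᶠ z in 𝓝 y, F z = x₂ ∧
      Q z = (isotropyRep (E := E) x₂ hx₂).gauge z * P₂ := by
    filter_upwards [(isOpen_lt continuous_const continuous_norm).mem_nhds hyb] with z hz
    have hz' : 2 < ‖z‖ := hz
    have hh : h z ≤ -(1 / 2) := by
      rw [div_le_iff₀ (by positivity)]
      nlinarith [norm_nonneg z]
    obtain ⟨e1, e2⟩ := h₂ _ hh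
    refine ⟨?_, ?_⟩
    · rw [hF]
      exact (congrArg _ e1).trans (hx₂ _)
    · change differentialAt (γ (h z)) (g z) * P (h z) = _
      rw [e1, e2]
      rfl
  have l1 (ρ : SmoothRep E) (P : E →L[ℝ] E) : ((ContinuousLinearMap.mul ℝ (E →L[ℝ] E)
      (Ring.inverse P)).comp (((ContinuousLinearMap.mul ℝ (E →L[ℝ] E)).flip P).comp
        ρ.liftDeriv)) 1 = 0 := by
    change Ring.inverse P * (ρ.liftDeriv 1 * P) = 0
    rw [ρ.liftDeriv_one, zero_mul, mul_zero]
  have main := re_integral_chernIntegrand_annulus sA sK dK (l1 _ P₁) (l1 _ P₂) one_half_pos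
    (fun y hy hya ↦ connAlong_isotropy_end D.cov (isotropyRep (E := E) x₁ hx₁) hP₁ hy
      (end₁ y hy hya))
    (fun y hy hyb ↦ connAlong_isotropy_end D.cov (isotropyRep (E := E) x₂ hx₂) hP₂ hy
      (end₂ y hy hyb))
  -- The end frames P₁ and P₂ enter only by conjugation, which a trace does not see.
  rw [tripleTrace_conj halfTrace_mul_comm _ hP₁, tripleTrace_conj halfTrace_mul_comm _ hP₂] at main
  have key : ∀ᵐ y : R4, D.secondChernForm (F y) (fun i ↦ mfderiv (𝓡 4) 𝓘(ℝ, E) (orbitSphere γ)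
      (inverseStereographic y) (mfderiv (𝓡 4) (𝓡 4) inverseStereographic y (stdVec i))) =
      (1 / (8 * (Real.pi : ℂ) ^ 2)) *
        ((1 / 4) * chernIntegrand (complexTraceCLM (K y)) A y) := by
    filter_upwards [ae_ne_zero] with y hy
    rw [← secondChernForm_eq_chernIntegrand D (G' y hy) (hK y hy)]
    congr 1
    funext i
    have hc := mfderiv_comp y ((sf _).mdifferentiableAt (by simp))
      ((contMDiff_inverseStereographic y).mdifferentiableAt (by simp))
    exact (congrArg (fun L ↦ L (stdVec i)) hc).symm
  have hz : integralS4 (fun b v ↦ D.secondChernForm (orbitSphere γ b) fun i ↦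
      mfderiv (𝓡 4) 𝓘(ℝ, E) (orbitSphere γ) b (v i)) = 0 := hD _ sf
  have hz' := (integral_congr_ae key).symm.trans hz
  rw [integral_const_mul, integral_const_mul] at hz'
  have hpi : (1 / (8 * (Real.pi : ℂ) ^ 2)) ≠ 0 :=
    one_div_ne_zero (mul_ne_zero (by norm_num)
      (pow_ne_zero 2 (Complex.ofReal_ne_zero.2 Real.pi_ne_zero)))
  have hz2 := ((mul_eq_zero.1 hz').resolve_left hpi)
  have hz3 := (mul_eq_zero.1 hz2).resolve_left (by norm_num)
  rw [hz3, ← mul_sub, Complex.re_ofReal_mul, Complex.zero_re] at main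
  have := (mul_eq_zero.1 main.symm).resolve_left cutoffConst_ne_zero
  rw [Complex.sub_re] at this
  exact sub_eq_zero.1 this

end Monotone

/-! ### Reality of the triple trace of a symplectic representation. -/

section SymplecticTrace

variable {W : Type*} [NormedAddCommGroup W] [NormedSpace ℝ W] [FiniteDimensional ℝ W]

/-- An endomorphism and its adjoint with respect to a nondegenerate bilinear form have the same
trace. -/
theorem trace_eq_of_adjoint {σ : W →L[ℝ] W →L[ℝ] ℝ} (hσ : ∀ v, (∀ w, σ v w = 0) → v = 0)
    {X Y : W →L[ℝ] W} (h : ∀ v w, σ (X v) w = σ v (Y w)) : traceCLM X = traceCLM Y := by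
  let b : W →ₗ[ℝ] Module.Dual ℝ W :=
    { toFun := fun v ↦ (σ v : W →ₗ[ℝ] ℝ)
      map_add' := fun v w ↦ by
        ext u
        simp
      map_smul' := fun c v ↦ by
        ext u
        simp }
  have hi : Function.Injective b := (injective_iff_map_eq_zero b).2 fun v hv ↦
    hσ v fun w ↦ congrArg (fun f : Module.Dual ℝ W ↦ f w) hv
  have hb : Function.Bijective b :=
    ⟨hi, (LinearMap.injective_iff_surjective_of_finrank_eq_finrank
      (Subspace.dual_finrank_eq (K := ℝ) (V := W)).symm).1 hi⟩
  let e := LinearEquiv.ofBijective b hb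
  have hY : Module.Dual.transpose (R := ℝ) (Y : W →ₗ[ℝ] W) = e.conj (X : W →ₗ[ℝ] W) := by
    ext1 f
    obtain ⟨v, rfl⟩ := e.surjective f
    rw [LinearEquiv.conj_apply_apply, LinearEquiv.symm_apply_apply]
    ext w
    exact (h v w).symm
  have h1 := LinearMap.trace_transpose' (R := ℝ) (M := W) (Y : W →ₗ[ℝ] W)
  rw [hY, LinearMap.trace_conj'] at h1
  exact h1

/-- The imaginary part involves tr(J l_p l_q l_r). All four factors are skew for σ, so passing to
the adjoint reverses their order without a sign; by cyclicity and commutation with J the last two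
factors may be exchanged, and the alternating difference vanishes. -/
theorem tripleTrace_complexTraceCLM {σ : W →L[ℝ] W →L[ℝ] ℝ} (hσ : ∀ v, (∀ w, σ v w = 0) → v = 0)
    {J : W →L[ℝ] W} (hJ : ∀ v w, σ (J v) w = - σ v (J w)) {l : ℍ[ℝ] →L[ℝ] W →L[ℝ] W}
    (hl : ∀ q v w, σ (l q v) w = - σ v (l q w)) (hJl : ∀ q, J * l q = l q * J) :
    tripleTrace (complexTraceCLM J) l =
      (((tripleTrace halfTrace l).re : ℝ) : ℂ) := by
  have h (p q r : ℍ[ℝ]) : traceCLM (J * (l p * (l q * l r))) = traceCLM (J * (l p * (l r * l q))) := by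
    have h1 : traceCLM (J * (l p * (l q * l r))) = traceCLM (l r * (l q * (l p * J))) :=
      trace_eq_of_adjoint hσ fun v w ↦ by
        change σ (J (l p (l q (l r v)))) w = σ v (l r (l q (l p (J w))))
        rw [hJ, hl, hl, hl, neg_neg, neg_neg]
    rw [h1, ← hJl p, ← mul_assoc, traceCLM_mul_comm, mul_assoc]
  rw [tripleTrace, tripleTrace, complexTraceCLM_eq, complexTraceCLM_eq, halfTrace_apply,
    halfTrace_apply, h quatI quatJ quatK]
  apply Complex.ext <;> simp

end SymplecticTrace

/-! ### The Chern number of the isotropy bundle. -/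

section Isotropy

variable {E : Type*} [NormedAddCommGroup E] [NormedSpace ℝ E] [FiniteDimensional ℝ E]
  {M : Type*} [TopologicalSpace M] [ChartedSpace E M] [IsManifold 𝓘(ℝ, E) ∞ M] [T2Space M]
  [MulAction SU2 M] [ContMDiffSMul (𝓡 3) 𝓘(ℝ, E) ∞ SU2 M]

/-- Differentiate the invariance of σ at the identity. -/
theorem SmoothRep.skew_liftDeriv {W : Type*} [NormedAddCommGroup W] [NormedSpace ℝ W]
    (ρ : SmoothRep W) {σ : W →L[ℝ] W →L[ℝ] ℝ}
    (hσ : ∀ g v w, σ (ρ.toHom g v) (ρ.toHom g w) = σ v w) (q : ℍ[ℝ]) (v w : W) :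
    σ (ρ.liftDeriv q v) w = - σ v (ρ.liftDeriv q w) := by
  have h (v : W) : HasFDerivAt (fun q ↦ ρ.radialExt q v) (ρ.liftDeriv.flip v) 1 := by
    simpa using ρ.hasFDerivAt_radialExt_one.clm_apply (hasFDerivAt_const v (1 : ℍ[ℝ]))
  have h1 := ((σ.hasFDerivAt.comp 1 (h v)).clm_apply (h w))
  have h2 : (fun q ↦ (σ ∘ fun q ↦ ρ.radialExt q v) q (ρ.radialExt q w)) = fun _ ↦ σ v w :=
    funext fun q ↦ hσ _ v w
  rw [h2] at h1
  have h3 := congrArg (fun L ↦ L q) (h1.unique (hasFDerivAt_const (σ v w) (1 : ℍ[ℝ])))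
  have h4 : ρ.radialExt 1 = 1 := by rw [radialExt, unitQuat_one, map_one]
  simp [h4] at h3
  linarith

/-- J could enter only through the imaginary part of the complex trace, which vanishes for a
symplectic representation. The value thus depends on the real isotropy representation alone, and J
need not be related to any almost complex structure on M. -/
theorem integralS4_isotropyRep {Ω : SymplecticForm E M} (hΩ : Ω.IsInvariant) {x : M}
    (hx : ∀ g : SU2, g • x = x) {J : TangentSpace 𝓘(ℝ, E) x →L[ℝ] TangentSpace 𝓘(ℝ, E) x}
    (hJ : Ω.IsInvariantCompatibleAt x J)
    (D : ComplexConnection (𝓡 4) E (isotropyComplexStructure x hx J)) :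
    integralS4 D.secondChernForm = (1 / (8 * (Real.pi : ℂ) ^ 2)) * ((1 / 4) * -(cutoffConst *
      (((tripleTrace halfTrace (isotropyRep (E := E) x hx).liftDeriv).re : ℝ) : ℂ))) := by
  let J' : E →L[ℝ] E := J
  let σ : E →L[ℝ] E →L[ℝ] ℝ := Ω.form x
  have hJ2 : J' * J' = -1 := by
    ext v
    exact hJ.compatible.sq v
  have hρ (g : SU2) : J' * (isotropyRep (E := E) x hx).toHom g =
      (isotropyRep (E := E) x hx).toHom g * J' := by
    ext v
    exact hJ.commutes g v
  have hσJ (v w : E) : σ (J' v) w = - σ v (J' w) := by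
    have h1 : σ (J' (J' v)) (J' w) = σ (J' v) w := hJ.compatible.invariant (J' v) w
    have h2 : J' (J' v) = -v := hJ.compatible.sq v
    rw [← h1, h2, map_neg]
    rfl
  have hσρ (g : SU2) (v w : E) : σ ((isotropyRep (E := E) x hx).toHom g v)
      ((isotropyRep (E := E) x hx).toHom g w) = σ v w := by
    -- The form at g • x is the form at x only after rewriting along the fixed-point equation, so
    -- the statement is generalized to a variable point z.
    have key : ∀ z : M, z = x → ∀ a b : E,
        (show E →L[ℝ] E →L[ℝ] ℝ from Ω.form z) a b = σ a b := by
      rintro _ rfl a b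
      rfl
    exact (key (g • x) (hx g) _ _).symm.trans (hΩ g x v w)
  refine ((isotropyRep (E := E) x hx).integralS4_secondChernForm hJ2 hρ D).trans ?_
  rw [tripleTrace_complexTraceCLM (σ := σ) (Ω.nondegenerate x) hσJ
    ((isotropyRep (E := E) x hx).skew_liftDeriv hσρ)
    ((isotropyRep (E := E) x hx).commute_liftDeriv hρ)]

end Isotropy
end SU2Action

end

theorem mainTheorem5
    {E : Type*} [NormedAddCommGroup E] [NormedSpace ℝ E] [FiniteDimensional ℝ E]
    {M : Type*} [TopologicalSpace M] [ChartedSpace E M] [IsManifold 𝓘(ℝ, E) ∞ M]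
    [T2Space M] [CompactSpace M] [ConnectedSpace M]
    (Ω : SU2Action.SymplecticForm E M)
    [MulAction SU2Action.SU2 M] [ContMDiffSMul (𝓡 3) 𝓘(ℝ, E) ∞ SU2Action.SU2 M]
    (hΩ : Ω.IsInvariant)
    (𝒥 : Ω.CompatibleAlmostComplexStructure)
    (D : SU2Action.ComplexConnection 𝓘(ℝ, E) E 𝒥.J)
    (hD : SU2Action.IsMonotone D.secondChernForm)
    (x₁ x₂ : M) (hx₁ : ∀ g : SU2Action.SU2, g • x₁ = x₁) (hx₂ : ∀ g : SU2Action.SU2, g • x₂ = x₂)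
    (J₁ : TangentSpace 𝓘(ℝ, E) x₁ →L[ℝ] TangentSpace 𝓘(ℝ, E) x₁)
    (hJ₁ : Ω.IsInvariantCompatibleAt x₁ J₁)
    (J₂ : TangentSpace 𝓘(ℝ, E) x₂ →L[ℝ] TangentSpace 𝓘(ℝ, E) x₂)
    (hJ₂ : Ω.IsInvariantCompatibleAt x₂ J₂)
    (D₁ : SU2Action.ComplexConnection (𝓡 4) E (SU2Action.isotropyComplexStructure x₁ hx₁ J₁))
    (D₂ : SU2Action.ComplexConnection (𝓡 4) E (SU2Action.isotropyComplexStructure x₂ hx₂ J₂)) :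
    SU2Action.integralS4 D₁.secondChernForm = SU2Action.integralS4 D₂.secondChernForm := by
  have h := SU2Action.re_tripleTrace_isotropyRep_eq 𝒥 D hD hx₁ hx₂
  rw [SU2Action.integralS4_isotropyRep hΩ hx₁ hJ₁, SU2Action.integralS4_isotropyRep hΩ hx₂ hJ₂, h]
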